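/- **Lemma (existence and uniqueness of the fixed-point parameters).** Let $N,p$ be natural numbers, let $\boldsymbol{\Sigma}\in\mathbb{R}^{p\times p}$ be a covariance (symmetric positive semidefinite) matrix with positive semidefinite square root $\boldsymbol{\Sigma}^{1/2}$, let $\boldsymbol{\Theta}\in\mathbb{R}^{p\times 2}$ have columns $\boldsymbol{\theta}_1,\boldsymbol{\theta}_2$, let $\boldsymbol{S}_e$ be a real symmetric $2\times 2$ matrix, let $\mathcal{I}_1,\mathcal{I}_2\subseteq\{1,\dots,N\}$ be nonempty, and set $n_k=|\mathcal{I}_k|$, $n_{12}=|\mathcal{I}_1\cap\mathcal{I}_2|$. For each $k\in\{1,2\}$ let $\lambda_k\ge 0$ and let the penalty $\Omega_k:\mathbb{R}^p\to\mathbb{R}$ be one of $$\sqrt{\tfrac{p}{n_k}}\,\tfrac{\lambda_k}{2}\|\boldsymbol{\pi}\|_2^2\ \text{(ridge)},\qquad \tfrac{\lambda_k}{\sqrt{n_k}}\|\boldsymbol{\pi}\|_1\ \text{(Lasso)},\qquad \tfrac{\lambda_k}{\sqrt{n_k}}\inf_{\boldsymbol{v}\in\mathbb{R}^p}\Big\{\tfrac{\sqrt{n_k}}{2\alpha_k}\|\boldsymbol{\pi}-\boldsymbol{v}\|_2^2+\|\boldsymbol{v}\|_1\Big\},\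 \alpha_k>0\ \text{($\alpha_k$-smoothed Lasso)};$$ the case $\lambda_k=0$ is least squares. The two regressions may use different penalties. For $\zeta>0$ and $\boldsymbol{y}\in\mathbb{R}^p$ put $$\eta_k(\boldsymbol{y};\zeta)=\operatorname*{argmin}_{\boldsymbol{\pi}\in\mathbb{R}^p}\Big\{\tfrac12\|\boldsymbol{y}-\boldsymbol{\Sigma}^{1/2}\boldsymbol{\pi}\|_2^2+\tfrac1\zeta\,\Omega_k(\boldsymbol{\pi})\Big\}.$$ For a positive semidefinite $\boldsymbol{S}\in\mathbb{R}^{2\times 2}$ and $\zeta_1,\zeta_2>0$, let $(\boldsymbol{g}_1,\boldsymbol{g}_2)\sim\mathsf{N}(\boldsymbol{0},\boldsymbol{S}\otimes\mathbf{I}_p)$ and $\boldsymbol{y}_k=\boldsymbol{\Sigma}^{1/2}\boldsymbol{\theta}_k+\boldsymbol{g}_k$, let $\widehat{\boldsymbol{\Theta}}\in\mathbb{R}^{p\times 2}$ have columns $\eta_k(\boldsymbol{y}_k;\zeta_k)$, and define $$\mathsf{R}(\boldsymbol{S},\{\zeta_k\})=\mathbb{E}\big[(\widehat{\boldsymbol{\Theta}}-\boldsymbol{\Theta})^\top\boldsymbol{\Sigma}(\widehat{\boldsymbol{\Theta}}-\boldsymbol{\Theta})\big],\qquad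 \mathsf{df}_k(\boldsymbol{S},\{\zeta_k\})=\mathbb{E}\big[\operatorname{div}\boldsymbol{\Sigma}^{1/2}\eta_k(\,\cdot\,;\zeta_k)(\boldsymbol{y}_k)\big].$$ Let $\boldsymbol{N}^-=\begin{pmatrix}1/n_1& n_{12}/(n_1n_2)\\ n_{12}/(n_1n_2)&1/n_2\end{pmatrix}$ and let $\odot$ denote the entrywise product. Assume that $\boldsymbol{\Sigma}$ is invertible, that $\boldsymbol{S}_e\succeq 0$, and that for each $k$ either $n_k>p$ or $\lambda_k>0$. Then there is exactly one pair consisting of a positive semidefinite matrix $\boldsymbol{S}_g\in\mathbb{R}^{2\times2}$ and numbers $\zeta_1,\zeta_2>0$ such that $$\boldsymbol{S}_g=\boldsymbol{N}^-\odot\big(\boldsymbol{S}_e+\mathsf{R}(\boldsymbol{S}_g,\{\zeta_k\})\big),\qquad \zeta_k=1-\frac{\mathsf{df}_k(\boldsymbol{S}_g,\{\zeta_k\})}{n_k},\quad k=1,2.$$ At this solution everything in the equations is well defined: the minimizers exist and are unique, $\boldsymbol{\Sigma}^{1/2}\eta_k(\,\cdot\,;\zeta_k)$ is differentiable at $\boldsymbol{y}_k$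 almost surely, and the random variables whose expectations are taken are integrable. -/

import Mathlib

open MeasureTheory ProbabilityTheory
open scoped Matrix MatrixOrder Kronecker

namespace SimReg

/-- The type of penalized regression. Ordinary least squares is the case of a vanishing
regularization parameter. -/
inductive Method : Type
  | ridge : Method
  | lasso : Method
  | smoothedLasso (α : ℝ) (hα : 0 < α) : Method

/-- Squared Euclidean norm. -/
def sqNorm {p : ℕ} (v : Fin p → ℝ) : ℝ := ∑ j, v j ^ 2

/-- The `ℓ¹` norm. -/
def l1Norm {p : ℕ} (v : Fin p → ℝ) : ℝ := ∑ j, |v j|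

/-- The Moreau envelope `M_t` of the `ℓ¹` norm, for `t > 0`. -/
noncomputable def moreauL1 {p : ℕ} (t : ℝ) (x : Fin p → ℝ) : ℝ :=
  ⨅ v : Fin p → ℝ, (1 / (2 * t) * sqNorm (x - v) + l1Norm v)

/-- The penalty `Ω` of a regression on `n` samples with regularization parameter `lam`. -/
noncomputable def penalty {p : ℕ} (m : Method) (n : ℕ) (lam : ℝ) (x : Fin p → ℝ) : ℝ :=
  match m with
  | .ridge => √((p : ℝ) / (n : ℝ)) * (lam / 2) * sqNorm x
  | .lasso => lam / √(n : ℝ) * l1Norm x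
  | .smoothedLasso α _ => lam / √(n : ℝ) * moreauL1 (α / √(n : ℝ)) x

/-- The data of two simultaneous regressions (indexed by `Fin 2`) on `N` units with `p` covariates:
population covariance, matrix of parameters (the columns are `θ₁, θ₂`), noise covariance, the
samples used, the methods and the regularization parameters. -/
structure Model (N p : ℕ) where
  Sigma : Matrix (Fin p) (Fin p) ℝ
  Theta : Matrix (Fin p) (Fin 2) ℝ
  Se : Matrix (Fin 2) (Fin 2) ℝ
  I : Fin 2 → Finset (Fin N)
  method : Fin 2 → Method
  lam : Fin 2 → ℝ

namespace Model

variable {N p : ℕ} (M : Model N p)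

/-- The sample sizes `n_k`. -/
def n (k : Fin 2) : ℕ := (M.I k).card

/-- The size `n₁₂` of the overlap. -/
def n12 : ℕ := (M.I 0 ∩ M.I 1).card

/-- The positive semidefinite square root `Σ^{1/2}`. -/
noncomputable def sqrtSigma : Matrix (Fin p) (Fin p) ℝ := CFC.sqrt M.Sigma

/-- The matrix `N⁻`. -/
noncomputable def Nminus : Matrix (Fin 2) (Fin 2) ℝ :=
  !![1 / (M.n 0 : ℝ), (M.n12 : ℝ) / ((M.n 0 : ℝ) * (M.n 1 : ℝ));
     (M.n12 : ℝ) / ((M.n 0 : ℝ) * (M.n 1 : ℝ)), 1 / (M.n 1 : ℝ)]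

/-- The objective minimized by the `k`-th estimator in the fixed-design model. -/
noncomputable def objective (k : Fin 2) (z : ℝ) (y x : Fin p → ℝ) : ℝ :=
  1 / 2 * sqNorm (y - M.sqrtSigma *ᵥ x) + 1 / z * penalty (M.method k) (M.n k) (M.lam k) x

/-- `η_k(y; z)`: the minimizer of the objective. -/
noncomputable def eta (k : Fin 2) (z : ℝ) (y : Fin p → ℝ) : Fin p → ℝ :=
  Classical.epsilon fun x => IsMinOn (M.objective k z y) Set.univ x

/-- The law `N(0, S ⊗ I_p)` of the noise `(g₁, g₂)`, the coordinate `(k, j)` being the `j`-th entry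
of `g_k`. -/
noncomputable def noiseLaw (p : ℕ) (S : Matrix (Fin 2) (Fin 2) ℝ) :
    Measure (EuclideanSpace ℝ (Fin 2 × Fin p)) :=
  multivariateGaussian 0 (S ⊗ₖ (1 : Matrix (Fin p) (Fin p) ℝ))

/-- The `k`-th fixed-design observation `y_k = Σ^{1/2} θ_k + g_k`. -/
noncomputable def obs (k : Fin 2) (g : EuclideanSpace ℝ (Fin 2 × Fin p)) : Fin p → ℝ :=
  M.sqrtSigma *ᵥ (fun j => M.Theta j k) + fun j => g (k, j)

/-- The estimates in the fixed-design model, as the columns of a matrix. -/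
noncomputable def ThetaHat (ζ : Fin 2 → ℝ) (g : EuclideanSpace ℝ (Fin 2 × Fin p)) :
    Matrix (Fin p) (Fin 2) ℝ :=
  Matrix.of fun j k => M.eta k (ζ k) (M.obs k g) j

/-- The matrix `(Θ̂ - Θ)ᵀ Σ (Θ̂ - Θ)`. -/
noncomputable def errorGram (ζ : Fin 2 → ℝ) (g : EuclideanSpace ℝ (Fin 2 × Fin p)) :
    Matrix (Fin 2) (Fin 2) ℝ :=
  (M.ThetaHat ζ g - M.Theta)ᵀ * M.Sigma * (M.ThetaHat ζ g - M.Theta)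

/-- Second moments of the prediction error, `R(S, ζ) = E[(Θ̂ - Θ)ᵀ Σ (Θ̂ - Θ)]`. -/
noncomputable def R (S : Matrix (Fin 2) (Fin 2) ℝ) (ζ : Fin 2 → ℝ) : Matrix (Fin 2) (Fin 2) ℝ :=
  Matrix.of fun a b => ∫ g, M.errorGram ζ g a b ∂(noiseLaw p S)

/-- The map `y ↦ Σ^{1/2} η_k(y; z)`. -/
noncomputable def fit (k : Fin 2) (z : ℝ) (y : Fin p → ℝ) : Fin p → ℝ :=
  M.sqrtSigma *ᵥ M.eta k z y

/-- The divergence `∑ⱼ ∂ⱼ Fⱼ` of a vector field on `ℝᵖ`. -/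
noncomputable def divergence (F : (Fin p → ℝ) → (Fin p → ℝ)) (y : Fin p → ℝ) : ℝ :=
  ∑ j, fderiv ℝ F y (Pi.single j 1) j

/-- Degrees of freedom, `df_k(S, ζ) = E[div Σ^{1/2} η_k(y_k; ζ_k)]`. -/
noncomputable def df (S : Matrix (Fin 2) (Fin 2) ℝ) (ζ : Fin 2 → ℝ) (k : Fin 2) : ℝ :=
  ∫ g, divergence (M.fit k (ζ k)) (M.obs k g) ∂(noiseLaw p S)

/-- `(S, ζ)`, with `S` a covariance matrix and positive `ζ₁, ζ₂`, solves the fixed-point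
equations. -/
structure IsFixedPoint (S : Matrix (Fin 2) (Fin 2) ℝ) (ζ : Fin 2 → ℝ) : Prop where
  posSemidef : S.PosSemidef
  zeta_pos : ∀ k, 0 < ζ k
  eq_S : S = M.Nminus ⊙ (M.Se + M.R S ζ)
  eq_zeta : ∀ k, ζ k = 1 - M.df S ζ k / (M.n k : ℝ)

/-- All minimizers, derivatives and expectations in the fixed-point equations exist
at `(S, ζ)`. -/
structure IsWellDefinedAt (S : Matrix (Fin 2) (Fin 2) ℝ) (ζ : Fin 2 → ℝ) : Prop where
  existsUnique_min : ∀ k y, ∃! x, IsMinOn (M.objective k (ζ k) y) Set.univ x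
  integrable_errorGram : ∀ a b, Integrable (fun g => M.errorGram ζ g a b) (noiseLaw p S)
  ae_differentiableAt : ∀ k, ∀ᵐ g ∂(noiseLaw p S),
    DifferentiableAt ℝ (M.fit k (ζ k)) (M.obs k g)
  integrable_div : ∀ k,
    Integrable (fun g => divergence (M.fit k (ζ k)) (M.obs k g)) (noiseLaw p S)

end Model

end SimReg

/-! The substitution `x = Σ^{1/2} π` turns `Σ^{1/2} η_k(·; ζ)` into the proximal map of `f_k / ζ`,
where `f_k(x) = Ω_k(Σ^{-1/2} x)` is convex, nonnegative and zero at the origin. Proximal maps are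
firmly nonexpansive, hence Lipschitz. So Gaussian moments are finite, Rademacher's theorem gives
almost sure differentiability at positive noise level, and Stein's identity replaces `df_k` by `E⟨g,
error⟩ / τ_k` whenever `τ_k² = S_kk > 0`. The diagonal equations and the `ζ`-equations of regression
`k` involve only `(τ_k, ζ_k)`, so the system splits (`isFixedPoint_iff`) into two marginal systems
and one scalar equation for the covariance `ρ = S_01`.

Marginal uniqueness (`MarginalSol.unique`): couple two solutions through the same Gaussian vector
and integrate the monotonicity inequality of the subdifferential. The fixed-point equations turn it
into a sum of two nonnegative terms that is at most zero, the sign of one of them being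
Cauchy-Schwarz; equality everywhere identifies the solutions.

Marginal existence (`exists_marginalSol`): a combination of the two equations is strictly increasing
in `z`, so it defines a continuous curve `z = r(τ)`. Along this curve the remaining equation changes
sign between small and large `τ`, by the linear growth of a convex function that vanishes only at
the origin. Least squares, where `f_k = 0`, is solved explicitly.

If both the noise and the signal of a regression vanish, then `τ = 0`, Stein's identity says
nothing, and `df` is the divergence of the fit at the origin. There the proximal map is locally
linear: zero for the Lasso, the resolvent of a quadratic form for the other penalties. The resulting
equation for `z` is solved by applying the nondegenerate marginal theorem to the quadratic form
itself.

Covariance (`existsUnique_covariance`): for fixed marginals, Cauchy-Schwarz and `n₁₂ ≤ min(n₁, n₂)`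
make the right-hand side map `[-τ₁τ₂, τ₁τ₂]` into itself. Firm nonexpansiveness bounds its squared
Lipschitz constant by `(1 - ζ₁)(1 - ζ₂) < 1` when both `τ_k` are positive. -/

namespace SimReg

/-! ### Proximal maps: monotonicity, nonexpansiveness, continuity, existence -/

section Prox

open Filter Topology
open scoped RealInnerProductSpace

variable {E : Type*} [NormedAddCommGroup E] [InnerProductSpace ℝ E]

/-- `x` is the proximal point of `f / z` at `y`, in the form of a variational inequality. -/
def ProxAt (f : E → ℝ) (z : ℝ) (y x : E) : Prop :=
  ∀ w, f x + z * ⟪y - x, w - x⟫ ≤ f w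

/-- `ProxAt` says that `z • (y - x)` is a subgradient of `f` at `x`, so this is monotonicity of the
subdifferential: test each inequality at the other point and add. Allowing `z ≠ z'` is essential for
the uniqueness proof. -/
lemma ProxAt.inner_le {f : E → ℝ} {z z' : ℝ} {y y' x x' : E} (h : ProxAt f z y x)
    (h' : ProxAt f z' y' x') : 0 ≤ ⟪z • (y - x) - z' • (y' - x'), x - x'⟫ := by
  have h1 := h x'
  have h2 := h' x
  have e : ⟪y - x, x' - x⟫ = - ⟪y - x, x - x'⟫ := by rw [← inner_neg_right, neg_sub]
  rw [inner_sub_left, real_inner_smul_left, real_inner_smul_left]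
  rw [e] at h1
  linarith

lemma ProxAt.firm {f : E → ℝ} {z : ℝ} (hz : 0 < z) {y y' x x' : E} (h : ProxAt f z y x)
    (h' : ProxAt f z y' x') : ‖x - x'‖ ^ 2 ≤ ⟪x - x', y - y'⟫ := by
  have h1 := h.inner_le h'
  rw [← smul_sub, real_inner_smul_left] at h1
  have h2 := nonneg_of_mul_nonneg_right h1 hz
  rw [show y - x - (y' - x') = (y - y') - (x - x') by abel, inner_sub_left,
    real_inner_self_eq_norm_sq, real_inner_comm] at h2
  linarith

lemma ProxAt.norm_sub_le {f : E → ℝ} {z : ℝ} (hz : 0 < z) {y y' x x' : E} (h : ProxAt f z y x)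
    (h' : ProxAt f z y' x') : ‖x - x'‖ ≤ ‖y - y'‖ := by
  have h1 := h.firm hz h'
  have h2 := real_inner_le_norm (x - x') (y - y')
  rcases (norm_nonneg (x - x')).eq_or_lt with h3 | h3
  · rw [← h3]; positivity
  · nlinarith

lemma ProxAt.unique {f : E → ℝ} {z : ℝ} (hz : 0 < z) {y x x' : E} (h : ProxAt f z y x)
    (h' : ProxAt f z y x') : x = x' := by
  have := h.norm_sub_le hz h'
  rw [sub_self, norm_zero, norm_le_zero_iff, sub_eq_zero] at this
  exact this

lemma ProxAt.norm_sub_le_param {f : E → ℝ} {z z' : ℝ} {y x x' : E}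
    (h : ProxAt f z y x) (h' : ProxAt f z' y x') : z' * ‖x - x'‖ ≤ |z - z'| * ‖y - x‖ := by
  have h1 := h.inner_le h'
  rw [show z • (y - x) - z' • (y - x') = (z - z') • (y - x) - z' • (x - x') by
    simp only [smul_sub, sub_smul]; abel, inner_sub_left, real_inner_smul_left,
    real_inner_smul_left, real_inner_self_eq_norm_sq] at h1
  have h2 : (z - z') * ⟪y - x, x - x'⟫ ≤ |z - z'| * (‖y - x‖ * ‖x - x'‖) := by
    calc _ ≤ |(z - z') * ⟪y - x, x - x'⟫| := le_abs_self _
      _ = |z - z'| * |⟪y - x, x - x'⟫| := abs_mul _ _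
      _ ≤ _ := by gcongr; exact abs_real_inner_le_norm _ _
  rcases (norm_nonneg (x - x')).eq_or_lt with h3 | h3
  · rw [← h3, mul_zero]; positivity
  · nlinarith

lemma ProxAt.isMin {f : E → ℝ} {z : ℝ} (hz : 0 < z) {y x : E} (h : ProxAt f z y x) (w : E) :
    1 / 2 * ‖y - x‖ ^ 2 + 1 / z * f x ≤ 1 / 2 * ‖y - w‖ ^ 2 + 1 / z * f w := by
  have h1 := h w
  have h2 : 1 / z * (f x + z * ⟪y - x, w - x⟫) ≤ 1 / z * f w := by gcongr
  have h3 : 1 / z * (f x + z * ⟪y - x, w - x⟫) = 1 / z * f x + ⟪y - x, w - x⟫ := by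
    field_simp
  have h4 : ‖y - w‖ ^ 2 = ‖y - x‖ ^ 2 - 2 * ⟪y - x, w - x⟫ + ‖w - x‖ ^ 2 := by
    rw [← norm_sub_sq_real]; congr 2; abel
  nlinarith [sq_nonneg ‖w - x‖]

lemma proxAt_of_isMin {f : E → ℝ} (hf : ConvexOn ℝ Set.univ f) {z : ℝ} (hz : 0 < z) {y x : E}
    (h : ∀ w, 1 / 2 * ‖y - x‖ ^ 2 + 1 / z * f x ≤ 1 / 2 * ‖y - w‖ ^ 2 + 1 / z * f w) :
    ProxAt f z y x := by
  intro w
  -- Compare the minimizer with points at fraction `t` of the segment towards `w`: the quadratic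
  -- remainder is of order `t²`, so it disappears after division by `t` and `t → 0`.
  have key : ∀ t : ℝ, 0 < t → t ≤ 1 →
      f x + z * ⟪y - x, w - x⟫ - f w ≤ t * (z / 2 * ‖w - x‖ ^ 2) := by
    intro t ht ht1
    have h1 := h (x + t • (w - x))
    have h2 : f (x + t • (w - x)) ≤ (1 - t) * f x + t * f w := by
      have := hf.2 (Set.mem_univ x) (Set.mem_univ w) (sub_nonneg.2 ht1) ht.le (by ring)
      rw [show x + t • (w - x) = (1 - t) • x + t • w by module]
      simpa only [smul_eq_mul] using this
    have h4 : ‖y - (x + t • (w - x))‖ ^ 2 =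
        ‖y - x‖ ^ 2 - 2 * (t * ⟪y - x, w - x⟫) + t ^ 2 * ‖w - x‖ ^ 2 := by
      rw [← sub_sub, norm_sub_sq_real, real_inner_smul_right, norm_smul, mul_pow,
        Real.norm_eq_abs, sq_abs]
    rw [h4] at h1
    have h5 : 1 / z * f (x + t • (w - x)) ≤ 1 / z * ((1 - t) * f x + t * f w) := by gcongr
    have h6 : t * (1 / z * (f x - f w) + ⟪y - x, w - x⟫) ≤ t * (t * ‖w - x‖ ^ 2 / 2) := by
      nlinarith
    have h7 := le_of_mul_le_mul_left h6 ht
    have h8 : z * (1 / z * (f x - f w) + ⟪y - x, w - x⟫) ≤ z * (t * ‖w - x‖ ^ 2 / 2) := by gcongr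
    have h9 : z * (1 / z * (f x - f w) + ⟪y - x, w - x⟫) = f x - f w + z * ⟪y - x, w - x⟫ := by
      field_simp
    linarith
  have lim : Tendsto (fun t : ℝ => t * (z / 2 * ‖w - x‖ ^ 2)) (𝓝[>] 0) (𝓝 0) := by
    have : Tendsto (fun t : ℝ => t * (z / 2 * ‖w - x‖ ^ 2)) (𝓝 0) (𝓝 (0 * (z / 2 * ‖w - x‖ ^ 2))) :=
      (continuous_id.mul continuous_const).tendsto 0
    rw [zero_mul] at this
    exact this.mono_left nhdsWithin_le_nhds
  have := ge_of_tendsto lim (b := f x + z * ⟪y - x, w - x⟫ - f w) (by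
    filter_upwards [Ioc_mem_nhdsGT (zero_lt_one (α := ℝ))] with t ht
    exact key t ht.1 ht.2)
  linarith

lemma continuous_of_convexOn [FiniteDimensional ℝ E] {f : E → ℝ} (hf : ConvexOn ℝ Set.univ f) :
    Continuous f := hf.locallyLipschitz.continuous

lemma exists_proxAt [FiniteDimensional ℝ E] {f : E → ℝ} (hf : ConvexOn ℝ Set.univ f)
    (hf0 : ∀ x, 0 ≤ f x) {z : ℝ} (hz : 0 < z) (y : E) : ∃ x, ProxAt f z y x := by
  have hc : Continuous fun w => 1 / 2 * ‖y - w‖ ^ 2 + 1 / z * f w := by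
    have := continuous_of_convexOn hf
    fun_prop
  have hlim : Tendsto (fun w => 1 / 2 * ‖y - w‖ ^ 2 + 1 / z * f w) (cocompact E) atTop := by
    have h1 : Tendsto (fun w : E => ‖y - w‖) (cocompact E) atTop := by
      refine tendsto_atTop_mono (f := fun w => ‖w‖ - ‖y‖) (fun w => ?_)
        (tendsto_atTop_add_const_right _ _ (tendsto_norm_cocompact_atTop (E := E)))
      rw [norm_sub_rev]
      exact norm_sub_norm_le _ _
    have h2 : Tendsto (fun w : E => 1 / 2 * ‖y - w‖ ^ 2) (cocompact E) atTop :=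
      ((tendsto_pow_atTop two_ne_zero).comp h1).const_mul_atTop (by norm_num)
    refine tendsto_atTop_mono (fun w => ?_) h2
    have := hf0 w
    have : 0 ≤ 1 / z * f w := by positivity
    linarith
  obtain ⟨x, hx⟩ := hc.exists_forall_le hlim
  exact ⟨x, proxAt_of_isMin hf hz hx⟩

/-- By convexity along rays from the origin, beyond the sphere of radius `r` the function lies above
the linear function through its minimum on the sphere, which is positive by compactness. The radius
is free because small noise requires one below the size of the signal. -/
lemma exists_coercive [FiniteDimensional ℝ E] {f : E → ℝ} (hf : ConvexOn ℝ Set.univ f)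
    (h0 : f 0 = 0) (hpos : ∀ x, x ≠ 0 → 0 < f x) {r : ℝ} (hr : 0 < r) :
    ∃ c > 0, ∀ x, c * (‖x‖ - r) ≤ f x := by
  have hnn : ∀ x, 0 ≤ f x := fun x => by
    rcases eq_or_ne x 0 with rfl | h
    · exact h0.ge
    · exact (hpos x h).le
  rcases (Metric.sphere (0 : E) r).eq_empty_or_nonempty with hS | hS
  · have hsub : ∀ x : E, x = 0 := by
      intro x
      by_contra hx
      have hx' : 0 < ‖x‖ := norm_pos_iff.2 hx
      have : (r / ‖x‖) • x ∈ Metric.sphere (0 : E) r := by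
        simp [norm_smul, abs_of_pos hr, hx'.ne']
      rw [hS] at this
      exact this
    refine ⟨1, one_pos, fun x => ?_⟩
    rw [hsub x, h0, norm_zero]
    linarith
  · obtain ⟨m, hm, hmin⟩ := (isCompact_sphere (0 : E) r).exists_isMinOn hS
      (continuous_of_convexOn hf).continuousOn
    have hm0 : m ≠ 0 := by
      rintro rfl
      simp at hm
      linarith
    refine ⟨f m / r, div_pos (hpos m hm0) hr, fun x => ?_⟩
    rcases le_or_gt ‖x‖ r with hx | hx
    · refine le_trans ?_ (hnn x)
      exact mul_nonpos_of_nonneg_of_nonpos (div_nonneg (hnn m) hr.le) (by linarith)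
    · have hx' : 0 < ‖x‖ := hr.trans hx
      have h1 : (r / ‖x‖) • x ∈ Metric.sphere (0 : E) r := by
        simp [norm_smul, abs_of_pos hr, hx'.ne']
      have h2 : f m ≤ f ((r / ‖x‖) • x) := hmin h1
      have h3 : f ((r / ‖x‖) • x) ≤ r / ‖x‖ * f x := by
        have := hf.2 (Set.mem_univ 0) (Set.mem_univ x) (sub_nonneg.2 ((div_le_one hx').2 hx.le))
          (by positivity : 0 ≤ r / ‖x‖) (by ring)
        simpa [h0] using this
      have h4 : f m * ‖x‖ ≤ r * f x := by
        have := h2.trans h3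
        rw [div_mul_eq_mul_div, le_div_iff₀ hx'] at this
        exact this
      rw [div_mul_eq_mul_div, div_le_iff₀ hr]
      have := hpos m hm0
      nlinarith

/-- `F z` is the proximal map of `f / z` for every `z > 0`. -/
def IsProx (f : E → ℝ) (F : ℝ → E → E) : Prop :=
  ∀ z, 0 < z → ∀ y, ProxAt f z y (F z y)

variable {f : E → ℝ} {F : ℝ → E → E}

lemma IsProx.lipschitz (hF : IsProx f F) {z : ℝ} (hz : 0 < z) : LipschitzWith 1 (F z) :=
  LipschitzWith.of_dist_le_mul fun y y' => by
    simpa [dist_eq_norm] using (hF z hz y).norm_sub_le hz (hF z hz y')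

lemma IsProx.map_zero (hF : IsProx f F) (h0 : f 0 = 0) (hnn : ∀ x, 0 ≤ f x) {z : ℝ} (hz : 0 < z) :
    F z 0 = 0 := by
  refine (hF z hz 0).unique hz fun w => ?_
  simpa [h0] using hnn w

lemma IsProx.norm_le (hF : IsProx f F) (h0 : f 0 = 0) (hnn : ∀ x, 0 ≤ f x) {z : ℝ} (hz : 0 < z)
    (y : E) : ‖F z y‖ ≤ ‖y‖ := by
  have := (hF z hz y).norm_sub_le hz (hF z hz 0)
  rwa [hF.map_zero h0 hnn hz, sub_zero, sub_zero] at this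

lemma IsProx.continuousOn (hF : IsProx f F) :
    ContinuousOn (fun q : ℝ × E => F q.1 q.2) (Set.Ioi 0 ×ˢ Set.univ) := by
  rintro ⟨z, y⟩ ⟨hz, -⟩
  have hz : 0 < z := hz
  refine ContinuousAt.continuousWithinAt ?_
  rw [ContinuousAt, tendsto_iff_norm_sub_tendsto_zero]
  -- Move `q.2` to `y` at parameter `q.1`, then `q.1` to `z` at the point `y`. The second move costs
  -- a multiple of `‖y - F q.1 y‖`, which is bounded through `‖y - F z y‖` by the same parameter
  -- estimate with the roles exchanged.
  have hb : Tendsto (fun q : ℝ × E => ‖q.2 - y‖ + |q.1 - z| / z * (‖y - F z y‖ +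
      ‖y - F z y‖ * |q.1 - z| / q.1)) (𝓝 (z, y)) (𝓝 0) := by
    have : ContinuousAt (fun q : ℝ × E => ‖q.2 - y‖ + |q.1 - z| / z * (‖y - F z y‖ +
      ‖y - F z y‖ * |q.1 - z| / q.1)) (z, y) := by
      refine ContinuousAt.add (by fun_prop) (ContinuousAt.mul (by fun_prop) (ContinuousAt.add
        (by fun_prop) (ContinuousAt.div (by fun_prop) (by fun_prop) hz.ne')))
    simpa [ContinuousAt] using this
  refine squeeze_zero' (Eventually.of_forall fun _ => norm_nonneg _) ?_ hb
  have hev : ∀ᶠ q : ℝ × E in 𝓝 (z, y), 0 < q.1 :=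
    (continuous_fst.tendsto (z, y)).eventually (lt_mem_nhds hz)
  filter_upwards [hev] with q hq
  have h1 := (hF q.1 hq q.2).norm_sub_le hq (hF q.1 hq y)
  have h2 := (hF q.1 hq y).norm_sub_le_param (hF z hz y)
  have h3 := (hF z hz y).norm_sub_le_param (hF q.1 hq y)
  have h4 : ‖y - F q.1 y‖ ≤ ‖y - F z y‖ + ‖F z y - F q.1 y‖ := by
    have := norm_add_le (y - F z y) (F z y - F q.1 y)
    simpa using this
  have h5 : ‖F z y - F q.1 y‖ ≤ ‖y - F z y‖ * |q.1 - z| / q.1 := by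
    rw [le_div_iff₀ hq, abs_sub_comm]
    linarith
  have h6 : ‖F q.1 y - F z y‖ ≤ |q.1 - z| / z * ‖y - F q.1 y‖ := by
    rw [div_mul_eq_mul_div, le_div_iff₀ hz]
    linarith
  calc ‖F q.1 q.2 - F z y‖ ≤ ‖F q.1 q.2 - F q.1 y‖ + ‖F q.1 y - F z y‖ := by
        have := norm_add_le (F q.1 q.2 - F q.1 y) (F q.1 y - F z y)
        simpa using this
    _ ≤ _ := by
        refine add_le_add h1 (h6.trans ?_)
        gcongr
        exact h4.trans (by gcongr)

end Prox


/-! ### Stein's identity for Lipschitz functions -/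

section Stein

open Filter Topology

lemma hasDerivAt_gaussianPDFReal (x : ℝ) :
    HasDerivAt (gaussianPDFReal 0 1) (-x * gaussianPDFReal 0 1 x) x := by
  have h : HasDerivAt (fun y : ℝ => -(y - 0) ^ 2 / (2 * ((1 : NNReal) : ℝ))) (-x) x := by
    have := (((hasDerivAt_id x).sub_const 0).pow 2).neg.div_const (2 * ((1 : NNReal) : ℝ))
    refine this.congr_deriv ?_
    simp
    ring
  have := (h.exp.const_mul (√(2 * Real.pi * ((1 : NNReal) : ℝ)))⁻¹)
  refine (this.congr_deriv ?_)
  simp only [gaussianPDFReal]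
  ring

/-- A Lipschitz function grows at most affinely, so this kills the boundary terms of the integration
by parts. The crude bound `exp(-R²/2) ≤ 2 / R²` suffices. -/
lemma tendsto_affine_mul_gaussianPDFReal (a K : ℝ) :
    Tendsto (fun R : ℝ => (a + K * R) * gaussianPDFReal 0 1 R) atTop (𝓝 0) := by
  rw [tendsto_zero_iff_norm_tendsto_zero]
  have hlim : Tendsto (fun R : ℝ => 2 * (|a| + |K|) * (√(2 * Real.pi * ((1 : NNReal) : ℝ)))⁻¹ * R⁻¹)
      atTop (𝓝 0) := by
    simpa using tendsto_inv_atTop_zero.const_mul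
      (2 * (|a| + |K|) * (√(2 * Real.pi * ((1 : NNReal) : ℝ)))⁻¹)
  refine squeeze_zero' (Eventually.of_forall fun _ => norm_nonneg _) ?_ hlim
  filter_upwards [eventually_ge_atTop 1] with R hR
  have h1 : Real.exp (-(R - 0) ^ 2 / (2 * ((1 : NNReal) : ℝ))) ≤ 2 * (R ^ 2)⁻¹ := by
    rw [show -(R - 0) ^ 2 / (2 * ((1 : NNReal) : ℝ)) = -(R ^ 2 / 2) by simp; ring, Real.exp_neg,
      ← div_eq_mul_inv, inv_eq_one_div, div_le_div_iff₀ (Real.exp_pos _) (by positivity)]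
    have := Real.add_one_le_exp (R ^ 2 / 2)
    linarith
  have h2 : |a + K * R| ≤ (|a| + |K|) * R := by
    have h3 := abs_add_le a (K * R)
    rw [abs_mul, abs_of_pos (by linarith : 0 < R)] at h3
    nlinarith [abs_nonneg a, abs_nonneg K]
  simp only [gaussianPDFReal]
  rw [norm_mul, norm_mul, Real.norm_eq_abs, Real.norm_eq_abs, Real.norm_eq_abs,
    abs_of_pos (Real.exp_pos _), abs_of_nonneg (a := (√(2 * Real.pi * ((1 : NNReal) : ℝ)))⁻¹)
    (by positivity)]
  calc _ ≤ ((|a| + |K|) * R) * ((√(2 * Real.pi * ((1 : NNReal) : ℝ)))⁻¹ * (2 * (R ^ 2)⁻¹)) := by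
        gcongr
    _ = _ := by field_simp

lemma integrable_mul_gaussianPDFReal {h : ℝ → ℝ} (hh : Integrable h (gaussianReal 0 1)) :
    Integrable fun x => gaussianPDFReal 0 1 x * h x := by
  rw [gaussianReal_of_var_ne_zero 0 one_ne_zero,
    integrable_withDensity_iff_integrable_smul₀' (measurable_gaussianPDF _ _).aemeasurable
      (ae_of_all _ fun _ => gaussianPDF_lt_top)] at hh
  simpa [gaussianPDF, ENNReal.toReal_ofReal (gaussianPDFReal_nonneg _ _ _)] using hh

lemma memLp_two_of_lipschitz {E F : Type*} [NormedAddCommGroup E] [MeasurableSpace E]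
    [BorelSpace E] [NormedAddCommGroup F] [SecondCountableTopology E]
    {μ : Measure E} [IsFiniteMeasure μ] (hμ : MemLp id 2 μ) {K : NNReal} {g : E → F}
    (hg : LipschitzWith K g) : MemLp g 2 μ := by
  refine MemLp.mono' ((hμ.norm.const_mul (K : ℝ)).add (memLp_const ‖g 0‖))
    hg.continuous.aestronglyMeasurable (ae_of_all _ fun x => ?_)
  have h1 := hg.dist_le_mul x 0
  rw [dist_eq_norm, dist_zero_right] at h1
  have h2 := norm_add_le (g x - g 0) (g 0)
  rw [sub_add_cancel] at h2
  simp only [Pi.add_apply, id]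
  linarith

/-- Stein's identity for Lipschitz functions of a standard Gaussian variable. -/
lemma integral_id_mul_gaussianReal {K : NNReal} {g : ℝ → ℝ} (hg : LipschitzWith K g) :
    ∫ x, x * g x ∂gaussianReal 0 1 = ∫ x, deriv g x ∂gaussianReal 0 1 := by
  set φ := gaussianPDFReal 0 1 with hφ
  have hφd : deriv φ = fun x => -x * φ x := funext fun x => (hasDerivAt_gaussianPDFReal x).deriv
  have hL2 : MemLp (id : ℝ → ℝ) 2 (gaussianReal 0 1) := IsGaussian.memLp_two_id
  have hint1 : Integrable (fun x => φ x * (x * g x)) :=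
    integrable_mul_gaussianPDFReal (hL2.integrable_mul (memLp_two_of_lipschitz hL2 hg))
  have hdm : Measurable (deriv g) := measurable_deriv g
  have hint2 : Integrable (fun x => φ x * deriv g x) := by
    refine integrable_mul_gaussianPDFReal ((integrable_const (K : ℝ)).mono'
      hdm.aestronglyMeasurable (ae_of_all _ fun x => ?_))
    exact norm_deriv_le_of_lipschitz hg
  rw [integral_gaussianReal_eq_integral_smul one_ne_zero,
    integral_gaussianReal_eq_integral_smul one_ne_zero]
  simp only [smul_eq_mul]
  -- Integration by parts on `[-R, R]` with `φ' = -xφ`; a Lipschitz function is absolutely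
  -- continuous, so no pointwise differentiability is needed.
  have hac : ∀ R : ℝ, ∫ x in (-R)..R, φ x * (x * g x) =
      -(g R * φ R - g (-R) * φ (-R)) + ∫ x in (-R)..R, φ x * deriv g x := by
    intro R
    have h1 : AbsolutelyContinuousOnInterval g (-R) R :=
      (hg.lipschitzOnWith (s := Set.uIcc (-R) R)).absolutelyContinuousOnInterval
    have h2 : AbsolutelyContinuousOnInterval φ (-R) R := by
      refine ContDiffOn.absolutelyContinuousOnInterval ?_
      have : ContDiff ℝ 1 φ := by
        rw [hφ]
        unfold gaussianPDFReal
        fun_prop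
      exact this.contDiffOn
    have h3 := h1.integral_mul_deriv_eq_deriv_mul h2
    rw [hφd] at h3
    have h4 : ∫ x in (-R)..R, φ x * (x * g x) = - ∫ x in (-R)..R, g x * (-x * φ x) := by
      rw [← intervalIntegral.integral_neg]
      congr 1; ext x; ring
    have h5 : ∫ x in (-R)..R, φ x * deriv g x = ∫ x in (-R)..R, deriv g x * φ x := by
      congr 1; ext x; ring
    rw [h4, h3, h5]; ring
  have hlim1 := intervalIntegral_tendsto_integral hint1 tendsto_neg_atTop_atBot tendsto_id
  have hlim2 := intervalIntegral_tendsto_integral hint2 tendsto_neg_atTop_atBot tendsto_id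
  have hb : Tendsto (fun R : ℝ => -(g R * φ R - g (-R) * φ (-R))) atTop (𝓝 0) := by
    have hev : ∀ x : ℝ, φ (-x) = φ x := fun x => by simp [hφ, gaussianPDFReal]
    have h0 := (tendsto_affine_mul_gaussianPDFReal |g 0| K).const_mul 2
    rw [mul_zero] at h0
    refine squeeze_zero_norm' ?_ h0
    filter_upwards [eventually_ge_atTop 0] with R hR
    have hle : ∀ x : ℝ, |x| = R → |g x| ≤ |g 0| + K * R := fun x hx => by
      have h1 := hg.dist_le_mul x 0
      rw [Real.dist_eq, Real.dist_eq, sub_zero, hx] at h1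
      have h2 := abs_add_le (g x - g 0) (g 0)
      rw [sub_add_cancel] at h2
      linarith
    have hφ0 : 0 ≤ φ R := gaussianPDFReal_nonneg _ _ _
    rw [hev, ← sub_mul, norm_neg, norm_mul, Real.norm_eq_abs, Real.norm_eq_abs,
      abs_of_nonneg hφ0, ← mul_assoc]
    gcongr
    have h3 := hle R (abs_of_nonneg hR)
    have h4 := hle (-R) (by rw [abs_neg, abs_of_nonneg hR])
    have h5 := abs_sub (g R) (g (-R))
    linarith
  have hlim3 := hb.add hlim2
  rw [zero_add] at hlim3
  refine tendsto_nhds_unique hlim1 (hlim3.congr fun R => (hac R).symm)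

/-- Transfers Rademacher's theorem from Lebesgue measure to the Gaussian; one coordinate is split
off at a time. -/
lemma pi_gaussianReal_absolutelyContinuous (p : ℕ) :
    Measure.pi (fun _ : Fin p => gaussianReal 0 1) ≪ (volume : Measure (Fin p → ℝ)) := by
  induction p with
  | zero =>
    rw [volume_pi, Measure.pi_of_empty, Measure.pi_of_empty]
  | succ n ih =>
    have h1 := (measurePreserving_piFinSuccAbove (fun _ : Fin (n + 1) => gaussianReal 0 1) 0).symm
    have h2 := (volume_preserving_piFinSuccAbove (fun _ : Fin (n + 1) => ℝ) 0).symm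
    rw [← h1.map_eq, ← h2.map_eq]
    refine Measure.AbsolutelyContinuous.map ?_ (MeasurableEquiv.measurable _)
    exact (gaussianReal_absolutelyContinuous 0 one_ne_zero).prod ih

lemma measurePreserving_toLp_pi_gaussianReal (ι : Type*) [Fintype ι] :
    MeasurePreserving (WithLp.toLp 2) (Measure.pi fun _ : ι => gaussianReal 0 1)
      (stdGaussian (EuclideanSpace ℝ ι)) :=
  ⟨by fun_prop, map_pi_eq_stdGaussian⟩

lemma memLp_id_pi_gaussianReal (ι : Type*) [Fintype ι] :
    MemLp id 2 (Measure.pi fun _ : ι => gaussianReal 0 1) := by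
  have h1 : MemLp (WithLp.ofLp : EuclideanSpace ℝ ι → ι → ℝ) 2
      (stdGaussian (EuclideanSpace ℝ ι)) :=
    memLp_two_of_lipschitz IsGaussian.memLp_two_id (PiLp.lipschitzWith_ofLp 2 _)
  exact h1.comp_measurePreserving (measurePreserving_toLp_pi_gaussianReal ι)

/-- Stein's identity for a Lipschitz function of a standard Gaussian vector. -/
lemma integral_apply_mul_pi_gaussianReal {p : ℕ} {K : NNReal} {G : (Fin p → ℝ) → ℝ}
    (hG : LipschitzWith K G) (j : Fin p) :
    ∫ x, x j * G x ∂Measure.pi (fun _ : Fin p => gaussianReal 0 1) =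
      ∫ x, fderiv ℝ G x (Pi.single j 1) ∂Measure.pi (fun _ : Fin p => gaussianReal 0 1) := by
  obtain ⟨n, rfl⟩ : ∃ n, p = n + 1 := ⟨p - 1, by have := j.pos; omega⟩
  set γ := Measure.pi (fun _ : Fin (n + 1) => gaussianReal 0 1) with hγ
  set γ' := Measure.pi (fun _ : Fin n => gaussianReal 0 1) with hγ'
  have mp : MeasurePreserving (MeasurableEquiv.piFinSuccAbove (fun _ => ℝ) j).symm
      ((gaussianReal 0 1).prod γ') γ :=
    (measurePreserving_piFinSuccAbove (fun _ : Fin (n + 1) => gaussianReal 0 1) j).symm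
  have hL2 : MemLp (id : (Fin (n + 1) → ℝ) → _) 2 γ := memLp_id_pi_gaussianReal _
  have hint1 : Integrable (fun x => x j * G x) γ := by
    refine MemLp.integrable_mul (p := 2) (q := 2) ?_ (memLp_two_of_lipschitz hL2 hG)
    exact memLp_two_of_lipschitz hL2 (LipschitzWith.eval j)
  have hDm : Measurable fun x => fderiv ℝ G x (Pi.single j 1) :=
    (measurable_fderiv_apply_const ℝ G _)
  have hint2 : Integrable (fun x => fderiv ℝ G x (Pi.single j 1)) γ := by
    refine (integrable_const (K * ‖(Pi.single j 1 : Fin (n + 1) → ℝ)‖)).mono'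
      hDm.aestronglyMeasurable (ae_of_all _ fun x => ?_)
    exact ((fderiv ℝ G x).le_opNorm _).trans (by
      gcongr; exact norm_fderiv_le_of_lipschitz ℝ hG)
  have hae : ∀ᵐ x ∂γ, DifferentiableAt ℝ G x :=
    (pi_gaussianReal_absolutelyContinuous (n + 1)).ae_le hG.ae_differentiableAt
  have hae' : ∀ᵐ q ∂(gaussianReal 0 1).prod γ', DifferentiableAt ℝ G
      ((MeasurableEquiv.piFinSuccAbove (fun _ => ℝ) j).symm q) :=
    mp.quasiMeasurePreserving.ae hae
  have hmeas := (MeasurableEquiv.piFinSuccAbove (fun _ : Fin (n + 1) => ℝ) j).symm.measurableEmbedding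
  -- Fubini with the `j`-th coordinate as the inner variable. For almost every choice `r` of the
  -- others, `G` is differentiable at almost every point of the line, where the derivative of the
  -- slice is the partial derivative.
  rw [← mp.integral_comp hmeas, ← mp.integral_comp hmeas,
    integral_prod_symm (fun q => (MeasurableEquiv.piFinSuccAbove (fun _ => ℝ) j).symm q j *
      G ((MeasurableEquiv.piFinSuccAbove (fun _ => ℝ) j).symm q))
      ((mp.integrable_comp_emb hmeas).2 hint1),
    integral_prod_symm (fun q => fderiv ℝ G ((MeasurableEquiv.piFinSuccAbove (fun _ => ℝ) j).symm q)
      (Pi.single j 1)) ((mp.integrable_comp_emb hmeas).2 hint2)]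
  refine integral_congr_ae ?_
  have hae2 := Measure.ae_ae_of_ae_prod (Measure.measurePreserving_swap.quasiMeasurePreserving.ae
    (μa := γ'.prod (gaussianReal 0 1)) hae')
  filter_upwards [hae2] with r hr
  have hins : ∀ t : ℝ, HasDerivAt (fun t : ℝ => (Fin.insertNth j t r : Fin (n + 1) → ℝ))
      (Pi.single j 1) t := fun t => by
    rw [hasDerivAt_pi]
    intro i
    refine Fin.succAboveCases j ?_ (fun i => ?_) i
    · simpa using! hasDerivAt_id t
    · simpa [Pi.single_eq_of_ne (Fin.succAbove_ne j i)] using hasDerivAt_const t (r i)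
  have hlip : LipschitzWith 1 (fun t : ℝ => (Fin.insertNth j t r : Fin (n + 1) → ℝ)) := by
    refine LipschitzWith.of_dist_le_mul fun a b => ?_
    rw [NNReal.coe_one, one_mul, dist_pi_le_iff dist_nonneg]
    intro i
    refine Fin.succAboveCases j ?_ (fun i => ?_) i
    · simp
    · simp
  have h1 := integral_id_mul_gaussianReal (hG.comp hlip)
  have e1 : ∀ t : ℝ, (MeasurableEquiv.piFinSuccAbove (fun _ : Fin (n + 1) => ℝ) j).symm (t, r) =
    Fin.insertNth j t r := fun t => rfl
  simp only [e1, Fin.insertNth_apply_same]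
  refine h1.trans (integral_congr_ae ?_)
  filter_upwards [hr] with t ht
  exact (ht.hasFDerivAt.comp_hasDerivAt t (hins t)).deriv

end Stein


/-! ### Cauchy-Schwarz for square-integrable random vectors -/

section SecondMoments

open scoped RealInnerProductSpace

variable {Ω E : Type*} [MeasurableSpace Ω] {μ : Measure Ω} [NormedAddCommGroup E]
  [InnerProductSpace ℝ E] {X Y : Ω → E}

lemma integrable_inner_of_memLp (hX : MemLp X 2 μ) (hY : MemLp Y 2 μ) :
    Integrable (fun ω => ⟪X ω, Y ω⟫) μ := by
  refine (hX.norm.integrable_mul hY.norm).mono (hX.1.inner hY.1) (ae_of_all _ fun ω => ?_)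
  simpa using abs_real_inner_le_norm (X ω) (Y ω)

lemma integrable_norm_sq_of_memLp (hX : MemLp X 2 μ) : Integrable (fun ω => ‖X ω‖ ^ 2) μ := by
  simpa using integrable_inner_of_memLp hX hX

/-- The quadratic polynomial `t ↦ E‖tX - Y‖²` is nonnegative, so its discriminant is not positive.
-/
lemma sq_integral_inner_le (hX : MemLp X 2 μ) (hY : MemLp Y 2 μ) :
    (∫ ω, ⟪X ω, Y ω⟫ ∂μ) ^ 2 ≤ (∫ ω, ‖X ω‖ ^ 2 ∂μ) * ∫ ω, ‖Y ω‖ ^ 2 ∂μ := by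
  set a := ∫ ω, ‖X ω‖ ^ 2 ∂μ
  set b := ∫ ω, ⟪X ω, Y ω⟫ ∂μ
  set d := ∫ ω, ‖Y ω‖ ^ 2 ∂μ
  have key : ∀ t : ℝ, 0 ≤ a * (t * t) + (-2 * b) * t + d := by
    intro t
    have h : ∫ ω, ‖t • X ω - Y ω‖ ^ 2 ∂μ = a * (t * t) + (-2 * b) * t + d := by
      have e : ∀ ω, ‖t • X ω - Y ω‖ ^ 2 =
          t * t * ‖X ω‖ ^ 2 - 2 * t * ⟪X ω, Y ω⟫ + ‖Y ω‖ ^ 2 := fun ω => by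
        rw [norm_sub_sq_real, norm_smul, mul_pow, Real.norm_eq_abs, sq_abs, real_inner_smul_left]
        ring
      simp_rw [e]
      have i1 := (integrable_norm_sq_of_memLp hX).const_mul (t * t)
      have i2 := (integrable_inner_of_memLp hX hY).const_mul (2 * t)
      have i3 := integral_add (i1.sub i2) (integrable_norm_sq_of_memLp hY)
      have i4 := integral_sub i1 i2
      simp only [Pi.sub_apply] at i3
      rw [i3, i4, integral_const_mul, integral_const_mul]
      ring
    rw [← h]
    exact integral_nonneg fun ω => by positivity
  have := discrim_le_zero key
  unfold discrim at this
  nlinarith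

end SecondMoments

/-! ### Realizing the noise law by combinations of independent standard blocks -/

section GaussianLaws

open scoped RealInnerProductSpace

/-- With `A` the adjoint of `L`, the characteristic function of the image law at `t` depends only on
`‖A t‖²`. -/
lemma map_stdGaussian_congr {E E' F : Type*} [NormedAddCommGroup E] [InnerProductSpace ℝ E]
    [FiniteDimensional ℝ E] [MeasurableSpace E] [BorelSpace E]
    [NormedAddCommGroup E'] [InnerProductSpace ℝ E']
    [FiniteDimensional ℝ E'] [MeasurableSpace E'] [BorelSpace E']
    [NormedAddCommGroup F] [InnerProductSpace ℝ F]
    [FiniteDimensional ℝ F] [MeasurableSpace F] [BorelSpace F]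
    {L : E →L[ℝ] F} {L' : E' →L[ℝ] F} {A : F → E} {A' : F → E'}
    (hA : ∀ t x, ⟪L x, t⟫ = ⟪x, A t⟫) (hA' : ∀ t x, ⟪L' x, t⟫ = ⟪x, A' t⟫)
    (h : ∀ t, ‖A t‖ ^ 2 = ‖A' t‖ ^ 2) : (stdGaussian E).map L = (stdGaussian E').map L' := by
  apply Measure.ext_of_charFun
  ext t
  rw [charFun_apply, charFun_apply, integral_map (by fun_prop) (by fun_prop),
    integral_map (by fun_prop) (by fun_prop)]
  simp_rw [hA, hA']
  rw [← charFun_apply, ← charFun_apply, charFun_stdGaussian, charFun_stdGaussian]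
  norm_cast
  rw [h]

/-- The linear combination `∑ᵢ cᵢ zᵢ` of the blocks `zᵢ` of `z`. -/
noncomputable def comb {m p : ℕ} (c : Fin m → ℝ) :
    EuclideanSpace ℝ (Fin m × Fin p) →L[ℝ] EuclideanSpace ℝ (Fin p) :=
  LinearMap.toContinuousLinearMap
    { toFun := fun z => WithLp.toLp 2 fun j => ∑ i, c i * z (i, j)
      map_add' := fun x y => by
        ext j
        simp [mul_add, Finset.sum_add_distrib]
      map_smul' := fun a x => by
        ext j
        simp [Finset.mul_sum, mul_left_comm] }

lemma comb_apply {m p : ℕ} (c : Fin m → ℝ) (z : EuclideanSpace ℝ (Fin m × Fin p)) (j : Fin p) :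
    comb c z j = ∑ i, c i * z (i, j) := rfl

/-- Two linear combinations of the blocks of `z`. -/
noncomputable def jointComb {m p : ℕ} (c : Fin 2 → Fin m → ℝ) :
    EuclideanSpace ℝ (Fin m × Fin p) →L[ℝ] EuclideanSpace ℝ (Fin 2 × Fin p) :=
  LinearMap.toContinuousLinearMap
    { toFun := fun z => WithLp.toLp 2 fun q => ∑ i, c q.1 i * z (i, q.2)
      map_add' := fun x y => by
        ext j
        simp [mul_add, Finset.sum_add_distrib]
      map_smul' := fun a x => by
        ext j
        simp [Finset.mul_sum, mul_left_comm] }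

lemma jointComb_apply {m p : ℕ} (c : Fin 2 → Fin m → ℝ) (z : EuclideanSpace ℝ (Fin m × Fin p))
    (q : Fin 2 × Fin p) : jointComb c z q = ∑ i, c q.1 i * z (i, q.2) := rfl

/-- The `k`-th block of `g`. -/
noncomputable def block {p : ℕ} (k : Fin 2) :
    EuclideanSpace ℝ (Fin 2 × Fin p) →L[ℝ] EuclideanSpace ℝ (Fin p) :=
  comb (Pi.single k 1)

lemma block_apply {p : ℕ} (k : Fin 2) (g : EuclideanSpace ℝ (Fin 2 × Fin p)) (j : Fin p) :
    block k g j = g (k, j) := by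
  rw [block, comb_apply, Finset.sum_eq_single k]
  · simp
  · intro b _ hb; simp [hb]
  · simp

lemma block_jointComb {m p : ℕ} (c : Fin 2 → Fin m → ℝ) (z : EuclideanSpace ℝ (Fin m × Fin p))
    (k : Fin 2) : block k (jointComb c z) = comb (c k) z := by
  ext j
  rw [block_apply, jointComb_apply, comb_apply]

lemma map_comb_stdGaussian {m p : ℕ} (c : Fin m → ℝ) {τ : ℝ} (hτ : τ ^ 2 = c ⬝ᵥ c) :
    (stdGaussian (EuclideanSpace ℝ (Fin m × Fin p))).map (comb c) =
      (stdGaussian (EuclideanSpace ℝ (Fin p))).map (τ • ContinuousLinearMap.id ℝ (EuclideanSpace ℝ (Fin p))) := by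
  refine map_stdGaussian_congr (A := fun t => WithLp.toLp 2 fun q => c q.1 * t q.2)
    (A' := fun t => τ • t) (fun t x => ?_) (fun t x => ?_) (fun t => ?_)
  · simp only [PiLp.inner_apply, comb_apply, RCLike.inner_apply, conj_trivial,
      Fintype.sum_prod_type, Finset.mul_sum]
    rw [Finset.sum_comm]
    refine Finset.sum_congr rfl fun i _ => Finset.sum_congr rfl fun j _ => ?_
    ring
  · simp [real_inner_smul_left, real_inner_smul_right]
  · rw [norm_smul, mul_pow, Real.norm_eq_abs, sq_abs, hτ, EuclideanSpace.real_norm_sq_eq,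
      EuclideanSpace.real_norm_sq_eq, Fintype.sum_prod_type, dotProduct, Finset.sum_mul_sum]
    refine Finset.sum_congr rfl fun i _ => Finset.sum_congr rfl fun j _ => ?_
    simp only
    ring

/-- The matrix of inner products of two vectors. -/
def gram {m : ℕ} (c : Fin 2 → Fin m → ℝ) : Matrix (Fin 2) (Fin 2) ℝ :=
  Matrix.of fun a b => c a ⬝ᵥ c b

lemma gram_posSemidef {m : ℕ} (c : Fin 2 → Fin m → ℝ) : (gram c).PosSemidef := by
  have := Matrix.posSemidef_self_mul_conjTranspose (Matrix.of c)
  convert this using 1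
  ext a b
  simp [gram, Matrix.mul_apply, dotProduct]

/-- Factor `S = BᵀB` and take the columns of `B`. Any noise law thus comes from two linear
combinations of standard blocks. -/
lemma exists_gram_eq {S : Matrix (Fin 2) (Fin 2) ℝ} (hS : S.PosSemidef) :
    ∃ c : Fin 2 → Fin 2 → ℝ, gram c = S := by
  obtain ⟨B, rfl⟩ := CStarAlgebra.nonneg_iff_eq_star_mul_self.1 hS.nonneg
  refine ⟨fun a i => B i a, ?_⟩
  ext a b
  simp [gram, Matrix.mul_apply, dotProduct, Matrix.star_apply]

instance isProbabilityMeasure_noiseLaw (p : ℕ) (S : Matrix (Fin 2) (Fin 2) ℝ) :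
    IsProbabilityMeasure (Model.noiseLaw p S) := by
  unfold Model.noiseLaw
  infer_instance

/-- Both sides have the same characteristic function, the exponent being the quadratic form of `gram
c ⊗ I`. The number `m` of blocks is free, which leaves room for couplings of several pairs on one
space. -/
lemma map_jointComb_stdGaussian {m p : ℕ} (c : Fin 2 → Fin m → ℝ) :
    (stdGaussian (EuclideanSpace ℝ (Fin m × Fin p))).map (jointComb c) =
      Model.noiseLaw p (gram c) := by
  apply Measure.ext_of_charFun
  ext t
  have hpsd : (gram c ⊗ₖ (1 : Matrix (Fin p) (Fin p) ℝ)).PosSemidef :=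
    (gram_posSemidef c).kronecker Matrix.PosSemidef.one
  rw [Model.noiseLaw, charFun_multivariateGaussian hpsd, charFun_apply,
    integral_map (by fun_prop) (by fun_prop)]
  have hA : ∀ x, ⟪jointComb c x, t⟫ =
      ⟪x, WithLp.toLp 2 fun q : Fin m × Fin p => ∑ k, c k q.1 * t (k, q.2)⟫ := fun x => by
    simp only [PiLp.inner_apply, jointComb_apply, RCLike.inner_apply, conj_trivial,
      Fintype.sum_prod_type, Finset.mul_sum, Fin.sum_univ_two,
      ← Finset.sum_add_distrib]
    rw [Finset.sum_comm]
    refine Finset.sum_congr rfl fun i _ => Finset.sum_congr rfl fun j _ => ?_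
    ring
  simp_rw [hA]
  rw [← charFun_apply, charFun_stdGaussian]
  congr 1
  rw [inner_zero_right, Complex.ofReal_zero, zero_mul, zero_sub, neg_div]
  congr 2
  rw [← Complex.ofReal_pow, EuclideanSpace.real_norm_sq_eq]
  congr 1
  simp only [dotProduct, Matrix.mulVec, Fintype.sum_prod_type, Matrix.kroneckerMap_apply,
    Matrix.one_apply, gram, Matrix.of_apply, mul_ite, mul_one, mul_zero, ite_mul, zero_mul,
    Finset.sum_ite_eq, Finset.mem_univ, if_true, Fin.sum_univ_two]
  rw [← Finset.sum_add_distrib, Finset.sum_comm]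
  refine Finset.sum_congr rfl fun j _ => ?_
  simp only [Finset.sum_mul, ← Finset.sum_add_distrib, Finset.mul_sum]
  refine Finset.sum_congr rfl fun i _ => ?_
  ring

lemma map_block_noiseLaw {p : ℕ} {S : Matrix (Fin 2) (Fin 2) ℝ} (hS : S.PosSemidef) (k : Fin 2) :
    (Model.noiseLaw p S).map (block k) = (stdGaussian (EuclideanSpace ℝ (Fin p))).map
      (√(S k k) • ContinuousLinearMap.id ℝ (EuclideanSpace ℝ (Fin p))) := by
  obtain ⟨c, rfl⟩ := exists_gram_eq hS
  rw [← map_jointComb_stdGaussian, Measure.map_map (by fun_prop) (by fun_prop)]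
  rw [show (block k : EuclideanSpace ℝ (Fin 2 × Fin p) → _) ∘ jointComb c = comb (c k) from
    funext fun z => block_jointComb c z k]
  refine map_comb_stdGaussian _ ?_
  rw [Real.sq_sqrt hS.diag_nonneg]
  rfl

lemma integral_block_noiseLaw {p : ℕ} {S : Matrix (Fin 2) (Fin 2) ℝ} (hS : S.PosSemidef)
    (k : Fin 2) {φ : EuclideanSpace ℝ (Fin p) → ℝ}
    (hφ : Measurable φ) :
    ∫ g, φ (block k g) ∂Model.noiseLaw p S =
      ∫ g, φ (√(S k k) • g) ∂stdGaussian (EuclideanSpace ℝ (Fin p)) := by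
  rw [← integral_map (φ := block k) (by fun_prop) hφ.aestronglyMeasurable, map_block_noiseLaw hS,
    integral_map (by fun_prop) hφ.aestronglyMeasurable]
  rfl

lemma ae_block_noiseLaw {p : ℕ} {S : Matrix (Fin 2) (Fin 2) ℝ} (hS : S.PosSemidef)
    (k : Fin 2) {P : EuclideanSpace ℝ (Fin p) → Prop} (hP : MeasurableSet {x | P x})
    (h : ∀ᵐ g ∂stdGaussian (EuclideanSpace ℝ (Fin p)), P (√(S k k) • g)) :
    ∀ᵐ g ∂Model.noiseLaw p S, P (block k g) := by
  rw [← ae_map_iff (f := block k) (by fun_prop) hP, map_block_noiseLaw hS,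
    ae_map_iff (by fun_prop) hP]
  exact h

lemma integral_blocks_noiseLaw_gram {m p : ℕ} (c : Fin 2 → Fin m → ℝ)
    {φ : EuclideanSpace ℝ (Fin p) → EuclideanSpace ℝ (Fin p) → ℝ}
    (hφ : Continuous fun q : EuclideanSpace ℝ (Fin p) × EuclideanSpace ℝ (Fin p) => φ q.1 q.2) :
    ∫ g, φ (block 0 g) (block 1 g) ∂Model.noiseLaw p (gram c) =
      ∫ z, φ (comb (c 0) z) (comb (c 1) z) ∂stdGaussian (EuclideanSpace ℝ (Fin m × Fin p)) := by
  rw [← map_jointComb_stdGaussian, integral_map (by fun_prop)]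
  · simp_rw [block_jointComb]
  · exact (hφ.comp ((block 0).continuous.prodMk (block 1).continuous)).aestronglyMeasurable

end GaussianLaws

/-! ### Divergence of Lipschitz fields under Gaussian noise -/

section Divergence

open scoped RealInnerProductSpace

variable {p : ℕ} {K : NNReal} {Φ : (Fin p → ℝ) → Fin p → ℝ}

lemma measurable_divergence (Φ : (Fin p → ℝ) → Fin p → ℝ) : Measurable (Model.divergence Φ) := by
  unfold Model.divergence
  refine Finset.measurable_sum _ fun j _ => ?_
  exact (measurable_pi_apply j).comp (measurable_fderiv_apply_const ℝ Φ _)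

lemma abs_divergence_le (hΦ : LipschitzWith K Φ) (y : Fin p → ℝ) :
    |Model.divergence Φ y| ≤ ∑ j : Fin p, K * ‖(Pi.single j 1 : Fin p → ℝ)‖ := by
  refine (Finset.abs_sum_le_sum_abs _ _).trans (Finset.sum_le_sum fun j _ => ?_)
  rw [← Real.norm_eq_abs]
  refine (norm_le_pi_norm _ j).trans (((fderiv ℝ Φ y).le_opNorm _).trans ?_)
  gcongr
  exact norm_fderiv_le_of_lipschitz ℝ hΦ

lemma integrable_divergence_comp (hΦ : LipschitzWith K Φ) {Ω : Type*} [MeasurableSpace Ω]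
    {μ : Measure Ω} [IsFiniteMeasure μ] {Y : Ω → Fin p → ℝ} (hY : Measurable Y) :
    Integrable (fun ω => Model.divergence Φ (Y ω)) μ :=
  (integrable_const (∑ j : Fin p, K * ‖(Pi.single j 1 : Fin p → ℝ)‖)).mono'
    ((measurable_divergence Φ).comp hY).aestronglyMeasurable
    (ae_of_all _ fun ω => by simpa using abs_divergence_le hΦ (Y ω))

lemma lipschitzWith_affine (a : Fin p → ℝ) (τ : ℝ) :
    LipschitzWith ‖τ‖₊ fun x : Fin p → ℝ => a + τ • x :=
  LipschitzWith.of_dist_le_mul fun x y => by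
    simp [dist_smul₀]

/-- Apply Rademacher's theorem to `Φ` composed with the affine map and undo that map, which is
invertible because `τ ≠ 0`. -/
lemma ae_differentiableAt_affine (hΦ : LipschitzWith K Φ) (a : Fin p → ℝ) {τ : ℝ} (hτ : τ ≠ 0) :
    ∀ᵐ x ∂Measure.pi (fun _ : Fin p => gaussianReal 0 1), DifferentiableAt ℝ Φ (a + τ • x) := by
  have h1 := (pi_gaussianReal_absolutelyContinuous p).ae_le
    ((hΦ.comp (lipschitzWith_affine a τ)).ae_differentiableAt)
  filter_upwards [h1] with x hx
  have e : Φ = (Φ ∘ fun x => a + τ • x) ∘ fun y => τ⁻¹ • (y - a) := by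
    funext y
    simp [smul_smul, hτ]
  rw [e]
  refine DifferentiableAt.comp _ ?_ (by fun_prop)
  convert hx using 1
  simp [smul_smul, hτ]

lemma ae_differentiableAt_stdGaussian (hΦ : LipschitzWith K Φ) (a : Fin p → ℝ) {τ : ℝ}
    (hτ : τ ≠ 0) : ∀ᵐ g ∂stdGaussian (EuclideanSpace ℝ (Fin p)),
      DifferentiableAt ℝ Φ (a + τ • g.ofLp) := by
  rw [← map_pi_eq_stdGaussian, ae_map_iff (by fun_prop)]
  · exact ae_differentiableAt_affine hΦ a hτ
  · exact (measurableSet_of_differentiableAt ℝ Φ).preimage (by fun_prop)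

/-- Stein's identity in each coordinate; the factor `τ` comes from the chain rule. This is what
converts degrees of freedom into a correlation. -/
lemma integral_divergence_stdGaussian (hΦ : LipschitzWith K Φ) (a : Fin p → ℝ) {τ : ℝ}
    (hτ : τ ≠ 0) :
    τ * ∫ g, Model.divergence Φ (a + τ • g.ofLp) ∂stdGaussian (EuclideanSpace ℝ (Fin p)) =
      ∫ g, ⟪g, WithLp.toLp 2 (Φ (a + τ • g.ofLp))⟫ ∂stdGaussian (EuclideanSpace ℝ (Fin p)) := by
  have hc : Continuous Φ := hΦ.continuous
  have hmeas : Measurable fun g : EuclideanSpace ℝ (Fin p) =>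
      Model.divergence Φ (a + τ • g.ofLp) :=
    (measurable_divergence Φ).comp (by fun_prop)
  rw [← map_pi_eq_stdGaussian, integral_map (by fun_prop) hmeas.aestronglyMeasurable,
    integral_map (by fun_prop) (Continuous.aestronglyMeasurable (by fun_prop))]
  simp only [PiLp.inner_apply, RCLike.inner_apply, conj_trivial, Model.divergence]
  set γ := Measure.pi fun _ : Fin p => gaussianReal 0 1
  have hL2 : MemLp (id : (Fin p → ℝ) → _) 2 γ := memLp_id_pi_gaussianReal _
  have hlip : ∀ j, LipschitzWith (K * ‖τ‖₊) fun x : Fin p → ℝ => Φ (a + τ • x) j := fun j => by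
    rw [← one_mul (K * ‖τ‖₊)]
    exact (LipschitzWith.eval (α := fun _ : Fin p => ℝ) j).comp
      (hΦ.comp (lipschitzWith_affine a τ))
  have hi1 : ∀ j, Integrable (fun x : Fin p → ℝ => Φ (a + τ • x) j * x j) γ := fun j =>
    (memLp_two_of_lipschitz hL2 (hlip j)).integrable_mul
      (memLp_two_of_lipschitz hL2 (LipschitzWith.eval (α := fun _ : Fin p => ℝ) j))
  have hi2 : ∀ j, Integrable (fun x : Fin p → ℝ => fderiv ℝ Φ (a + τ • x) (Pi.single j 1) j) γ := by
    intro j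
    refine (integrable_const (K * ‖(Pi.single j 1 : Fin p → ℝ)‖)).mono' ?_ (ae_of_all _ fun x => ?_)
    · exact (((measurable_pi_apply j).comp (measurable_fderiv_apply_const ℝ Φ _)).comp
        (by fun_prop : Measurable fun x : Fin p → ℝ => a + τ • x)).aestronglyMeasurable
    · refine (norm_le_pi_norm _ j).trans (((fderiv ℝ Φ _).le_opNorm _).trans ?_)
      gcongr
      exact norm_fderiv_le_of_lipschitz ℝ hΦ
  rw [integral_finsetSum _ fun j _ => hi1 j, integral_finsetSum _ fun j _ => hi2 j,
    Finset.mul_sum]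
  refine Finset.sum_congr rfl fun j _ => ?_
  have h1 := integral_apply_mul_pi_gaussianReal (hlip j) j
  simp_rw [mul_comm (Φ _ j)]
  rw [h1, ← integral_const_mul]
  refine integral_congr_ae ?_
  filter_upwards [ae_differentiableAt_affine hΦ a hτ] with x hx
  have h2 : HasFDerivAt (fun x : Fin p → ℝ => a + τ • x)
      (τ • ContinuousLinearMap.id ℝ (Fin p → ℝ)) x :=
    ((hasFDerivAt_id x).const_smul τ).const_add a
  have h3 := (hasFDerivAt_pi'.1 (hx.hasFDerivAt.comp x h2) j).fderiv
  rw [show (fun x : Fin p → ℝ => Φ (a + τ • x) j) =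
    fun x => (Φ ∘ fun x : Fin p → ℝ => a + τ • x) x j from rfl, h3]
  simp

end Divergence


/-! ### The marginal system and its uniqueness -/

section Marginal

set_option linter.unusedSectionVars false

open Filter Topology
open scoped RealInnerProductSpace

variable {E : Type*} [NormedAddCommGroup E] [InnerProductSpace ℝ E] [FiniteDimensional ℝ E]
  [MeasurableSpace E] [BorelSpace E]

/-- The mean squared error `E‖F z (x₀ + τ g) - x₀‖²` for standard Gaussian `g`. -/
noncomputable def mse (F : ℝ → E → E) (x₀ : E) (τ z : ℝ) : ℝ :=
  ∫ g, ‖F z (x₀ + τ • g) - x₀‖ ^ 2 ∂stdGaussian E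

/-- The correlation `E⟨g, F z (x₀ + τ g) - x₀⟩` for standard Gaussian `g`. -/
noncomputable def corr (F : ℝ → E → E) (x₀ : E) (τ z : ℝ) : ℝ :=
  ∫ g, ⟪g, F z (x₀ + τ • g) - x₀⟫ ∂stdGaussian E

/-- The fixed-point equations of a single regression, with noise level `τ` and, by Stein's identity,
the degrees of freedom replaced by `corr / τ`. -/
structure MarginalSol (F : ℝ → E → E) (x₀ : E) (n s τ z : ℝ) : Prop where
  nonneg : 0 ≤ τ
  pos : 0 < z
  eq_mse : n * τ ^ 2 = s + mse F x₀ τ z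
  eq_corr : n * τ * (1 - z) = corr F x₀ τ z

variable {f : E → ℝ} {F : ℝ → E → E}

lemma memLp_id_stdGaussian : MemLp (fun g : E => g) 2 (stdGaussian E) := IsGaussian.memLp_two_id

lemma integral_inner_const_stdGaussian (x : E) : ∫ g, ⟪g, x⟫ ∂stdGaussian E = 0 := by
  simp_rw [real_inner_comm x]
  exact integral_strongDual_stdGaussian (innerSL ℝ x)

lemma lipschitzWith_affine_vec (x₀ : E) (τ : ℝ) : LipschitzWith ‖τ‖₊ fun g : E => x₀ + τ • g :=
  LipschitzWith.of_dist_le_mul fun x y => by simp [dist_smul₀]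

lemma IsProx.memLp_comp (hF : IsProx f F) {z : ℝ} (hz : 0 < z) (x₀ : E) (τ : ℝ) :
    MemLp (fun g => F z (x₀ + τ • g)) 2 (stdGaussian E) :=
  memLp_two_of_lipschitz memLp_id_stdGaussian
    ((hF.lipschitz hz).comp (lipschitzWith_affine_vec x₀ τ))

lemma IsProx.memLp_error (hF : IsProx f F) {z : ℝ} (hz : 0 < z) (x₀ : E) (τ : ℝ) :
    MemLp (fun g => F z (x₀ + τ • g) - x₀) 2 (stdGaussian E) :=
  (hF.memLp_comp hz x₀ τ).sub (memLp_const x₀)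

lemma mse_nonneg (F : ℝ → E → E) (x₀ : E) (τ z : ℝ) : 0 ≤ mse F x₀ τ z :=
  integral_nonneg fun _ => by positivity

/-- Uniqueness of the noise level, and of the parameter `z` when the noise does not vanish. -/
theorem MarginalSol.unique (hF : IsProx f F) {x₀ : E} {n s : ℝ} (hn : 0 < n) (hs : 0 ≤ s)
    {τ z τ' z' : ℝ} (h : MarginalSol F x₀ n s τ z) (h' : MarginalSol F x₀ n s τ' z') :
    τ = τ' ∧ (0 < τ → z = z') := by
  have hu := hF.memLp_error h.pos x₀ τ
  have hu' := hF.memLp_error h'.pos x₀ τ'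
  have hg := memLp_id_stdGaussian (E := E)
  set u : E → E := fun g => F z (x₀ + τ • g) - x₀ with hudef
  set u' : E → E := fun g => F z' (x₀ + τ' • g) - x₀ with hudef'
  set c := ∫ g, ⟪u g, u' g⟫ ∂stdGaussian E with hc
  have hz := h.pos
  have hz' := h'.pos
  have hb : mse F x₀ τ z = n * τ ^ 2 - s := by linarith [h.eq_mse]
  have hb' : mse F x₀ τ' z' = n * τ' ^ 2 - s := by linarith [h'.eq_mse]
  have hb0 := mse_nonneg F x₀ τ z
  have hb0' := mse_nonneg F x₀ τ' z'
  rw [hb] at hb0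
  rw [hb'] at hb0'
  -- The expectation of the monotonicity inequality for the two solutions driven by the same `g`,
  -- with second moments and correlations replaced by the fixed-point equations.
  have hmono : 0 ≤ (z * τ - z' * τ') * (n * τ * (1 - z) - n * τ' * (1 - z')) -
      z * (n * τ ^ 2 - s) - z' * (n * τ' ^ 2 - s) + (z + z') * c := by
    have hp : ∀ g, 0 ≤ (z * τ - z' * τ') * ⟪g, u g⟫ - (z * τ - z' * τ') * ⟪g, u' g⟫ -
        z * ‖u g‖ ^ 2 - z' * ‖u' g‖ ^ 2 + (z + z') * ⟪u g, u' g⟫ := fun g => by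
      have h1 := (hF z hz (x₀ + τ • g)).inner_le (hF z' hz' (x₀ + τ' • g))
      rw [show z • (x₀ + τ • g - F z (x₀ + τ • g)) - z' • (x₀ + τ' • g - F z' (x₀ + τ' • g)) =
        (z * τ - z' * τ') • g - z • u g + z' • u' g by simp only [hudef, hudef']; module,
        show F z (x₀ + τ • g) - F z' (x₀ + τ' • g) = u g - u' g by
          simp only [hudef, hudef']; module] at h1
      simp only [inner_add_left, inner_sub_left, inner_sub_right, real_inner_smul_left,
        real_inner_self_eq_norm_sq] at h1
      rw [real_inner_comm (u g) (u' g)] at h1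
      linarith
    have h2 := integral_nonneg (μ := stdGaussian E) (f := fun g =>
      (z * τ - z' * τ') * ⟪g, u g⟫ - (z * τ - z' * τ') * ⟪g, u' g⟫ -
        z * ‖u g‖ ^ 2 - z' * ‖u' g‖ ^ 2 + (z + z') * ⟪u g, u' g⟫) hp
    have i1 := (integrable_inner_of_memLp hg hu).const_mul (z * τ - z' * τ')
    have i2 := (integrable_inner_of_memLp hg hu').const_mul (z * τ - z' * τ')
    have i3 := (integrable_norm_sq_of_memLp hu).const_mul z
    have i4 := (integrable_norm_sq_of_memLp hu').const_mul z'
    have i5 := (integrable_inner_of_memLp hu hu').const_mul (z + z')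
    have e1 := integral_sub i1 i2
    have e2 := integral_sub (i1.sub i2) i3
    have e3 := integral_sub ((i1.sub i2).sub i3) i4
    have e4 := integral_add (((i1.sub i2).sub i3).sub i4) i5
    simp only [Pi.sub_apply] at e1 e2 e3 e4
    rw [e4, e3, e2, e1] at h2
    simp only [integral_const_mul] at h2
    have f1 : ∫ g, ⟪g, u g⟫ ∂stdGaussian E = n * τ * (1 - z) := h.eq_corr.symm
    have f2 : ∫ g, ⟪g, u' g⟫ ∂stdGaussian E = n * τ' * (1 - z') := h'.eq_corr.symm
    have f3 : ∫ g, ‖u g‖ ^ 2 ∂stdGaussian E = n * τ ^ 2 - s := hb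
    have f4 : ∫ g, ‖u' g‖ ^ 2 ∂stdGaussian E = n * τ' ^ 2 - s := hb'
    rw [f1, f2, f3, f4] at h2
    linarith
  have hcs : c ^ 2 ≤ (n * τ ^ 2 - s) * (n * τ' ^ 2 - s) := by
    have := sq_integral_inner_le hu hu'
    rw [← hb, ← hb']
    exact this
  have hτ := h.nonneg
  have hτ' := h'.nonneg
  have hcb : 2 * c ≤ (n * τ ^ 2 - s) + (n * τ' ^ 2 - s) := by
    refine abs_le_of_sq_le_sq' ?_ (by linarith) |>.2
    nlinarith [sq_nonneg (n * τ ^ 2 - s - (n * τ' ^ 2 - s))]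
  -- Cauchy-Schwarz after adding `s`: writing `b = nτ² - s` and `b' = nτ'² - s`, the bounds `c² ≤
  -- bb'` and `2c ≤ b + b'` give `(c + s)² ≤ (b + s)(b' + s)`.
  have hcn : c + s ≤ n * τ * τ' := by
    refine abs_le_of_sq_le_sq' ?_ (by positivity) |>.2
    nlinarith
  -- Rearranging `hmono` leaves exactly minus these two terms. Both are nonnegative, hence both
  -- vanish.
  have hd : n * (z * τ - z' * τ') ^ 2 + (z + z') * (n * τ * τ' - s - c) ≤ 0 := by nlinarith
  have hd1 : 0 ≤ n * (z * τ - z' * τ') ^ 2 := by positivity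
  have hd2 : 0 ≤ (z + z') * (n * τ * τ' - s - c) := mul_nonneg (by linarith) (by linarith)
  have hzτ : z * τ = z' * τ' := by
    have : (z * τ - z' * τ') ^ 2 = 0 := by
      rcases mul_eq_zero.1 (le_antisymm (by linarith) hd1 :
        n * (z * τ - z' * τ') ^ 2 = 0) with h1 | h1
      · exact absurd h1 hn.ne'
      · exact h1
    linarith [pow_eq_zero_iff two_ne_zero |>.1 this]
  have hceq : c = n * τ * τ' - s := by
    rcases mul_eq_zero.1 (le_antisymm (by linarith) hd2 :
      (z + z') * (n * τ * τ' - s - c) = 0) with h1 | h1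
    · linarith
    · linarith
  rcases hs.eq_or_lt with hs0 | hs0
  · subst hs0
    rcases hτ.eq_or_lt with ht | ht
    · subst ht
      have : τ' = 0 := by
        rw [mul_zero] at hzτ
        exact (mul_eq_zero.1 hzτ.symm).resolve_left hz'.ne'
      exact ⟨this.symm, fun h => absurd h (lt_irrefl _)⟩
    · have ht' : 0 < τ' := by
        refine hτ'.lt_of_ne fun h0 => ?_
        rw [← h0, mul_zero] at hzτ
        exact (mul_pos hz ht).ne' hzτ
      -- For `s = 0` equality holds in Cauchy-Schwarz, so `τ' u = τ u'` almost surely. Correlating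
      -- with `g` and using the correlation equations yields `z = z'`.
      have hv : MemLp (fun g => τ' • u g - τ • u' g) 2 (stdGaussian E) :=
        (hu.const_smul τ').sub (hu'.const_smul τ)
      have hv0 : ∫ g, ‖τ' • u g - τ • u' g‖ ^ 2 ∂stdGaussian E = 0 := by
        have e : ∀ g, ‖τ' • u g - τ • u' g‖ ^ 2 = τ' ^ 2 * ‖u g‖ ^ 2 -
            2 * τ * τ' * ⟪u g, u' g⟫ + τ ^ 2 * ‖u' g‖ ^ 2 := fun g => by
          rw [norm_sub_sq_real, norm_smul, norm_smul, mul_pow, mul_pow, Real.norm_eq_abs,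
            Real.norm_eq_abs, sq_abs, sq_abs, real_inner_smul_left, real_inner_smul_right]
          ring
        simp_rw [e]
        have i1 := (integrable_norm_sq_of_memLp hu).const_mul (τ' ^ 2)
        have i2 := (integrable_inner_of_memLp hu hu').const_mul (2 * τ * τ')
        have i3 := (integrable_norm_sq_of_memLp hu').const_mul (τ ^ 2)
        have e1 := integral_sub i1 i2
        have e2 := integral_add (i1.sub i2) i3
        simp only [Pi.sub_apply] at e1 e2
        rw [e2, e1]
        simp only [integral_const_mul]
        have f3 : ∫ g, ‖u g‖ ^ 2 ∂stdGaussian E = n * τ ^ 2 - 0 := hb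
        have f4 : ∫ g, ‖u' g‖ ^ 2 ∂stdGaussian E = n * τ' ^ 2 - 0 := hb'
        rw [f3, f4, ← hc, hceq]
        ring
      have h3 := sq_integral_inner_le hg hv
      rw [hv0, mul_zero] at h3
      have h4 : ∫ g, ⟪g, τ' • u g - τ • u' g⟫ ∂stdGaussian E =
          τ' * (n * τ * (1 - z)) - τ * (n * τ' * (1 - z')) := by
        simp only [inner_sub_right, real_inner_smul_right]
        rw [integral_sub ((integrable_inner_of_memLp hg hu).const_mul _)
          ((integrable_inner_of_memLp hg hu').const_mul _), integral_const_mul,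
          integral_const_mul, h.eq_corr, h'.eq_corr]
        rfl
      have h5 : n * τ * τ' * (z' - z) = 0 := by
        have := pow_eq_zero_iff two_ne_zero |>.1 (le_antisymm h3 (sq_nonneg _))
        rw [h4] at this
        linarith
      have h6 : z = z' := by
        rcases mul_eq_zero.1 h5 with h | h
        · exact absurd h (by positivity)
        · linarith
      subst h6
      exact ⟨mul_left_cancel₀ hz.ne' hzτ, fun _ => rfl⟩
  -- For `s > 0` equality in `hcn` forces `b + b' = 2c`; with `c² ≤ bb'` this gives `(b - b')² ≤ 0`,
  -- hence equal noise levels.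
  · have h1 : (n * τ ^ 2 - s) + (n * τ' ^ 2 - s) ≤ 2 * c := by
      have : (c + s) ^ 2 = (n * τ ^ 2) * (n * τ' ^ 2) := by rw [hceq]; ring
      have h2 : s * ((n * τ ^ 2 - s) + (n * τ' ^ 2 - s)) ≤ s * (2 * c) := by nlinarith
      exact le_of_mul_le_mul_left h2 hs0
    have h2 : (n * τ ^ 2 - n * τ' ^ 2) ^ 2 ≤ 0 := by
      have h3 : 2 * c = (n * τ ^ 2 - s) + (n * τ' ^ 2 - s) := le_antisymm hcb h1
      nlinarith
    have h3 : n * (τ ^ 2 - τ' ^ 2) = 0 := by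
      have := pow_eq_zero_iff two_ne_zero |>.1 (le_antisymm h2 (sq_nonneg _))
      linarith
    have h4 : τ = τ' := by
      have := (mul_eq_zero.1 h3).resolve_left hn.ne'
      exact (pow_left_inj₀ hτ hτ' two_ne_zero).1 (by linarith)
    refine ⟨h4, fun ht => ?_⟩
    subst h4
    exact mul_right_cancel₀ ht.ne' hzτ

end Marginal


/-! ### Solving two scalar equations by nested intermediate value arguments -/

section RootFinding

open Filter Topology Set

/-- A continuous function of two positive variables that is strictly increasing in the second one
and changes sign along it has a zero depending continuously on the first variable. -/
lemma exists_continuousOn_root {H : ℝ → ℝ → ℝ}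
    (hc : ContinuousOn (fun q : ℝ × ℝ => H q.1 q.2) (Ioi 0 ×ˢ Ioi 0))
    (hmono : ∀ t, 0 < t → ∀ z, 0 < z → ∀ z', z < z' → H t z < H t z')
    (hneg : ∀ t, 0 < t → ∃ z, 0 < z ∧ H t z < 0) (hpos : ∀ t, 0 < t → ∃ z, 0 < z ∧ 0 < H t z) :
    ∃ r : ℝ → ℝ, (∀ t, 0 < t → 0 < r t ∧ H t (r t) = 0) ∧ ContinuousOn r (Ioi 0) := by
  have hex : ∀ t, 0 < t → ∃ z, 0 < z ∧ H t z = 0 := by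
    intro t ht
    obtain ⟨z1, hz1, h1⟩ := hneg t ht
    obtain ⟨z2, hz2, h2⟩ := hpos t ht
    have hlt : z1 < z2 := by
      by_contra hcon
      rcases (not_lt.1 hcon).eq_or_lt with h | h
      · rw [h] at h2; linarith
      · have := hmono t ht z2 hz2 z1 h; linarith
    have hcz : ContinuousOn (H t) (Icc z1 z2) := by
      have hm : ContinuousOn (fun z : ℝ => (t, z)) (Icc z1 z2) := by fun_prop
      exact hc.comp hm fun z hz => ⟨ht, lt_of_lt_of_le hz1 hz.1⟩
    obtain ⟨z, hz, hz0⟩ := intermediate_value_Icc hlt.le hcz ⟨h1.le, h2.le⟩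
    exact ⟨z, lt_of_lt_of_le hz1 hz.1, hz0⟩
  choose! r hr using hex
  refine ⟨r, hr, fun t ht => ContinuousAt.continuousWithinAt ?_⟩
  have ht : 0 < t := ht
  have hnear : ∀ z, 0 < z → ContinuousAt (fun t => H t z) t := fun z hz => by
    have h1 : ContinuousAt (fun q : ℝ × ℝ => H q.1 q.2) (t, z) :=
      hc.continuousAt ((isOpen_Ioi.prod isOpen_Ioi).mem_nhds ⟨ht, hz⟩)
    exact h1.comp (f := fun t => (t, z)) (by fun_prop)
  obtain ⟨hrt, hrt0⟩ := hr t ht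
  rw [ContinuousAt, tendsto_order]
  constructor
  · intro l hl
    -- The given `l` may be nonpositive, where nothing is known about `H`; raising it to at least `r
    -- t / 2` keeps the comparison point positive and still below the root.
    set l' := max l (r t / 2)
    have hl' : l' < r t := max_lt hl (by linarith)
    have hl0 : 0 < l' := lt_of_lt_of_le (by linarith) (le_max_right _ _)
    have h1 := hmono t ht l' hl0 (r t) hl'
    rw [hrt0] at h1
    filter_upwards [(hnear l' hl0).eventually (gt_mem_nhds h1), lt_mem_nhds ht] with t' h2 ht'
    refine lt_of_le_of_lt (le_max_left l (r t / 2)) ?_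
    by_contra hcon
    rcases (not_lt.1 hcon).eq_or_lt with h | h
    · have := (hr t' ht').2
      rw [h] at this
      exact h2.ne this
    · have := hmono t' ht' _ (hr t' ht').1 _ h
      rw [(hr t' ht').2] at this
      linarith
  · intro l hl
    have hl0 : 0 < l := hrt.trans hl
    have h1 := hmono t ht (r t) hrt l hl
    rw [hrt0] at h1
    filter_upwards [(hnear l hl0).eventually (lt_mem_nhds h1), lt_mem_nhds ht] with t' h2 ht'
    by_contra hcon
    rcases (not_lt.1 hcon).eq_or_lt with h | h
    · have := (hr t' ht').2
      rw [← h] at this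
      exact h2.ne' this
    · have := hmono t' ht' _ hl0 _ h
      rw [(hr t' ht').2] at this
      linarith

/-- Substituting `nt² = s + b` into half of the term `nt` in `nzt = nt - a` gives the equation `H =
0`. By `hM` this equation is strictly monotone in `z`, and its root `r t` is continuous in `t`. The
hypotheses `hL` and `hS` fix the sign of `nt² - s - b` along the root curve at large and small `t`;
where it vanishes, `H = 0` turns back into `nt(1 - z) = a`. -/
lemma exists_root_pair {n s : ℝ} (hn : 0 < n) {a b : ℝ → ℝ → ℝ}
    (ha : ContinuousOn (fun q : ℝ × ℝ => a q.1 q.2) (Ioi 0 ×ˢ Ioi 0))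
    (hb : ContinuousOn (fun q : ℝ × ℝ => b q.1 q.2) (Ioi 0 ×ˢ Ioi 0))
    (hM : ∀ t, 0 < t → ∀ z, 0 < z → ∀ z', z ≤ z' →
      b t z' / (2 * t) - a t z' ≤ b t z / (2 * t) - a t z)
    (hZ : ∀ t, 0 < t → ∃ z, 0 < z ∧ n * z * t < n * t / 2 + (s + b t z) / (2 * t) - a t z)
    (hL : ∃ T, 0 < T ∧ ∀ t, T ≤ t → ∀ z, 0 < z →
      n * z * t = n * t / 2 + (s + b t z) / (2 * t) - a t z → s + b t z ≤ n * t ^ 2)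
    (hS : ∃ ε, 0 < ε ∧ ∀ t, 0 < t → t ≤ ε → ∀ z, 0 < z →
      n * z * t = n * t / 2 + (s + b t z) / (2 * t) - a t z → n * t ^ 2 ≤ s + b t z) :
    ∃ t, 0 < t ∧ ∃ z, 0 < z ∧ n * t ^ 2 = s + b t z ∧ n * t * (1 - z) = a t z := by
  set H : ℝ → ℝ → ℝ := fun t z => n * z * t - (n * t / 2 + (s + b t z) / (2 * t) - a t z) with hH
  have hHc : ContinuousOn (fun q : ℝ × ℝ => H q.1 q.2) (Ioi 0 ×ˢ Ioi 0) := by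
    refine ContinuousOn.sub (by fun_prop) (((Continuous.continuousOn (by fun_prop)).add
      (ContinuousOn.div (continuousOn_const.add hb) (Continuous.continuousOn (by fun_prop)) ?_)).sub
        ha)
    rintro q ⟨hq, -⟩
    exact mul_ne_zero two_ne_zero (ne_of_gt hq)
  have hsplit : ∀ t z, (s + b t z) / (2 * t) = s / (2 * t) + b t z / (2 * t) := fun t z =>
    add_div _ _ _
  obtain ⟨r, hr, hrc⟩ := exists_continuousOn_root hHc
    (fun t ht z hz z' hzz' => by
      have h1 := hM t ht z hz z' hzz'.le
      have h2 : n * z * t < n * z' * t := by gcongr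
      simp only [hH, hsplit]
      linarith)
    (fun t ht => by
      obtain ⟨z, hz, h⟩ := hZ t ht
      exact ⟨z, hz, by simp only [hH]; linarith⟩)
    (fun t ht => by
      obtain ⟨z, hz⟩ : ∃ z, 1 ≤ z ∧ n * t / 2 + (s + b t 1) / (2 * t) - a t 1 < n * t * z := by
        refine ⟨max 1 ((n * t / 2 + (s + b t 1) / (2 * t) - a t 1) / (n * t) + 1),
          le_max_left _ _, ?_⟩
        have hnt : 0 < n * t := by positivity
        calc _ < n * t * ((n * t / 2 + (s + b t 1) / (2 * t) - a t 1) / (n * t) + 1) := by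
              rw [mul_add, mul_div_cancel₀ _ hnt.ne']; linarith
          _ ≤ _ := by gcongr; exact le_max_right _ _
      refine ⟨z, by linarith, ?_⟩
      have h1 := hM t ht 1 one_pos z hz.1
      have h2 := hz.2
      simp only [hH, hsplit] at h2 ⊢
      linarith)
  set D : ℝ → ℝ := fun t => n * t ^ 2 - (s + b t (r t)) with hD
  have hDc : ContinuousOn D (Ioi 0) := by
    refine ContinuousOn.sub (by fun_prop) (continuousOn_const.add ?_)
    have h1 : ContinuousOn (fun t => (t, r t)) (Ioi 0) := continuousOn_id.prodMk hrc
    exact hb.comp h1 fun t ht => ⟨ht, (hr t ht).1⟩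
  obtain ⟨T, hT, hL⟩ := hL
  obtain ⟨ε, hε, hS⟩ := hS
  have hroot : ∀ t, 0 < t → n * r t * t = n * t / 2 + (s + b t (r t)) / (2 * t) - a t (r t) :=
    fun t ht => by
      have := (hr t ht).2
      simp only [hH] at this
      linarith
  set m := min ε T
  have hm : 0 < m := lt_min hε hT
  have h1 : D m ≤ 0 := by
    have := hS m hm (min_le_left _ _) (r m) (hr m hm).1 (hroot m hm)
    simp only [hD]; linarith
  have h2 : 0 ≤ D T := by
    have := hL T le_rfl (r T) (hr T hT).1 (hroot T hT)
    simp only [hD]; linarith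
  obtain ⟨t, ht, ht0⟩ := intermediate_value_Icc (min_le_right ε T)
    (hDc.mono fun x hx => lt_of_lt_of_le hm hx.1) ⟨h1, h2⟩
  have htp : 0 < t := lt_of_lt_of_le hm ht.1
  refine ⟨t, htp, r t, (hr t htp).1, by simp only [hD] at ht0; linarith, ?_⟩
  have h3 := hroot t htp
  have h4 : s + b t (r t) = n * t ^ 2 := by simp only [hD] at ht0; linarith
  rw [h4, show n * t ^ 2 / (2 * t) = n * t / 2 by field_simp] at h3
  linarith

/-- The arithmetic behind the sign at large noise, with `β = zt`, `a` the correlation, `b` the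
squared error, `e` the mean norm of the fit and `X` the signal norm. If the sign were wrong (`h5`),
coercivity `h1` would bound `β` and then `e`, whereas `h3` and `h4` force `nβ + K(e + X)` to be at
least `nt/4`. -/
lemma noise_level_le {n s X c K t β a b e m : ℝ} (hn : 0 < n) (hs : 0 ≤ s) (hc : 0 < c)
    (hK : 0 ≤ K) (ht : 1 ≤ t) (hβ : 0 < β) (hb : 0 ≤ b)
    (h1 : c * (e - 1) ≤ β * (a - m / t - b / t)) (h2 : -(m / t) ≤ X ^ 2 / 2 + b / (2 * t ^ 2))
    (h3 : n * β = n * t / 2 + (s + b) / (2 * t) - a)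
    (h4 : a ≤ K * (e + X) + t * (n / 4) + b / (4 * t)) (h5 : n * t ^ 2 ≤ s + b) (he : 0 ≤ e) :
    t ≤ 4 * (n * (1 + (n / 2 + s / 2 + X ^ 2 / 2 + c) / n) +
      K * (1 + (1 + (n / 2 + s / 2 + X ^ 2 / 2 + c) / n) * (n / 2 + s / 2 + X ^ 2 / 2) / c + X)) /
        n := by
  set C := n / 2 + s / 2 + X ^ 2 / 2 with hC
  have hC0 : 0 ≤ C := by positivity
  set B := 1 + (C + c) / n with hB
  have hBn : n * B = n + (C + c) := by rw [hB]; field_simp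
  have htp : 0 < t := by linarith
  set w := t⁻¹ with hw
  have hwp : 0 < w := inv_pos.2 htp
  have hw1 : w ≤ 1 := inv_le_one_of_one_le₀ ht
  have htw : t * w = 1 := mul_inv_cancel₀ htp.ne'
  have e1 : b / t = b * w := rfl
  have e2 : b / (2 * t ^ 2) = b * w ^ 2 / 2 := by rw [hw]; field_simp
  have e3 : (s + b) / (2 * t) = (s + b) * w / 2 := by rw [hw]; field_simp
  have e4 : b / (4 * t) = b * w / 4 := by rw [hw]; field_simp
  rw [e2] at h2
  rw [e3] at h3
  rw [e4] at h4
  rw [e1] at h1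
  -- After `a` is eliminated through the root equation, the terms growing with `t` cancel: `h5` is
  -- multiplied by `w² - w ≤ 0`, where `w = 1/t ≤ 1`.
  have k1 : a - m / t - b * w ≤ C - n * β := by
    have h6 : (s + b) * (w ^ 2 - w) ≤ n * t ^ 2 * (w ^ 2 - w) :=
      mul_le_mul_of_nonpos_right h5 (by nlinarith)
    have h7 : n * t ^ 2 * (w ^ 2 - w) = n - n * t := by
      have : t ^ 2 * (w ^ 2 - w) = (t * w) ^ 2 - t * (t * w) := by ring
      rw [mul_assoc, this, htw]; ring
    have h8 : s * (w - w ^ 2 / 2) ≤ s * (1 / 2) := by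
      gcongr; nlinarith [sq_nonneg (w - 1)]
    have h9 : a = n * t / 2 + (s + b) * w / 2 - n * β := by linarith
    have h10 : b * w ^ 2 / 2 - b * w / 2 = ((s + b) * (w ^ 2 - w) - s * (w ^ 2 - w)) / 2 := by ring
    have h11 : (s + b) * w / 2 = s * w / 2 + b * w / 2 := by ring
    have h12 : a - m / t - b * w ≤
        n * t / 2 + s * w / 2 - n * β + X ^ 2 / 2 + (b * w ^ 2 / 2 - b * w / 2) := by linarith
    rw [h10] at h12
    linarith
  have k2 : c * (e - 1) ≤ β * (C - n * β) := h1.trans (by gcongr)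
  -- For `β > B` the factor `C - nβ` is below `-c` while `β > 1`, so the right side of `k2` is below
  -- `-c`, contradicting `e ≥ 0`.
  have k3 : β ≤ B := by
    by_contra hcon
    have hcon := not_le.1 hcon
    have hβ1 : 1 < β := by
      have : 0 ≤ (C + c) / n := by positivity
      linarith
    have h6 : n * B < n * β := by gcongr
    have h7 : c < n * β - C := by linarith
    have h8 : 1 * c < β * (n * β - C) := by gcongr
    have h9 : 0 ≤ c * e := by positivity
    linarith
  have k4 : e ≤ 1 + B * C / c := by
    have h6 : β * C ≤ B * C := by gcongr
    have h7 : 0 ≤ n * β ^ 2 := by positivity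
    have : e - 1 ≤ B * C / c := by rw [le_div_iff₀ hc]; linarith
    linarith
  rw [le_div_iff₀ hn]
  have k5 : K * (e + X) ≤ K * (1 + B * C / c + X) := by gcongr
  have k6 : n * β ≤ n * B := by gcongr
  have k7 : 0 ≤ s * w := by positivity
  have k8 : 0 ≤ b * w := by positivity
  have k9 : (s + b) * w / 2 = s * w / 2 + b * w / 2 := by ring
  linarith

/-- The arithmetic behind the sign at small noise without noise variance. If `b ≤ nt²`, then the
error `v` and `β` are `O(t)`, so the fit has mean norm close to `X`; coercivity with radius `X / 2`
then bounds `cX / 2` by `O(t)`. -/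
lemma le_noise_level {n X c P t β a b e m v : ℝ} (hn : 0 < n) (hX : 0 ≤ X)
    (hc : 0 < c) (hP : 0 ≤ P) (ht : 0 < t) (ht1 : t ≤ 1) (hβ : 0 < β)
    (h1 : c * (e - X / 2) ≤ β * (a - m / t - b / t)) (hb : 0 ≤ b) (hbn : b ≤ n * t ^ 2)
    (hv : v ≤ b / (2 * t) + t / 2) (he : X - v ≤ e)
    (ha1 : a ≤ t * P / 2 + b / (2 * t)) (ha2 : -a ≤ t * P / 2 + b / (2 * t)) (hm : -m ≤ X * v)
    (h3 : n * β = n * t / 2 + b / (2 * t) - a) :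
    c * X / 2 ≤ t * ((n + (P + n) / 2) / n * ((P + n) / 2 + X * (n + 1) / 2) + c * (n + 1) / 2) := by
  have hbt : b / t ≤ n * t := by rw [div_le_iff₀ ht]; nlinarith
  have hbt0 : 0 ≤ b / t := by positivity
  have hb2 : b / (2 * t) = b / t / 2 := by field_simp
  rw [hb2] at hv ha1 ha2 h3
  have hv' : v ≤ (n + 1) * t / 2 := by linarith
  have hm' : -(m / t) ≤ X * (n + 1) / 2 := by
    rw [← neg_div, div_le_iff₀ ht]
    have : X * v ≤ X * ((n + 1) * t / 2) := by gcongr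
    linarith
  set k1 := (n + (P + n) / 2) / n with hk1
  set k2 := (P + n) / 2 + X * (n + 1) / 2 with hk2
  have hk10 : 0 ≤ k1 := by positivity
  have hk20 : 0 ≤ k2 := by positivity
  have hk1n : n * k1 = n + (P + n) / 2 := by rw [hk1]; field_simp
  have hβk : β ≤ t * k1 := by
    have : n * β ≤ n * (t * k1) := by
      rw [show n * (t * k1) = t * (n * k1) by ring, hk1n]
      nlinarith
    exact le_of_mul_le_mul_left this hn
  have hr : a - m / t - b / t ≤ k2 := by
    have : a ≤ (P + n) / 2 := by nlinarith
    rw [hk2]; linarith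
  have h4 : β * (a - m / t - b / t) ≤ t * k1 * k2 := by
    calc _ ≤ β * k2 := by gcongr
      _ ≤ _ := by gcongr
  have h5 : c * (X - (n + 1) * t / 2 - X / 2) ≤ c * (e - X / 2) := by gcongr; linarith
  nlinarith

end RootFinding


/-! ### Existence for the marginal system -/

section MarginalExistence

set_option linter.unusedSectionVars false

open Filter Topology Set
open scoped RealInnerProductSpace

variable {E : Type*} [NormedAddCommGroup E] [InnerProductSpace ℝ E] [FiniteDimensional ℝ E]
  [MeasurableSpace E] [BorelSpace E] {f : E → ℝ} {F : ℝ → E → E}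

lemma IsProx.norm_error_le (hF : IsProx f F) (h0 : f 0 = 0) (hnn : ∀ x, 0 ≤ f x) {z τ T : ℝ}
    (hz : 0 < z) (hτ : 0 ≤ τ) (hT : τ ≤ T) (x₀ g : E) :
    ‖F z (x₀ + τ • g) - x₀‖ ≤ 2 * ‖x₀‖ + T * ‖g‖ := by
  have h1 := norm_sub_le (F z (x₀ + τ • g)) x₀
  have h2 := hF.norm_le h0 hnn hz (x₀ + τ • g)
  have h3 := norm_add_le x₀ (τ • g)
  rw [norm_smul, Real.norm_eq_abs, abs_of_nonneg hτ] at h3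
  have h4 : τ * ‖g‖ ≤ T * ‖g‖ := by gcongr
  linarith

lemma memLp_affine_norm (X T : ℝ) : MemLp (fun g : E => X + T * ‖g‖) 2 (stdGaussian E) :=
  (memLp_const X).add (memLp_id_stdGaussian.norm.const_mul T)

lemma IsProx.continuousAt_error (hF : IsProx f F) (x₀ g : E) {τ z : ℝ} (hz : 0 < z) :
    ContinuousAt (fun q : ℝ × ℝ => F q.2 (x₀ + q.1 • g) - x₀) (τ, z) := by
  have h1 : ContinuousAt (fun q : ℝ × E => F q.1 q.2) (z, x₀ + τ • g) :=
    hF.continuousOn.continuousAt ((isOpen_Ioi.prod isOpen_univ).mem_nhds ⟨hz, mem_univ _⟩)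
  exact (h1.comp (f := fun q : ℝ × ℝ => (q.2, x₀ + q.1 • g)) (x := (τ, z)) (by fun_prop)).sub_const
    x₀

lemma eventually_parameters {τ z : ℝ} (hτ : 0 < τ) (hz : 0 < z) :
    ∀ᶠ q : ℝ × ℝ in 𝓝 (τ, z), 0 < q.1 ∧ q.1 ≤ τ + 1 ∧ 0 < q.2 := by
  have h1 := (continuous_fst.tendsto (τ, z)).eventually (lt_mem_nhds hτ)
  have h2 := (continuous_fst.tendsto (τ, z)).eventually
    (gt_mem_nhds (show (τ, z).1 < τ + 1 by simp))
  have h3 := (continuous_snd.tendsto (τ, z)).eventually (lt_mem_nhds hz)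
  filter_upwards [h1, h2, h3] with q a b c using ⟨a, b.le, c⟩

lemma IsProx.continuousOn_mse (hF : IsProx f F) (h0 : f 0 = 0) (hnn : ∀ x, 0 ≤ f x) (x₀ : E) :
    ContinuousOn (fun q : ℝ × ℝ => mse F x₀ q.1 q.2) (Ioi 0 ×ˢ Ioi 0) := by
  rintro ⟨τ, z⟩ ⟨hτ, hz⟩
  refine ContinuousAt.continuousWithinAt ?_
  refine continuousAt_of_dominated (bound := fun g => (2 * ‖x₀‖ + (τ + 1) * ‖g‖) ^ 2) ?_ ?_ ?_ ?_
  · filter_upwards [eventually_parameters hτ hz] with q hq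
    exact (integrable_norm_sq_of_memLp (hF.memLp_error hq.2.2 x₀ q.1)).aestronglyMeasurable
  · filter_upwards [eventually_parameters hτ hz] with q hq
    refine ae_of_all _ fun g => ?_
    have := hF.norm_error_le h0 hnn hq.2.2 hq.1.le hq.2.1 x₀ g
    rw [Real.norm_eq_abs, abs_of_nonneg (by positivity)]
    gcongr
  · simpa using integrable_norm_sq_of_memLp (memLp_affine_norm (E := E) (2 * ‖x₀‖) (τ + 1))
  · exact ae_of_all _ fun g => (hF.continuousAt_error x₀ g hz).norm.pow 2

lemma IsProx.continuousOn_corr (hF : IsProx f F) (h0 : f 0 = 0) (hnn : ∀ x, 0 ≤ f x) (x₀ : E) :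
    ContinuousOn (fun q : ℝ × ℝ => corr F x₀ q.1 q.2) (Ioi 0 ×ˢ Ioi 0) := by
  rintro ⟨τ, z⟩ ⟨hτ, hz⟩
  refine ContinuousAt.continuousWithinAt ?_
  refine continuousAt_of_dominated (bound := fun g => ‖g‖ * (2 * ‖x₀‖ + (τ + 1) * ‖g‖)) ?_ ?_ ?_ ?_
  · filter_upwards [eventually_parameters hτ hz] with q hq
    exact (integrable_inner_of_memLp memLp_id_stdGaussian
      (hF.memLp_error hq.2.2 x₀ q.1)).aestronglyMeasurable
  · filter_upwards [eventually_parameters hτ hz] with q hq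
    refine ae_of_all _ fun g => ?_
    have := hF.norm_error_le h0 hnn hq.2.2 hq.1.le hq.2.1 x₀ g
    exact (norm_inner_le_norm _ _).trans (by gcongr)
  · exact memLp_id_stdGaussian.norm.integrable_mul (memLp_affine_norm (E := E) (2 * ‖x₀‖) (τ + 1))
  · exact ae_of_all _ fun g => continuousAt_const.inner (𝕜 := ℝ) (hF.continuousAt_error x₀ g hz)

/-- Up to the factor `1/τ`, the expression is the mean of the quadratic part `‖u‖²/2 - τ⟨g, u⟩` of
the proximal objective. Raising `z` gives this part more weight against `f`, so its value at the
minimizer decreases; adding the two variational inequalities proves this pointwise. -/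
lemma IsProx.objective_antitone (hF : IsProx f F) (x₀ : E) {τ z z' : ℝ} (hτ : 0 < τ) (hz : 0 < z)
    (hzz : z ≤ z') : mse F x₀ τ z' / (2 * τ) - corr F x₀ τ z' ≤
      mse F x₀ τ z / (2 * τ) - corr F x₀ τ z := by
  have hz' : 0 < z' := hz.trans_le hzz
  have hg := memLp_id_stdGaussian (E := E)
  have i1 := fun {w : ℝ} (hw : 0 < w) =>
    (integrable_norm_sq_of_memLp (hF.memLp_error hw x₀ τ)).div_const (2 * τ)
  have i2 := fun {w : ℝ} (hw : 0 < w) => integrable_inner_of_memLp hg (hF.memLp_error hw x₀ τ)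
  have e : ∀ w, 0 < w → mse F x₀ τ w / (2 * τ) - corr F x₀ τ w =
      ∫ g, (‖F w (x₀ + τ • g) - x₀‖ ^ 2 / (2 * τ) - ⟪g, F w (x₀ + τ • g) - x₀⟫)
        ∂stdGaussian E := fun w hw => by
    rw [integral_sub (i1 hw) (i2 hw), integral_div]; rfl
  rw [e z hz, e z' hz']
  refine integral_mono ((i1 hz').sub (i2 hz')) ((i1 hz).sub (i2 hz)) fun g => ?_
  rcases hzz.eq_or_lt with rfl | hlt
  · exact le_rfl
  have h1 := hF z hz (x₀ + τ • g) (F z' (x₀ + τ • g))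
  have h2 := hF z' hz' (x₀ + τ • g) (F z (x₀ + τ • g))
  set u := F z (x₀ + τ • g) - x₀ with hu
  set u' := F z' (x₀ + τ • g) - x₀ with hu'
  rw [show x₀ + τ • g - F z (x₀ + τ • g) = τ • g - u by simp only [hu]; abel,
    show F z' (x₀ + τ • g) - F z (x₀ + τ • g) = u' - u by simp only [hu, hu']; abel] at h1
  rw [show x₀ + τ • g - F z' (x₀ + τ • g) = τ • g - u' by simp only [hu']; abel,
    show F z (x₀ + τ • g) - F z' (x₀ + τ • g) = u - u' by simp only [hu, hu']; abel] at h2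
  simp only [inner_sub_left, inner_sub_right, real_inner_smul_left,
    real_inner_self_eq_norm_sq] at h1 h2
  rw [real_inner_comm u u'] at h2
  have hsq : 0 ≤ ‖u‖ ^ 2 - 2 * ⟪u, u'⟫ + ‖u'‖ ^ 2 := by
    rw [← norm_sub_sq_real]; positivity
  have h3 : (z' - z) * (‖u'‖ ^ 2 / 2 - τ * ⟪g, u'⟫) ≤ (z' - z) * (‖u‖ ^ 2 / 2 - τ * ⟪g, u⟫) := by
    nlinarith
  have h4 := le_of_mul_le_mul_left h3 (sub_pos.2 hlt)
  have e1 : ∀ x y : ℝ, x / (2 * τ) - y = (x / 2 - τ * y) / τ := fun x y => by field_simp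
  simp only [e1]
  gcongr

/-- Test the variational inequality at `w = 0`, insert the coercivity bound and integrate. The
linear term `τ⟨g, x₀⟩` has mean zero and is added so that the integrands compare pointwise. -/
lemma IsProx.coercive_integral_le (hF : IsProx f F) (h0 : f 0 = 0) {c r : ℝ}
    (hc : ∀ x, c * (‖x‖ - r) ≤ f x) (x₀ : E) {τ z : ℝ} (hz : 0 < z) :
    c * ((∫ g, ‖F z (x₀ + τ • g)‖ ∂stdGaussian E) - r) ≤ z * (τ * corr F x₀ τ z -
      (∫ g, ⟪F z (x₀ + τ • g) - x₀, x₀⟫ ∂stdGaussian E) - mse F x₀ τ z) := by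
  have hg := memLp_id_stdGaussian (E := E)
  have hu := hF.memLp_error hz x₀ τ
  have i0 : Integrable (fun g => ‖F z (x₀ + τ • g)‖) (stdGaussian E) :=
    ((hF.memLp_comp hz x₀ τ).integrable (by norm_num)).norm
  have i1 := (integrable_inner_of_memLp hg hu).const_mul τ
  have i2 := integrable_inner_of_memLp hu (memLp_const x₀)
  have i3 := integrable_norm_sq_of_memLp hu
  have i4 : Integrable (fun g : E => τ * ⟪g, x₀⟫) (stdGaussian E) :=
    (integrable_inner_of_memLp hg (memLp_const x₀)).const_mul τ
  have e1 := integral_sub i1 i2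
  have e2 := integral_sub (i1.sub i2) i3
  have e3 := integral_add ((i1.sub i2).sub i3) i4
  simp only [Pi.sub_apply] at e1 e2 e3
  have hR : z * (τ * corr F x₀ τ z -
      (∫ g, ⟪F z (x₀ + τ • g) - x₀, x₀⟫ ∂stdGaussian E) - mse F x₀ τ z) =
      ∫ g, z * (τ * ⟪g, F z (x₀ + τ • g) - x₀⟫ - ⟪F z (x₀ + τ • g) - x₀, x₀⟫ -
        ‖F z (x₀ + τ • g) - x₀‖ ^ 2 + τ * ⟪g, x₀⟫) ∂stdGaussian E := by
    rw [integral_const_mul, e3, e2, e1, integral_const_mul, integral_const_mul,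
      integral_inner_const_stdGaussian, mul_zero, add_zero]
    rfl
  have hLe : c * ((∫ g, ‖F z (x₀ + τ • g)‖ ∂stdGaussian E) - r) =
      ∫ g, c * (‖F z (x₀ + τ • g)‖ - r) ∂stdGaussian E := by
    rw [integral_const_mul, integral_sub i0 (integrable_const r)]
    simp
  rw [hR, hLe]
  refine integral_mono ((i0.sub (integrable_const r)).const_mul c)
    ((((i1.sub i2).sub i3).add i4).const_mul z) fun g => ?_
  have h1 := hF z hz (x₀ + τ • g) 0
  set u := F z (x₀ + τ • g) - x₀ with hu
  have hFu : F z (x₀ + τ • g) = x₀ + u := by simp only [hu]; abel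
  have h2 := hc (F z (x₀ + τ • g))
  rw [h0] at h1
  have h3 : ⟪x₀ + τ • g - F z (x₀ + τ • g), 0 - F z (x₀ + τ • g)⟫ =
      -(τ * ⟪g, u⟫ - ⟪u, x₀⟫ - ‖u‖ ^ 2 + τ * ⟪g, x₀⟫) := by
    rw [hFu, show x₀ + τ • g - (x₀ + u) = τ • g - u by abel, zero_sub, inner_neg_right]
    simp only [inner_sub_left, inner_add_right, real_inner_smul_left, real_inner_self_eq_norm_sq]
    ring
  rw [h3] at h1
  simp only
  linarith

lemma exists_tail_le {δ : ℝ} (hδ : 0 < δ) : ∃ K : ℝ, 0 ≤ K ∧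
    ∫ g, {g : E | K < ‖g‖}.indicator (fun g => ‖g‖ ^ 2) g ∂stdGaussian E ≤ δ := by
  have hlim : Tendsto (fun N : ℕ => ∫ g, {g : E | (N : ℝ) < ‖g‖}.indicator (fun g => ‖g‖ ^ 2) g
      ∂stdGaussian E) atTop (𝓝 (∫ _, 0 ∂stdGaussian E)) := by
    refine tendsto_integral_of_dominated_convergence (fun g => ‖g‖ ^ 2) (fun N => ?_)
      (integrable_norm_sq_of_memLp memLp_id_stdGaussian) (fun N => ae_of_all _ fun g => ?_)
      (ae_of_all _ fun g => ?_)
    · exact (Continuous.measurable (by fun_prop)).indicator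
        (measurableSet_lt measurable_const measurable_norm) |>.aestronglyMeasurable
    · rw [Real.norm_eq_abs, abs_of_nonneg (indicator_nonneg (fun _ _ => by positivity) _)]
      exact indicator_le_self' (fun _ _ => by positivity) _
    · obtain ⟨N, hN⟩ := exists_nat_ge ‖g‖
      refine tendsto_const_nhds.congr' ?_
      filter_upwards [eventually_ge_atTop N] with M hM
      rw [indicator_of_notMem]
      simp only [mem_ofPred_eq, not_lt]
      exact hN.trans (by exact_mod_cast hM)
  rw [integral_zero] at hlim
  obtain ⟨N, hN⟩ := (hlim.eventually (gt_mem_nhds hδ)).exists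
  exact ⟨N, by positivity, hN.le⟩

/-- As `z → 0` the penalty dominates and the proximal point shrinks to within roughly `r` of the
origin, so the correlation with `g` becomes small; the fixed vector `x₀` does not contribute to it.
-/
lemma IsProx.exists_small_param (hF : IsProx f F) (h0 : f 0 = 0)
    (hcoer : ∀ r, 0 < r → ∃ c, 0 < c ∧ ∀ x, c * (‖x‖ - r) ≤ f x) (x₀ : E) {n s τ : ℝ}
    (hn : 0 < n) (hs : 0 ≤ s) (hτ : 0 < τ) :
    ∃ z, 0 < z ∧ n * z * τ < n * τ / 2 + (s + mse F x₀ τ z) / (2 * τ) - corr F x₀ τ z := by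
  have hg := memLp_id_stdGaussian (E := E)
  have hg3 : Integrable (fun g : E => ‖g‖ ^ 3) (stdGaussian E) :=
    (IsGaussian.memLp_id (stdGaussian E) 3 (by norm_num)).integrable_norm_pow (by norm_num)
  have hg1 : Integrable (fun g : E => ‖g‖) (stdGaussian E) := (hg.integrable (by norm_num)).norm
  set G := ∫ g, ‖g‖ ∂stdGaussian E with hG
  have hG0 : 0 ≤ G := integral_nonneg fun _ => norm_nonneg _
  set W := ∫ g, (2 * ‖x₀‖ ^ 2 * ‖g‖ + 2 * τ ^ 2 * ‖g‖ ^ 3) ∂stdGaussian E with hW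
  have hW0 : 0 ≤ W := integral_nonneg fun _ => by positivity
  -- With this `r` the term `r * G` is at most `nτ/8`; the `z` below makes `nzτ` plus the remaining
  -- bound on the correlation equal to `nτ/8`. The total stays below `nτ/2`.
  set r := n * τ / (8 * (G + 1)) with hr
  have hr0 : 0 < r := by positivity
  obtain ⟨c, hc0, hc⟩ := hcoer r hr0
  set z := n * τ / (8 * (n * τ + W / c)) with hz
  have hz0 : 0 < z := by positivity
  refine ⟨z, hz0, ?_⟩
  have hcorr : corr F x₀ τ z ≤ r * G + z / c * W := by
    have i1 := integrable_inner_of_memLp hg (hF.memLp_error hz0 x₀ τ)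
    have i2 := integrable_inner_of_memLp hg (memLp_const x₀)
    have i3 : Integrable (fun g : E => 2 * ‖x₀‖ ^ 2 * ‖g‖ + 2 * τ ^ 2 * ‖g‖ ^ 3) (stdGaussian E) :=
      (hg1.const_mul _).add (hg3.const_mul _)
    have e1 : corr F x₀ τ z =
        ∫ g, (⟪g, F z (x₀ + τ • g) - x₀⟫ + ⟪g, x₀⟫) ∂stdGaussian E := by
      rw [integral_add i1 i2, integral_inner_const_stdGaussian, add_zero]; rfl
    have e2 : r * G + z / c * W = ∫ g, (r * ‖g‖ + z / c *
        (2 * ‖x₀‖ ^ 2 * ‖g‖ + 2 * τ ^ 2 * ‖g‖ ^ 3)) ∂stdGaussian E := by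
      rw [integral_add (hg1.const_mul _) (i3.const_mul _), integral_const_mul, integral_const_mul]
    rw [e1, e2]
    refine integral_mono (i1.add i2) ((hg1.const_mul _).add (i3.const_mul _)) fun g => ?_
    simp only
    rw [← inner_add_right, sub_add_cancel]
    set y := x₀ + τ • g with hy
    have h1 := hF z hz0 y 0
    have h2 := hc (F z y)
    rw [h0, zero_sub, inner_neg_right, inner_sub_left, real_inner_self_eq_norm_sq] at h1
    have h3 := real_inner_le_norm y (F z y)
    have h4 : c * (‖F z y‖ - r) ≤ z * ‖y‖ ^ 2 := by
      have h5 : ⟪y, F z y⟫ - ‖F z y‖ ^ 2 ≤ ‖y‖ ^ 2 := by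
        nlinarith [sq_nonneg (‖y‖ - ‖F z y‖), sq_nonneg ‖y‖, sq_nonneg ‖F z y‖]
      have h6 : z * (⟪y, F z y⟫ - ‖F z y‖ ^ 2) ≤ z * ‖y‖ ^ 2 := by gcongr
      linarith
    have h5 : ‖F z y‖ ≤ r + z / c * ‖y‖ ^ 2 := by
      have : ‖F z y‖ - r ≤ z * ‖y‖ ^ 2 / c := by rw [le_div_iff₀ hc0]; linarith
      rw [div_mul_eq_mul_div]; linarith
    have h6 : ‖y‖ ^ 2 ≤ 2 * ‖x₀‖ ^ 2 + 2 * τ ^ 2 * ‖g‖ ^ 2 := by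
      have h7 := norm_add_le x₀ (τ • g)
      rw [norm_smul, Real.norm_eq_abs, abs_of_pos hτ] at h7
      have h8 : ‖y‖ ^ 2 ≤ (‖x₀‖ + τ * ‖g‖) ^ 2 := by gcongr
      nlinarith [sq_nonneg (‖x₀‖ - τ * ‖g‖)]
    calc ⟪g, F z y⟫ ≤ ‖g‖ * ‖F z y‖ := real_inner_le_norm _ _
      _ ≤ ‖g‖ * (r + z / c * (2 * ‖x₀‖ ^ 2 + 2 * τ ^ 2 * ‖g‖ ^ 2)) := by
          gcongr
          exact h5.trans (by gcongr)
      _ = _ := by ring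
  have h1 : r * G ≤ n * τ / 8 := by
    rw [hr, div_mul_eq_mul_div, div_le_div_iff₀ (by positivity) (by norm_num)]
    have : 0 ≤ n * τ := by positivity
    nlinarith
  have h2 : n * z * τ + z / c * W = n * τ / 8 := by
    have : n * z * τ + z / c * W = z * (n * τ + W / c) := by field_simp
    rw [this, hz]
    field_simp
  have h3 : 0 ≤ (s + mse F x₀ τ z) / (2 * τ) := by
    have := mse_nonneg F x₀ τ z
    positivity
  have h4 : 0 < n * τ := by positivity
  linarith

lemma IsProx.exists_large_noise (hF : IsProx f F) (h0 : f 0 = 0)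
    (hcoer : ∀ r, 0 < r → ∃ c, 0 < c ∧ ∀ x, c * (‖x‖ - r) ≤ f x) (x₀ : E) {n s : ℝ}
    (hn : 0 < n) (hs : 0 ≤ s) : ∃ T, 0 < T ∧ ∀ τ, T ≤ τ → ∀ z, 0 < z →
      n * z * τ = n * τ / 2 + (s + mse F x₀ τ z) / (2 * τ) - corr F x₀ τ z →
      s + mse F x₀ τ z ≤ n * τ ^ 2 := by
  obtain ⟨c, hc0, hc⟩ := hcoer 1 one_pos
  obtain ⟨K, hK0, hK⟩ := exists_tail_le (E := E) (show 0 < n / 4 by positivity)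
  set X := ‖x₀‖ with hX
  set T := 4 * (n * (1 + (n / 2 + s / 2 + X ^ 2 / 2 + c) / n) +
      K * (1 + (1 + (n / 2 + s / 2 + X ^ 2 / 2 + c) / n) * (n / 2 + s / 2 + X ^ 2 / 2) / c + X)) /
        n with hT
  refine ⟨max 1 T + 1, by positivity, fun τ hτ z hz hroot => ?_⟩
  by_contra hcon
  have hτ1 : 1 ≤ τ := by linarith [le_max_left 1 T]
  have hτ0 : 0 < τ := by linarith
  have hg := memLp_id_stdGaussian (E := E)
  have hu := hF.memLp_error hz x₀ τ
  have i1 := integrable_inner_of_memLp hg hu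
  have i2 := integrable_inner_of_memLp hu (memLp_const x₀)
  have i3 := integrable_norm_sq_of_memLp hu
  have i0 : Integrable (fun g => ‖F z (x₀ + τ • g)‖) (stdGaussian E) :=
    ((hF.memLp_comp hz x₀ τ).integrable (by norm_num)).norm
  have h1 := hF.coercive_integral_le h0 hc x₀ (τ := τ) hz
  set a := corr F x₀ τ z with ha
  set b := mse F x₀ τ z with hb
  set m := ∫ g, ⟪F z (x₀ + τ • g) - x₀, x₀⟫ ∂stdGaussian E with hm
  set e := ∫ g, ‖F z (x₀ + τ • g)‖ ∂stdGaussian E with he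
  have hle : τ ≤ T := by
    refine noise_level_le (β := z * τ) (a := a) (b := b) (e := e) (m := m) hn hs hc0 hK0 hτ1
      (by positivity) (mse_nonneg _ _ _ _) ?_ ?_ ?_ ?_ (le_of_not_ge hcon)
      (integral_nonneg fun _ => norm_nonneg _)
    · refine h1.trans_eq ?_
      field_simp
    · have h2 : -m ≤ τ * X ^ 2 / 2 + b / (2 * τ) := by
        have i4 := i3.div_const (2 * τ)
        have e1 : τ * X ^ 2 / 2 + b / (2 * τ) =
            ∫ g, (τ * X ^ 2 / 2 + ‖F z (x₀ + τ • g) - x₀‖ ^ 2 / (2 * τ)) ∂stdGaussian E := by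
          rw [integral_add (integrable_const _) i4, integral_const, integral_div]
          simp [hb, mse]
        rw [e1, hm, ← integral_neg]
        refine integral_mono i2.neg ((integrable_const _).add i4) fun g => ?_
        set u := F z (x₀ + τ • g) - x₀
        have h3 : -⟪u, x₀⟫ ≤ ‖u‖ * X := (neg_le_abs _).trans (abs_real_inner_le_norm _ _)
        have h4 : ‖u‖ * X ≤ τ * X ^ 2 / 2 + ‖u‖ ^ 2 / (2 * τ) := by
          have : τ * X ^ 2 / 2 + ‖u‖ ^ 2 / (2 * τ) - ‖u‖ * X = (τ * X - ‖u‖) ^ 2 / (2 * τ) := by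
            field_simp; ring
          have h5 : 0 ≤ (τ * X - ‖u‖) ^ 2 / (2 * τ) := by positivity
          linarith
        exact h3.trans h4
      have h3 : -m / τ ≤ (τ * X ^ 2 / 2 + b / (2 * τ)) / τ := by gcongr
      rw [neg_div] at h3
      refine h3.trans_eq ?_
      field_simp
    · linarith
    -- Bound `⟨g, u⟩` by `K‖u‖` where `‖g‖ ≤ K`, and by Young's inequality `τ‖g‖² + ‖u‖²/(4τ)` on
    -- the tail. The choice of `K` makes the tail cost at most `τ n/4`, half of the term `nτ/2` in
    -- the root equation.
    · have i5 : Integrable (fun g => ‖F z (x₀ + τ • g) - x₀‖) (stdGaussian E) :=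
        (hu.integrable (by norm_num)).norm
      have i6 : Integrable (fun g : E => {g : E | K < ‖g‖}.indicator (fun g => ‖g‖ ^ 2) g)
          (stdGaussian E) :=
        (integrable_norm_sq_of_memLp hg).indicator (measurableSet_lt measurable_const measurable_norm)
      have i7 := i3.div_const (4 * τ)
      have j1 := (i0.add (integrable_const X)).const_mul K
      have j2 := i6.const_mul τ
      have e1 := integral_add (j1.add j2) i7
      have e2 := integral_add j1 j2
      have e3 := integral_add i0 (integrable_const X)
      simp only [Pi.add_apply] at e1 e2 e3 j1
      have hle : a ≤ K * (e + X) +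
          τ * (∫ g, {g : E | K < ‖g‖}.indicator (fun g => ‖g‖ ^ 2) g ∂stdGaussian E) +
            b / (4 * τ) := by
        have e4 : K * (e + X) +
          τ * (∫ g, {g : E | K < ‖g‖}.indicator (fun g => ‖g‖ ^ 2) g ∂stdGaussian E) +
            b / (4 * τ) = ∫ g, (K * (‖F z (x₀ + τ • g)‖ + X) +
              τ * {g : E | K < ‖g‖}.indicator (fun g => ‖g‖ ^ 2) g +
              ‖F z (x₀ + τ • g) - x₀‖ ^ 2 / (4 * τ)) ∂stdGaussian E := by
          rw [e1, e2, integral_const_mul, integral_const_mul, e3, integral_div]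
          simp [hb, mse, he]
        rw [e4]
        refine integral_mono i1 ((j1.add j2).add i7) fun g => ?_
        set u := F z (x₀ + τ • g) - x₀ with hudef
        have h3 : ⟪g, u⟫ ≤ ‖g‖ * ‖u‖ := real_inner_le_norm _ _
        have h4 : ‖u‖ ≤ ‖F z (x₀ + τ • g)‖ + X := norm_sub_le _ _
        refine h3.trans ?_
        by_cases hKg : K < ‖g‖
        · rw [indicator_of_mem (by exact hKg)]
          have h5 : ‖g‖ * ‖u‖ ≤ τ * ‖g‖ ^ 2 + ‖u‖ ^ 2 / (4 * τ) := by
            have : τ * ‖g‖ ^ 2 + ‖u‖ ^ 2 / (4 * τ) - ‖g‖ * ‖u‖ =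
                (2 * τ * ‖g‖ - ‖u‖) ^ 2 / (4 * τ) := by
              field_simp; ring
            have h5 : 0 ≤ (2 * τ * ‖g‖ - ‖u‖) ^ 2 / (4 * τ) := by positivity
            linarith
          have h6 : 0 ≤ K * (‖F z (x₀ + τ • g)‖ + X) := by positivity
          linarith
        · rw [indicator_of_notMem (by exact hKg), mul_zero, add_zero]
          have h5 : ‖g‖ * ‖u‖ ≤ K * (‖F z (x₀ + τ • g)‖ + X) := by
            have := not_lt.1 hKg
            gcongr
          have h6 : 0 ≤ ‖u‖ ^ 2 / (4 * τ) := by positivity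
          linarith
      have : τ * (∫ g, {g : E | K < ‖g‖}.indicator (fun g => ‖g‖ ^ 2) g ∂stdGaussian E) ≤
        τ * (n / 4) := by gcongr
      linarith
  have := le_max_right 1 T
  linarith

/-- If `s > 0`, the claim already holds once `nτ² ≤ s`. If `s = 0`, the signal is nonzero and a
squared error below `nτ²` would keep the fit away from the origin, where coercivity makes the
penalty too costly. -/
lemma IsProx.exists_small_noise (hF : IsProx f F) (h0 : f 0 = 0)
    (hcoer : ∀ r, 0 < r → ∃ c, 0 < c ∧ ∀ x, c * (‖x‖ - r) ≤ f x) (x₀ : E) {n s : ℝ}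
    (hn : 0 < n) (hs : 0 ≤ s) (hnd : s ≠ 0 ∨ x₀ ≠ 0) : ∃ ε, 0 < ε ∧ ∀ τ, 0 < τ → τ ≤ ε → ∀ z, 0 < z →
      n * z * τ = n * τ / 2 + (s + mse F x₀ τ z) / (2 * τ) - corr F x₀ τ z →
      n * τ ^ 2 ≤ s + mse F x₀ τ z := by
  rcases hs.eq_or_lt with hs0 | hs0
  swap
  · refine ⟨√(s / n), by positivity, fun τ hτ hτε z hz _ => ?_⟩
    have h1 : τ ^ 2 ≤ s / n := by
      rw [← Real.sq_sqrt (by positivity : 0 ≤ s / n)]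
      gcongr
    rw [le_div_iff₀ hn] at h1
    have := mse_nonneg F x₀ τ z
    linarith
  subst hs0
  have hx : x₀ ≠ 0 := by simpa using hnd
  set X := ‖x₀‖ with hX
  have hX0 : 0 < X := norm_pos_iff.2 hx
  obtain ⟨c, hc0, hc⟩ := hcoer (X / 2) (by positivity)
  set P := ∫ g, ‖g‖ ^ 2 ∂stdGaussian E with hP
  have hP0 : 0 ≤ P := integral_nonneg fun _ => by positivity
  set k := (n + (P + n) / 2) / n * ((P + n) / 2 + X * (n + 1) / 2) + c * (n + 1) / 2 with hk
  have hk0 : 0 < k := by positivity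
  -- A wrong sign would give `cX/2 ≤ τk`; half of that threshold for `τ` is excluded.
  refine ⟨min 1 (c * X / (4 * k)), by positivity, fun τ hτ hτε z hz hroot => ?_⟩
  by_contra hcon
  have hg := memLp_id_stdGaussian (E := E)
  have hu := hF.memLp_error hz x₀ τ
  have i1 := integrable_inner_of_memLp hg hu
  have i2 := integrable_inner_of_memLp hu (memLp_const x₀)
  have i3 := integrable_norm_sq_of_memLp hu
  have i4 := integrable_norm_sq_of_memLp hg
  have i5 : Integrable (fun g => ‖F z (x₀ + τ • g) - x₀‖) (stdGaussian E) :=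
    (hu.integrable (by norm_num)).norm
  have i0 : Integrable (fun g => ‖F z (x₀ + τ • g)‖) (stdGaussian E) :=
    ((hF.memLp_comp hz x₀ τ).integrable (by norm_num)).norm
  have h1 := hF.coercive_integral_le h0 hc x₀ (τ := τ) hz
  set a := corr F x₀ τ z with ha
  set b := mse F x₀ τ z with hb
  set m := ∫ g, ⟪F z (x₀ + τ • g) - x₀, x₀⟫ ∂stdGaussian E with hm
  set e := ∫ g, ‖F z (x₀ + τ • g)‖ ∂stdGaussian E with he
  set v := ∫ g, ‖F z (x₀ + τ • g) - x₀‖ ∂stdGaussian E with hv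
  have j1 := (i4.const_mul τ).div_const 2
  have j2 := i3.div_const (2 * τ)
  have hP2 : τ * P / 2 + b / (2 * τ) =
      ∫ g, (τ * ‖g‖ ^ 2 / 2 + ‖F z (x₀ + τ • g) - x₀‖ ^ 2 / (2 * τ)) ∂stdGaussian E := by
    rw [integral_add j1 j2, integral_div, integral_div, integral_const_mul]
    rfl
  have young : ∀ x y : ℝ, x * y ≤ τ * x ^ 2 / 2 + y ^ 2 / (2 * τ) := fun x y => by
    have : τ * x ^ 2 / 2 + y ^ 2 / (2 * τ) - x * y = (τ * x - y) ^ 2 / (2 * τ) := by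
      field_simp; ring
    have h5 : 0 ≤ (τ * x - y) ^ 2 / (2 * τ) := by positivity
    linarith
  have hle := le_noise_level (n := n) (X := X) (c := c) (P := P) (t := τ) (β := z * τ) (a := a)
    (b := b) (e := e) (m := m) (v := v) hn hX0.le hc0 hP0 hτ (hτε.trans (min_le_left _ _))
    (by positivity) (h1.trans_eq (by field_simp)) (mse_nonneg _ _ _ _)
    (by linarith [le_of_not_ge hcon]) ?_ ?_ ?_ ?_ ?_ (by rw [zero_add] at hroot; linarith)
  · have h2 : τ ≤ c * X / (4 * k) := hτε.trans (min_le_right _ _)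
    rw [le_div_iff₀ (by positivity)] at h2
    rw [← hk] at hle
    have : 0 < c * X := by positivity
    linarith
  · have e1 : b / (2 * τ) + τ / 2 =
        ∫ g, (‖F z (x₀ + τ • g) - x₀‖ ^ 2 / (2 * τ) + τ / 2) ∂stdGaussian E := by
      rw [integral_add j2 (integrable_const _), integral_div]
      simp [hb, mse]
    rw [e1]
    refine integral_mono i5 (j2.add (integrable_const _)) fun g => ?_
    have := young 1 ‖F z (x₀ + τ • g) - x₀‖
    simp only [one_mul, one_pow, mul_one] at this
    linarith
  · have e1 : X - v = ∫ g, (X - ‖F z (x₀ + τ • g) - x₀‖) ∂stdGaussian E := by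
      rw [integral_sub (integrable_const _) i5]
      simp [hv]
    rw [e1]
    refine integral_mono ((integrable_const _).sub i5) i0 fun g => ?_
    have h2 := norm_sub_le (F z (x₀ + τ • g)) (F z (x₀ + τ • g) - x₀)
    rw [sub_sub_cancel] at h2
    simp only
    linarith
  · rw [hP2]
    refine integral_mono i1 (j1.add j2) fun g => ?_
    exact (real_inner_le_norm _ _).trans (young _ _)
  · rw [hP2, ha, corr, ← integral_neg]
    refine integral_mono i1.neg (j1.add j2) fun g => ?_
    exact (neg_le_abs _).trans ((abs_real_inner_le_norm _ _).trans (young _ _))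
  · rw [hm, hv, ← integral_neg, ← integral_const_mul]
    refine integral_mono i2.neg (i5.const_mul X) fun g => ?_
    refine (neg_le_abs _).trans ((abs_real_inner_le_norm _ _).trans_eq (mul_comm _ _))

/-- Existence of a solution with positive noise level for a coercive penalty. -/
theorem exists_marginalSol (hF : IsProx f F) (h0 : f 0 = 0) (hnn : ∀ x, 0 ≤ f x)
    (hcoer : ∀ r, 0 < r → ∃ c, 0 < c ∧ ∀ x, c * (‖x‖ - r) ≤ f x) (x₀ : E) {n s : ℝ}
    (hn : 0 < n) (hs : 0 ≤ s) (hnd : s ≠ 0 ∨ x₀ ≠ 0) :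
    ∃ τ z, 0 < τ ∧ MarginalSol F x₀ n s τ z := by
  obtain ⟨τ, hτ, z, hz, h1, h2⟩ := exists_root_pair (s := s) hn (hF.continuousOn_corr h0 hnn x₀)
    (hF.continuousOn_mse h0 hnn x₀)
    (fun τ hτ z hz z' hzz => hF.objective_antitone x₀ hτ hz hzz)
    (fun τ hτ => hF.exists_small_param h0 hcoer x₀ hn hs hτ)
    (hF.exists_large_noise h0 hcoer x₀ hn hs)
    (hF.exists_small_noise h0 hcoer x₀ hn hs hnd)
  exact ⟨τ, z, hτ, hτ.le, hz, h1, h2⟩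

end MarginalExistence


/-! ### The covariance equation -/

section Cross

open scoped RealInnerProductSpace

/-- A firmly nonexpansive map. -/
def Firm {E : Type*} [NormedAddCommGroup E] [InnerProductSpace ℝ E] (U : E → E) : Prop :=
  ∀ y y', ‖U y - U y'‖ ^ 2 ≤ ⟪U y - U y', y - y'⟫

lemma Firm.lipschitz {E : Type*} [NormedAddCommGroup E] [InnerProductSpace ℝ E] {U : E → E}
    (hU : Firm U) : LipschitzWith 1 U :=
  LipschitzWith.of_dist_le_mul fun y y' => by
    rw [NNReal.coe_one, one_mul, dist_eq_norm, dist_eq_norm]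
    have h1 := (hU y y').trans (real_inner_le_norm _ _)
    rcases (norm_nonneg (U y - U y')).eq_or_lt with h3 | h3
    · rw [← h3]; positivity
    · nlinarith

lemma posSemidef_two {a b r : ℝ} (ha : 0 ≤ a) (hb : 0 ≤ b) (h : r ^ 2 ≤ a * b) :
    (!![a, r; r, b] : Matrix (Fin 2) (Fin 2) ℝ).PosSemidef := by
  refine Matrix.PosSemidef.of_dotProduct_mulVec_nonneg ?_ fun x => ?_
  · ext i j
    fin_cases i <;> fin_cases j <;> simp
  · have e : star x ⬝ᵥ !![a, r; r, b] *ᵥ x = a * x 0 ^ 2 + 2 * r * (x 0 * x 1) + b * x 1 ^ 2 := by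
      simp [dotProduct, Matrix.mulVec, Fin.sum_univ_two]
      ring
    rw [e]
    rcases ha.eq_or_lt with h0 | h0
    · rw [← h0, zero_mul] at h
      have hr : r = 0 := pow_eq_zero_iff two_ne_zero |>.1 (le_antisymm h (sq_nonneg r))
      rw [← h0, hr]
      have : 0 ≤ b * x 1 ^ 2 := by positivity
      linarith
    · have h1 : 0 ≤ a * (a * x 0 ^ 2 + 2 * r * (x 0 * x 1) + b * x 1 ^ 2) := by
        have : a * (a * x 0 ^ 2 + 2 * r * (x 0 * x 1) + b * x 1 ^ 2) =
            (a * x 0 + r * x 1) ^ 2 + (a * b - r ^ 2) * x 1 ^ 2 := by ring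
        rw [this]
        have : 0 ≤ (a * b - r ^ 2) * x 1 ^ 2 := mul_nonneg (by linarith) (sq_nonneg _)
        positivity
      exact nonneg_of_mul_nonneg_right h1 h0

variable {p m : ℕ}

/-- The mixed moment `E⟨U₁(g₁), U₂(g₂)⟩` for `(g₁, g₂) ∼ N(0, S ⊗ I)`. -/
noncomputable def cross (U₁ U₂ : EuclideanSpace ℝ (Fin p) → EuclideanSpace ℝ (Fin p))
    (S : Matrix (Fin 2) (Fin 2) ℝ) : ℝ :=
  ∫ g, ⟪U₁ (block 0 g), U₂ (block 1 g)⟫ ∂Model.noiseLaw p S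

/-- The moment `E⟨U(τ g), τ g⟩` for standard Gaussian `g`. -/
noncomputable def selfCorr (U : EuclideanSpace ℝ (Fin p) → EuclideanSpace ℝ (Fin p)) (τ : ℝ) : ℝ :=
  ∫ g, ⟪U (τ • g), τ • g⟫ ∂stdGaussian (EuclideanSpace ℝ (Fin p))

lemma cross_gram {U₁ U₂ : EuclideanSpace ℝ (Fin p) → EuclideanSpace ℝ (Fin p)}
    (h₁ : Continuous U₁) (h₂ : Continuous U₂) (c : Fin 2 → Fin m → ℝ) :
    cross U₁ U₂ (gram c) = ∫ z, ⟪U₁ (comb (c 0) z), U₂ (comb (c 1) z)⟫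
      ∂stdGaussian (EuclideanSpace ℝ (Fin m × Fin p)) :=
  integral_blocks_noiseLaw_gram c (φ := fun x y => ⟪U₁ x, U₂ y⟫)
    ((h₁.comp continuous_fst).inner (h₂.comp continuous_snd))

lemma comb_add_smul (a b : ℝ) (c d : Fin m → ℝ) (z : EuclideanSpace ℝ (Fin m × Fin p)) :
    comb (a • c + b • d) z = a • comb c z + b • comb d z := by
  ext j
  simp only [comb_apply, PiLp.add_apply, PiLp.smul_apply, Pi.add_apply, Pi.smul_apply, smul_eq_mul,
    Finset.mul_sum, ← Finset.sum_add_distrib]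
  exact Finset.sum_congr rfl fun i _ => by ring

lemma memLp_comb (c : Fin m → ℝ) : MemLp (fun z => comb c z) 2
    (stdGaussian (EuclideanSpace ℝ (Fin m × Fin p))) :=
  memLp_two_of_lipschitz memLp_id_stdGaussian (comb c).lipschitz

lemma Firm.memLp_comb {U : EuclideanSpace ℝ (Fin p) → EuclideanSpace ℝ (Fin p)} (hU : Firm U)
    (c : Fin m → ℝ) : MemLp (fun z => U (comb c z)) 2
    (stdGaussian (EuclideanSpace ℝ (Fin m × Fin p))) :=
  memLp_two_of_lipschitz memLp_id_stdGaussian (hU.lipschitz.comp (comb c).lipschitz)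

/-- Replacing `d` by `-d` leaves the Gram matrix, hence the joint law, unchanged, so the integral
equals its own negative. -/
lemma integral_inner_comb_of_orthogonal
    {U : EuclideanSpace ℝ (Fin p) → EuclideanSpace ℝ (Fin p)} (hU : Firm U)
    {c d : Fin m → ℝ} (hcd : c ⬝ᵥ d = 0) :
    ∫ z, ⟪U (comb c z), comb d z⟫ ∂stdGaussian (EuclideanSpace ℝ (Fin m × Fin p)) = 0 := by
  have hc := hU.lipschitz.continuous
  have h1 := cross_gram hc continuous_id ![c, d]
  have h2 := cross_gram hc continuous_id ![c, (0 : ℝ) • c + (-1 : ℝ) • d]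
  have hg : gram ![c, d] = gram ![c, (0 : ℝ) • c + (-1 : ℝ) • d] := by
    ext i j
    fin_cases i <;> fin_cases j <;> simp [gram, hcd, dotProduct_comm d c]
  rw [← hg, h1] at h2
  simp only [Matrix.cons_val_zero, Matrix.cons_val_one, id] at h2
  simp only [comb_add_smul] at h2
  simp only [zero_smul, zero_add, neg_smul, one_smul, inner_neg_right, integral_neg] at h2
  linarith

/-- Project `d` onto `c`; the orthogonal remainder is independent of `comb c` and contributes
nothing. The scaling by `τ²` avoids dividing by `c ⬝ᵥ c`. -/
lemma integral_inner_comb {U : EuclideanSpace ℝ (Fin p) → EuclideanSpace ℝ (Fin p)} (hU : Firm U)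
    (c d : Fin m → ℝ) {τ : ℝ} (hτ : τ ^ 2 = c ⬝ᵥ c) :
    τ ^ 2 * ∫ z, ⟪U (comb c z), comb d z⟫ ∂stdGaussian (EuclideanSpace ℝ (Fin m × Fin p)) =
      (c ⬝ᵥ d) * selfCorr U τ := by
  have hself : ∫ z, ⟪U (comb c z), comb c z⟫ ∂stdGaussian (EuclideanSpace ℝ (Fin m × Fin p)) =
      selfCorr U τ := by
    have hm : AEStronglyMeasurable (fun x => ⟪U x, x⟫)
        (Measure.map (comb c) (stdGaussian (EuclideanSpace ℝ (Fin m × Fin p)))) :=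
      (hU.lipschitz.continuous.inner continuous_id).aestronglyMeasurable
    rw [← integral_map (φ := comb c) (f := fun x => ⟪U x, x⟫) (by fun_prop) hm,
      map_comb_stdGaussian c hτ, integral_map (by fun_prop)
        (hU.lipschitz.continuous.inner continuous_id).aestronglyMeasurable]
    rfl
  have h := integral_inner_comb_of_orthogonal hU
    (c := c) (d := (c ⬝ᵥ c) • d + (-(c ⬝ᵥ d)) • c) (by simp; ring)
  simp only [comb_add_smul, inner_add_right, real_inner_smul_right] at h
  rw [integral_add ((integrable_inner_of_memLp (hU.memLp_comb c) (memLp_comb d)).const_mul _)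
    ((integrable_inner_of_memLp (hU.memLp_comb c) (memLp_comb c)).const_mul _),
    integral_const_mul, integral_const_mul, hself] at h
  rw [hτ]
  linarith

/-- Subtracting the mean-zero term `⟨τg, U 0⟩` makes the integrand nonnegative, by firmness between
`τg` and `0`. -/
lemma selfCorr_nonneg {U : EuclideanSpace ℝ (Fin p) → EuclideanSpace ℝ (Fin p)} (hU : Firm U)
    (τ : ℝ) : 0 ≤ selfCorr U τ := by
  have hi : Integrable (fun g : EuclideanSpace ℝ (Fin p) => ⟪τ • g, U 0⟫) (stdGaussian _) :=
    integrable_inner_of_memLp (memLp_id_stdGaussian.const_smul τ) (memLp_const _)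
  have hi2 : Integrable (fun g : EuclideanSpace ℝ (Fin p) => ⟪U (τ • g), τ • g⟫) (stdGaussian _) :=
    integrable_inner_of_memLp (memLp_two_of_lipschitz memLp_id_stdGaussian
      (hU.lipschitz.comp (lipschitzWith_smul τ))) (memLp_id_stdGaussian.const_smul τ)
  have h : selfCorr U τ = ∫ g, (⟪U (τ • g), τ • g⟫ - ⟪τ • g, U 0⟫)
      ∂stdGaussian (EuclideanSpace ℝ (Fin p)) := by
    rw [integral_sub hi2 hi]
    simp_rw [real_inner_smul_left _ (U 0)]
    rw [integral_const_mul, integral_inner_const_stdGaussian, mul_zero, sub_zero]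
    rfl
  rw [h]
  refine integral_nonneg fun g => ?_
  have := hU (τ • g) 0
  rw [sub_zero, inner_sub_left, real_inner_comm (τ • g) (U 0)] at this
  simp only [Pi.zero_apply]
  linarith [sq_nonneg ‖U (τ • g) - U 0‖]

lemma Firm.integral_norm_sub_sq_le {U : EuclideanSpace ℝ (Fin p) → EuclideanSpace ℝ (Fin p)}
    (hU : Firm U) {c d : Fin m → ℝ} {τ : ℝ} (hc : τ ^ 2 = c ⬝ᵥ c) (hd : τ ^ 2 = d ⬝ᵥ d) :
    τ ^ 2 * ∫ z, ‖U (comb c z) - U (comb d z)‖ ^ 2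
      ∂stdGaussian (EuclideanSpace ℝ (Fin m × Fin p)) ≤
      2 * (τ ^ 2 - c ⬝ᵥ d) * selfCorr U τ := by
  have hUc := hU.memLp_comb c
  have hUd := hU.memLp_comb d
  have hXc := SimReg.memLp_comb (p := p) c
  have hXd := SimReg.memLp_comb (p := p) d
  have i1 := integrable_inner_of_memLp hUc hXc
  have i2 := integrable_inner_of_memLp hUc hXd
  have i3 := integrable_inner_of_memLp hUd hXc
  have i4 := integrable_inner_of_memLp hUd hXd
  have h1 : ∫ z, ‖U (comb c z) - U (comb d z)‖ ^ 2
      ∂stdGaussian (EuclideanSpace ℝ (Fin m × Fin p)) ≤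
      ∫ z, (⟪U (comb c z), comb c z⟫ - ⟪U (comb c z), comb d z⟫ -
        (⟪U (comb d z), comb c z⟫ - ⟪U (comb d z), comb d z⟫))
        ∂stdGaussian (EuclideanSpace ℝ (Fin m × Fin p)) := by
    refine integral_mono (integrable_norm_sq_of_memLp (hUc.sub hUd))
      ((i1.sub i2).sub (i3.sub i4)) fun z => ?_
    have := hU (comb c z) (comb d z)
    simp only [inner_sub_left, inner_sub_right] at this ⊢
    linarith
  have e1 := integral_sub (i1.sub i2) (i3.sub i4)
  have e2 := integral_sub i1 i2
  have e3 := integral_sub i3 i4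
  simp only [Pi.sub_apply] at e1 e2 e3
  rw [e1, e2, e3] at h1
  have h2 := mul_le_mul_of_nonneg_left h1 (sq_nonneg τ)
  simp only [mul_sub] at h2
  rw [integral_inner_comb hU c c hc, integral_inner_comb hU c d hc,
    integral_inner_comb hU d c hd, integral_inner_comb hU d d hd, ← hc, ← hd,
    dotProduct_comm d c] at h2
  linarith

/-- The covariance matrix with variances `τ₁², τ₂²` and covariance `ρ`. -/
def covMatrix (τ₁ τ₂ ρ : ℝ) : Matrix (Fin 2) (Fin 2) ℝ := !![τ₁ ^ 2, ρ; ρ, τ₂ ^ 2]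

lemma covMatrix_posSemidef {τ₁ τ₂ ρ : ℝ} (hρ : |ρ| ≤ τ₁ * τ₂) :
    (covMatrix τ₁ τ₂ ρ).PosSemidef := by
  refine posSemidef_two (sq_nonneg _) (sq_nonneg _) ?_
  rw [← mul_pow]
  exact sq_le_sq' (by linarith [neg_abs_le ρ]) ((le_abs_self ρ).trans hρ)

/-- The increment of the mixed moment is written as a single expectation of an inner product of
increments, by a coupling with four Gaussian vectors. Cauchy-Schwarz separates the two maps, and
firmness bounds each squared increment by `2δ · selfCorr`, where `δ = (ρ' - ρ)/(τ₁τ₂)`. -/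
lemma cross_sub_sq_le_of_le {U₁ U₂ : EuclideanSpace ℝ (Fin p) → EuclideanSpace ℝ (Fin p)}
    (hU₁ : Firm U₁) (hU₂ : Firm U₂) {τ₁ τ₂ ρ ρ' : ℝ} (h₁ : 0 < τ₁) (h₂ : 0 < τ₂)
    (hρ : |ρ| ≤ τ₁ * τ₂) (hρ' : |ρ'| ≤ τ₁ * τ₂) (hle : ρ ≤ ρ') :
    (τ₁ * τ₂) ^ 2 * (cross U₁ U₂ (covMatrix τ₁ τ₂ ρ') - cross U₁ U₂ (covMatrix τ₁ τ₂ ρ)) ^ 2 ≤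
      (ρ' - ρ) ^ 2 * (selfCorr U₁ τ₁ * selfCorr U₂ τ₂) := by
  have hτ : 0 < τ₁ * τ₂ := mul_pos h₁ h₂
  have ha := abs_le.1 hρ
  have ha' := abs_le.1 hρ'
  set δ := (ρ' - ρ) / (τ₁ * τ₂) with hδ
  have hδρ : τ₁ * τ₂ * δ = ρ' - ρ := by rw [hδ]; field_simp
  have hδ0 : 0 ≤ δ := div_nonneg (by linarith) hτ.le
  have hδ2 : δ ≤ 2 := by rw [hδ, div_le_iff₀ hτ]; linarith
  -- The common part of the four vectors, with covariance midway between `ρ` and `ρ'`. Positivity of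
  -- this matrix amounts to `ρ' ≤ τ₁τ₂` and `-ρ ≤ τ₁τ₂`.
  have hA : (!![τ₁ ^ 2 * (1 - δ / 2), (ρ + ρ') / 2; (ρ + ρ') / 2, τ₂ ^ 2 * (1 - δ / 2)] :
      Matrix (Fin 2) (Fin 2) ℝ).PosSemidef := by
    refine posSemidef_two (mul_nonneg (sq_nonneg _) (by linarith))
      (mul_nonneg (sq_nonneg _) (by linarith)) ?_
    have e : τ₁ ^ 2 * (1 - δ / 2) * (τ₂ ^ 2 * (1 - δ / 2)) =
        (τ₁ * τ₂ - τ₁ * τ₂ * δ / 2) ^ 2 := by ring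
    rw [e, hδρ]
    exact sq_le_sq' (by linarith) (by linarith)
  obtain ⟨a, ha⟩ := exists_gram_eq hA
  have a00 : a 0 0 * a 0 0 + a 0 1 * a 0 1 = τ₁ ^ 2 * (1 - δ / 2) := by
    simpa [gram, dotProduct, Fin.sum_univ_two] using congr_fun (congr_fun ha 0) 0
  have a01 : a 0 0 * a 1 0 + a 0 1 * a 1 1 = (ρ + ρ') / 2 := by
    simpa [gram, dotProduct, Fin.sum_univ_two] using congr_fun (congr_fun ha 0) 1
  have a11 : a 1 0 * a 1 0 + a 1 1 * a 1 1 = τ₂ ^ 2 * (1 - δ / 2) := by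
    simpa [gram, dotProduct, Fin.sum_univ_two] using congr_fun (congr_fun ha 1) 1
  set q := √(δ / 2) with hq
  have hqq : q * q = δ / 2 := Real.mul_self_sqrt (by linarith)
  -- A third coordinate `±τ_k √(δ/2)` restores the variances `τ_k²`; equal signs give covariance
  -- `ρ'`, opposite signs `ρ`.
  set c₁ : Fin 3 → ℝ := ![a 0 0, a 0 1, τ₁ * q] with hc₁
  set d₁ : Fin 3 → ℝ := ![a 0 0, a 0 1, -(τ₁ * q)] with hd₁
  set c₂ : Fin 3 → ℝ := ![a 1 0, a 1 1, τ₂ * q] with hc₂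
  set d₂ : Fin 3 → ℝ := ![a 1 0, a 1 1, -(τ₂ * q)] with hd₂
  have cc₁ : c₁ ⬝ᵥ c₁ = τ₁ ^ 2 := by
    simp only [hc₁, dotProduct, Fin.sum_univ_three, Matrix.cons_val_zero, Matrix.cons_val_one,
      Matrix.cons_val]
    linear_combination a00 + τ₁ ^ 2 * hqq
  have dd₁ : d₁ ⬝ᵥ d₁ = τ₁ ^ 2 := by
    simp only [hd₁, dotProduct, Fin.sum_univ_three, Matrix.cons_val_zero, Matrix.cons_val_one,
      Matrix.cons_val]
    linear_combination a00 + τ₁ ^ 2 * hqq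
  have cd₁ : c₁ ⬝ᵥ d₁ = τ₁ ^ 2 * (1 - δ) := by
    simp only [hc₁, hd₁, dotProduct, Fin.sum_univ_three, Matrix.cons_val_zero,
      Matrix.cons_val_one, Matrix.cons_val]
    linear_combination a00 - τ₁ ^ 2 * hqq
  have cc₂ : c₂ ⬝ᵥ c₂ = τ₂ ^ 2 := by
    simp only [hc₂, dotProduct, Fin.sum_univ_three, Matrix.cons_val_zero, Matrix.cons_val_one,
      Matrix.cons_val]
    linear_combination a11 + τ₂ ^ 2 * hqq
  have dd₂ : d₂ ⬝ᵥ d₂ = τ₂ ^ 2 := by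
    simp only [hd₂, dotProduct, Fin.sum_univ_three, Matrix.cons_val_zero, Matrix.cons_val_one,
      Matrix.cons_val]
    linear_combination a11 + τ₂ ^ 2 * hqq
  have cd₂ : c₂ ⬝ᵥ d₂ = τ₂ ^ 2 * (1 - δ) := by
    simp only [hc₂, hd₂, dotProduct, Fin.sum_univ_three, Matrix.cons_val_zero,
      Matrix.cons_val_one, Matrix.cons_val]
    linear_combination a11 - τ₂ ^ 2 * hqq
  have hcc : c₁ ⬝ᵥ c₂ = ρ' := by
    simp only [hc₁, hc₂, dotProduct, Fin.sum_univ_three, Matrix.cons_val_zero,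
      Matrix.cons_val_one, Matrix.cons_val]
    linear_combination a01 + τ₁ * τ₂ * hqq + hδρ / 2
  have hdd : d₁ ⬝ᵥ d₂ = ρ' := by
    simp only [hd₁, hd₂, dotProduct, Fin.sum_univ_three, Matrix.cons_val_zero,
      Matrix.cons_val_one, Matrix.cons_val]
    linear_combination a01 + τ₁ * τ₂ * hqq + hδρ / 2
  have hcd : c₁ ⬝ᵥ d₂ = ρ := by
    simp only [hc₁, hd₂, dotProduct, Fin.sum_univ_three, Matrix.cons_val_zero,
      Matrix.cons_val_one, Matrix.cons_val]
    linear_combination a01 - τ₁ * τ₂ * hqq - hδρ / 2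
  have hdc : d₁ ⬝ᵥ c₂ = ρ := by
    simp only [hd₁, hc₂, dotProduct, Fin.sum_univ_three, Matrix.cons_val_zero,
      Matrix.cons_val_one, Matrix.cons_val]
    linear_combination a01 - τ₁ * τ₂ * hqq - hδρ / 2
  have hgram : ∀ (e₁ e₂ : Fin 3 → ℝ) (r : ℝ), e₁ ⬝ᵥ e₁ = τ₁ ^ 2 → e₂ ⬝ᵥ e₂ = τ₂ ^ 2 →
      e₁ ⬝ᵥ e₂ = r → cross U₁ U₂ (covMatrix τ₁ τ₂ r) =
        ∫ z, ⟪U₁ (comb e₁ z), U₂ (comb e₂ z)⟫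
          ∂stdGaussian (EuclideanSpace ℝ (Fin 3 × Fin p)) := by
    intro e₁ e₂ r h1 h2 h3
    have hg : covMatrix τ₁ τ₂ r = gram ![e₁, e₂] := by
      ext i j
      fin_cases i <;> fin_cases j <;> simp [covMatrix, gram, h1, h2, h3, dotProduct_comm e₂ e₁]
    rw [hg, cross_gram hU₁.lipschitz.continuous hU₂.lipschitz.continuous]
    rfl
  set γ := stdGaussian (EuclideanSpace ℝ (Fin 3 × Fin p))
  have mc₁ := hU₁.memLp_comb (m := 3) c₁
  have md₁ := hU₁.memLp_comb (m := 3) d₁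
  have mc₂ := hU₂.memLp_comb (m := 3) c₂
  have md₂ := hU₂.memLp_comb (m := 3) d₂
  have key : ∫ z, ⟪U₁ (comb c₁ z) - U₁ (comb d₁ z), U₂ (comb c₂ z) - U₂ (comb d₂ z)⟫ ∂γ =
      2 * (cross U₁ U₂ (covMatrix τ₁ τ₂ ρ') - cross U₁ U₂ (covMatrix τ₁ τ₂ ρ)) := by
    have i1 := integrable_inner_of_memLp mc₁ mc₂
    have i2 := integrable_inner_of_memLp md₁ mc₂
    have i3 := integrable_inner_of_memLp mc₁ md₂
    have i4 := integrable_inner_of_memLp md₁ md₂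
    have e1 := integral_sub (i1.sub i2) (i3.sub i4)
    have e2 := integral_sub i1 i2
    have e3 := integral_sub i3 i4
    simp only [Pi.sub_apply] at e1 e2 e3
    simp only [inner_sub_left, inner_sub_right]
    rw [e1, e2, e3, ← hgram c₁ c₂ ρ' cc₁ cc₂ hcc, ← hgram d₁ c₂ ρ dd₁ cc₂ hdc,
      ← hgram c₁ d₂ ρ cc₁ dd₂ hcd, ← hgram d₁ d₂ ρ' dd₁ dd₂ hdd]
    ring
  have hcs := sq_integral_inner_le (mc₁.sub md₁) (mc₂.sub md₂)
  simp only [Pi.sub_apply] at hcs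
  rw [key] at hcs
  have b₁ := hU₁.integral_norm_sub_sq_le cc₁.symm dd₁.symm
  have b₂ := hU₂.integral_norm_sub_sq_le cc₂.symm dd₂.symm
  rw [cd₁] at b₁
  rw [cd₂] at b₂
  set I₁ := ∫ z, ‖U₁ (comb c₁ z) - U₁ (comb d₁ z)‖ ^ 2 ∂γ with hI₁
  set I₂ := ∫ z, ‖U₂ (comb c₂ z) - U₂ (comb d₂ z)‖ ^ 2 ∂γ with hI₂
  have hI₂0 : 0 ≤ I₂ := integral_nonneg fun _ => by positivity
  have b₁' : I₁ ≤ 2 * δ * selfCorr U₁ τ₁ := by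
    refine le_of_mul_le_mul_left (b₁.trans_eq ?_) (pow_pos h₁ 2)
    ring
  have b₂' : I₂ ≤ 2 * δ * selfCorr U₂ τ₂ := by
    refine le_of_mul_le_mul_left (b₂.trans_eq ?_) (pow_pos h₂ 2)
    ring
  have hD₁ := selfCorr_nonneg hU₁ τ₁
  have hprod : I₁ * I₂ ≤ (2 * δ * selfCorr U₁ τ₁) * (2 * δ * selfCorr U₂ τ₂) := by
    gcongr
  rw [← hδρ]
  have : 4 * (cross U₁ U₂ (covMatrix τ₁ τ₂ ρ') - cross U₁ U₂ (covMatrix τ₁ τ₂ ρ)) ^ 2 ≤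
      4 * (δ ^ 2 * (selfCorr U₁ τ₁ * selfCorr U₂ τ₂)) := by
    linarith
  rw [mul_pow (τ₁ * τ₂) δ, mul_assoc]
  exact mul_le_mul_of_nonneg_left (le_of_mul_le_mul_left this (by norm_num)) (sq_nonneg _)

lemma cross_sub_sq_le {U₁ U₂ : EuclideanSpace ℝ (Fin p) → EuclideanSpace ℝ (Fin p)}
    (hU₁ : Firm U₁) (hU₂ : Firm U₂) {τ₁ τ₂ ρ ρ' : ℝ} (h₁ : 0 < τ₁) (h₂ : 0 < τ₂)
    (hρ : |ρ| ≤ τ₁ * τ₂) (hρ' : |ρ'| ≤ τ₁ * τ₂) :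
    (τ₁ * τ₂) ^ 2 * (cross U₁ U₂ (covMatrix τ₁ τ₂ ρ') - cross U₁ U₂ (covMatrix τ₁ τ₂ ρ)) ^ 2 ≤
      (ρ' - ρ) ^ 2 * (selfCorr U₁ τ₁ * selfCorr U₂ τ₂) := by
  rcases le_total ρ ρ' with h | h
  · exact cross_sub_sq_le_of_le hU₁ hU₂ h₁ h₂ hρ hρ' h
  · have := cross_sub_sq_le_of_le hU₁ hU₂ h₁ h₂ hρ' hρ h
    rw [← neg_sub ρ' ρ, neg_sq, ← neg_sub (cross U₁ U₂ (covMatrix τ₁ τ₂ ρ')), neg_sq] at this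
    exact this

/-- The equation for the covariance has exactly one solution. -/
theorem existsUnique_covariance {U₁ U₂ : EuclideanSpace ℝ (Fin p) → EuclideanSpace ℝ (Fin p)}
    (hU₁ : Firm U₁) (hU₂ : Firm U₂) {τ₁ τ₂ ν e : ℝ} (h₁ : 0 ≤ τ₁) (h₂ : 0 ≤ τ₂)
    (hbound : ∀ ρ, |ρ| ≤ τ₁ * τ₂ → |ν * (e + cross U₁ U₂ (covMatrix τ₁ τ₂ ρ))| ≤ τ₁ * τ₂)
    (hcontr : 0 < τ₁ → 0 < τ₂ → ν ^ 2 * (selfCorr U₁ τ₁ * selfCorr U₂ τ₂) < (τ₁ * τ₂) ^ 2) :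
    ∃ ρ, |ρ| ≤ τ₁ * τ₂ ∧ ρ = ν * (e + cross U₁ U₂ (covMatrix τ₁ τ₂ ρ)) ∧
      ∀ ρ', |ρ'| ≤ τ₁ * τ₂ → ρ' = ν * (e + cross U₁ U₂ (covMatrix τ₁ τ₂ ρ')) → ρ' = ρ := by
  rcases h₁.eq_or_lt with h0 | h1
  · rw [← h0, zero_mul] at hbound ⊢
    refine ⟨0, by simp, ?_, fun ρ' h _ => by simpa using h⟩
    have := hbound 0 (by simp)
    exact (abs_nonpos_iff.1 this).symm
  rcases h₂.eq_or_lt with h0 | h2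
  · rw [← h0, mul_zero] at hbound ⊢
    refine ⟨0, by simp, ?_, fun ρ' h _ => by simpa using h⟩
    have := hbound 0 (by simp)
    exact (abs_nonpos_iff.1 this).symm
  have hlt := hcontr h1 h2
  have hτ : 0 < τ₁ * τ₂ := mul_pos h1 h2
  set ψ : ℝ → ℝ := fun ρ => ν * (e + cross U₁ U₂ (covMatrix τ₁ τ₂ ρ)) with hψ
  -- The map strictly shrinks distances. Continuity then gives a fixed point by the intermediate
  -- value theorem, and strictness makes it unique.
  have hstrict : ∀ ρ ρ', |ρ| ≤ τ₁ * τ₂ → |ρ'| ≤ τ₁ * τ₂ → ρ ≠ ρ' →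
      (ψ ρ' - ψ ρ) ^ 2 < (ρ' - ρ) ^ 2 := by
    intro ρ ρ' hρ hρ' hne
    have h3 := cross_sub_sq_le hU₁ hU₂ h1 h2 hρ hρ'
    have h4 : (ψ ρ' - ψ ρ) ^ 2 = ν ^ 2 *
        (cross U₁ U₂ (covMatrix τ₁ τ₂ ρ') - cross U₁ U₂ (covMatrix τ₁ τ₂ ρ)) ^ 2 := by
      simp only [hψ]; ring
    rw [h4]
    have h5 : 0 < (ρ' - ρ) ^ 2 := by
      have : ρ' - ρ ≠ 0 := sub_ne_zero.2 hne.symm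
      positivity
    have h6 := mul_le_mul_of_nonneg_left h3 (sq_nonneg ν)
    have h7 := mul_lt_mul_of_pos_left hlt h5
    refine lt_of_mul_lt_mul_left (a := (τ₁ * τ₂) ^ 2) ?_ (by positivity)
    linarith
  have hlip : LipschitzOnWith 1 ψ (Set.Icc (-(τ₁ * τ₂)) (τ₁ * τ₂)) := by
    refine LipschitzOnWith.of_dist_le_mul fun ρ' hρ' ρ hρ => ?_
    rw [NNReal.coe_one, one_mul, Real.dist_eq, Real.dist_eq]
    rcases eq_or_ne ρ ρ' with rfl | hne
    · simp
    · exact (sq_lt_sq.1 (hstrict ρ ρ' (abs_le.2 hρ) (abs_le.2 hρ') hne)).le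
  have hb1 := abs_le.1 (hbound (τ₁ * τ₂) (by rw [abs_of_pos hτ]))
  have hb2 := abs_le.1 (hbound (-(τ₁ * τ₂)) (by rw [abs_neg, abs_of_pos hτ]))
  obtain ⟨ρ, hρ, hρ0⟩ := intermediate_value_Icc (f := fun ρ => ρ - ψ ρ)
    (by linarith : -(τ₁ * τ₂) ≤ τ₁ * τ₂) (continuousOn_id.sub hlip.continuousOn)
    (show (0 : ℝ) ∈ Set.Icc _ _ from ⟨by simp only [hψ]; linarith, by simp only [hψ]; linarith⟩)
  refine ⟨ρ, abs_le.2 hρ, by simp only at hρ0; linarith, fun ρ' hρ' heq => ?_⟩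
  by_contra hne
  have h3 := hstrict ρ ρ' (abs_le.2 hρ) hρ' (Ne.symm hne)
  have h4 : ψ ρ = ρ := by simp only at hρ0; linarith
  have h5 : ψ ρ' = ρ' := heq.symm
  rw [h4, h5] at h3
  exact lt_irrefl _ h3

end Cross


/-! ### Convexity, positivity and local structure of the penalties -/

section Penalty

open Filter Topology

variable {p : ℕ}

lemma sqNorm_nonneg (x : Fin p → ℝ) : 0 ≤ sqNorm x := Finset.sum_nonneg fun _ _ => sq_nonneg _

lemma l1Norm_nonneg (x : Fin p → ℝ) : 0 ≤ l1Norm x := Finset.sum_nonneg fun _ _ => abs_nonneg _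

lemma sqNorm_pos {x : Fin p → ℝ} (hx : x ≠ 0) : 0 < sqNorm x := by
  obtain ⟨j, hj⟩ := Function.ne_iff.1 hx
  have hj : x j ≠ 0 := hj
  exact Finset.sum_pos' (fun _ _ => sq_nonneg _) ⟨j, Finset.mem_univ j, by positivity⟩

lemma l1Norm_pos {x : Fin p → ℝ} (hx : x ≠ 0) : 0 < l1Norm x := by
  obtain ⟨j, hj⟩ := Function.ne_iff.1 hx
  have hj : x j ≠ 0 := hj
  exact Finset.sum_pos' (fun _ _ => abs_nonneg _) ⟨j, Finset.mem_univ j, by positivity⟩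

lemma sqNorm_add_dotProduct_le (x w : Fin p → ℝ) : sqNorm x + 2 * (x ⬝ᵥ (w - x)) ≤ sqNorm w := by
  unfold sqNorm dotProduct
  rw [Finset.mul_sum, ← Finset.sum_add_distrib]
  refine Finset.sum_le_sum fun j _ => ?_
  simp only [Pi.sub_apply]
  nlinarith [sq_nonneg (w j - x j)]

lemma convexOn_sqNorm : ConvexOn ℝ Set.univ (sqNorm (p := p)) := by
  refine ⟨convex_univ, fun x _ y _ a b ha hb hab => ?_⟩
  simp only [sqNorm, smul_eq_mul, Finset.mul_sum, ← Finset.sum_add_distrib]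
  refine Finset.sum_le_sum fun j _ => ?_
  simp only [Pi.add_apply, Pi.smul_apply, smul_eq_mul]
  obtain rfl : b = 1 - a := by linarith
  nlinarith [mul_nonneg (mul_nonneg ha hb) (sq_nonneg (x j - y j))]

lemma convexOn_l1Norm : ConvexOn ℝ Set.univ (l1Norm (p := p)) := by
  refine ⟨convex_univ, fun x _ y _ a b ha hb hab => ?_⟩
  simp only [l1Norm, smul_eq_mul, Finset.mul_sum, ← Finset.sum_add_distrib]
  refine Finset.sum_le_sum fun j _ => ?_
  refine (abs_add_le _ _).trans_eq ?_
  simp [abs_mul, abs_of_nonneg ha, abs_of_nonneg hb]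

lemma bddBelow_moreau {t : ℝ} (ht : 0 < t) (x : Fin p → ℝ) :
    BddBelow (Set.range fun v : Fin p → ℝ => 1 / (2 * t) * sqNorm (x - v) + l1Norm v) :=
  ⟨0, by
    rintro _ ⟨v, rfl⟩
    have := sqNorm_nonneg (x - v)
    have := l1Norm_nonneg v
    positivity⟩

lemma moreauL1_le {t : ℝ} (ht : 0 < t) (x v : Fin p → ℝ) :
    moreauL1 t x ≤ 1 / (2 * t) * sqNorm (x - v) + l1Norm v :=
  ciInf_le (bddBelow_moreau ht x) v

lemma moreauL1_nonneg {t : ℝ} (ht : 0 < t) (x : Fin p → ℝ) : 0 ≤ moreauL1 t x :=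
  le_ciInf fun v => by
    have := sqNorm_nonneg (x - v)
    have := l1Norm_nonneg v
    positivity

lemma moreauL1_zero {t : ℝ} (ht : 0 < t) : moreauL1 t (0 : Fin p → ℝ) = 0 := by
  refine le_antisymm ((moreauL1_le ht 0 0).trans_eq ?_) (moreauL1_nonneg ht 0)
  simp [sqNorm, l1Norm]

/-- Affine minorants of the Moreau envelope. -/
lemma le_moreauL1 {t : ℝ} (ht : 0 < t) {x : Fin p → ℝ} (hx : ∀ j, |x j| ≤ t) (w : Fin p → ℝ) :
    1 / (2 * t) * sqNorm x + 1 / t * (x ⬝ᵥ (w - x)) ≤ moreauL1 t w := by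
  refine le_ciInf fun v => ?_
  unfold sqNorm l1Norm dotProduct
  rw [Finset.mul_sum, Finset.mul_sum, Finset.mul_sum, ← Finset.sum_add_distrib,
    ← Finset.sum_add_distrib]
  refine Finset.sum_le_sum fun j _ => ?_
  simp only [Pi.sub_apply]
  have h1 : x j * v j ≤ t * |v j| := by
    calc x j * v j ≤ |x j * v j| := le_abs_self _
      _ = |x j| * |v j| := abs_mul _ _
      _ ≤ _ := by gcongr; exact hx j
  have h2 : 1 / (2 * t) * (w j - v j) ^ 2 + |v j| -
      (1 / (2 * t) * x j ^ 2 + 1 / t * (x j * (w j - x j))) =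
      ((w j - v j - x j) ^ 2 + 2 * (t * |v j| - x j * v j)) / (2 * t) := by
    field_simp; ring
  have h3 : 0 ≤ ((w j - v j - x j) ^ 2 + 2 * (t * |v j| - x j * v j)) / (2 * t) := by
    have : 0 ≤ t * |v j| - x j * v j := by linarith
    positivity
  linarith

lemma moreauL1_pos {t : ℝ} (ht : 0 < t) {x : Fin p → ℝ} (hx : x ≠ 0) : 0 < moreauL1 t x := by
  have hn : 0 < ‖x‖ := norm_pos_iff.2 hx
  -- Scale `x` into the cube where the affine minorant is available; the minorant based at `ε • x`
  -- is still positive at `x`.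
  set ε := min 1 (t / ‖x‖) with hε
  have hε0 : 0 < ε := lt_min one_pos (by positivity)
  have hε1 : ε ≤ 1 := min_le_left _ _
  have hb : ∀ j, |(ε • x) j| ≤ t := fun j => by
    rw [Pi.smul_apply, smul_eq_mul, abs_mul, abs_of_pos hε0]
    have h1 : |x j| ≤ ‖x‖ := norm_le_pi_norm x j
    have h2 : ε * ‖x‖ ≤ t := by
      rw [← le_div_iff₀ hn]; exact min_le_right _ _
    exact le_trans (by gcongr) h2
  refine lt_of_lt_of_le ?_ (le_moreauL1 ht hb x)
  have e1 : sqNorm (ε • x) = ε ^ 2 * sqNorm x := by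
    simp [sqNorm, mul_pow, Finset.mul_sum]
  have e2 : (ε • x) ⬝ᵥ (x - ε • x) = ε * (1 - ε) * sqNorm x := by
    simp only [dotProduct, sqNorm, Finset.mul_sum, Pi.smul_apply, Pi.sub_apply, smul_eq_mul]
    exact Finset.sum_congr rfl fun j _ => by ring
  rw [e1, e2]
  have := sqNorm_pos hx
  have h1 : 0 ≤ 1 / t * (ε * (1 - ε) * sqNorm x) := by
    have : 0 ≤ 1 - ε := by linarith
    positivity
  positivity

lemma convexOn_moreauL1 {t : ℝ} (ht : 0 < t) : ConvexOn ℝ Set.univ (moreauL1 (p := p) t) := by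
  refine ⟨convex_univ, fun x _ y _ a b ha hb hab => ?_⟩
  simp only [smul_eq_mul]
  refine le_of_forall_pos_le_add fun ε hε => ?_
  -- Partial minimization of a jointly convex function: near-minimizers for `x` and `y` are
  -- combined, so attainment of the infimum is not needed.
  obtain ⟨v, hv⟩ := exists_lt_of_ciInf_lt (show moreauL1 t x < moreauL1 t x + ε by linarith)
  obtain ⟨w, hw⟩ := exists_lt_of_ciInf_lt (show moreauL1 t y < moreauL1 t y + ε by linarith)
  refine (moreauL1_le ht _ (a • v + b • w)).trans ?_
  have h1 := convexOn_sqNorm.2 (Set.mem_univ (x - v)) (Set.mem_univ (y - w)) ha hb hab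
  have h2 := convexOn_l1Norm.2 (Set.mem_univ v) (Set.mem_univ w) ha hb hab
  simp only [smul_eq_mul] at h1 h2
  rw [show a • x + b • y - (a • v + b • w) = a • (x - v) + b • (y - w) by module]
  have h3 : 1 / (2 * t) * sqNorm (a • (x - v) + b • (y - w)) ≤
      1 / (2 * t) * (a * sqNorm (x - v) + b * sqNorm (y - w)) := by gcongr
  have h4 := mul_le_mul_of_nonneg_left hv.le ha
  have h5 := mul_le_mul_of_nonneg_left hw.le hb
  have h6 : a * ε + b * ε = ε := by rw [← add_mul, hab, one_mul]
  linarith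

variable {m : Method} {n : ℕ} {lam : ℝ}

lemma penalty_zero_lam (m : Method) (n : ℕ) (x : Fin p → ℝ) : penalty m n 0 x = 0 := by
  cases m <;> simp [penalty]

lemma penalty_zero (m : Method) (hn : 0 < n) (lam : ℝ) : penalty m n lam (0 : Fin p → ℝ) = 0 := by
  have hn' : (0 : ℝ) < n := by exact_mod_cast hn
  cases m with
  | ridge => simp [penalty, sqNorm]
  | lasso => simp [penalty, l1Norm]
  | smoothedLasso α hα =>
    simp only [penalty]
    rw [moreauL1_zero (by positivity), mul_zero]

lemma penalty_nonneg (m : Method) (hn : 0 < n) (hlam : 0 ≤ lam) (x : Fin p → ℝ) :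
    0 ≤ penalty m n lam x := by
  have hn' : (0 : ℝ) < n := by exact_mod_cast hn
  cases m with
  | ridge => exact mul_nonneg (by positivity) (sqNorm_nonneg x)
  | lasso => exact mul_nonneg (by positivity) (l1Norm_nonneg x)
  | smoothedLasso α hα => exact mul_nonneg (by positivity) (moreauL1_nonneg (by positivity) x)

lemma ridge_factor_pos (hp : 0 < p) (hn : 0 < n) (hlam : 0 < lam) :
    0 < √((p : ℝ) / (n : ℝ)) * (lam / 2) := by
  have hn' : (0 : ℝ) < n := by exact_mod_cast hn
  have hp' : (0 : ℝ) < p := by exact_mod_cast hp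
  positivity

lemma pos_of_ne_zero {x : Fin p → ℝ} (hx : x ≠ 0) : 0 < p := by
  obtain ⟨j, -⟩ := Function.ne_iff.1 hx
  exact j.pos

lemma penalty_pos (m : Method) (hn : 0 < n) (hlam : 0 < lam) {x : Fin p → ℝ} (hx : x ≠ 0) :
    0 < penalty m n lam x := by
  have hn' : (0 : ℝ) < n := by exact_mod_cast hn
  cases m with
  | ridge => exact mul_pos (ridge_factor_pos (pos_of_ne_zero hx) hn hlam) (sqNorm_pos hx)
  | lasso => exact mul_pos (by positivity) (l1Norm_pos hx)
  | smoothedLasso α hα => exact mul_pos (by positivity) (moreauL1_pos (by positivity) hx)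

lemma convexOn_penalty (m : Method) (hn : 0 < n) (hlam : 0 ≤ lam) :
    ConvexOn ℝ Set.univ (penalty (p := p) m n lam) := by
  have hn' : (0 : ℝ) < n := by exact_mod_cast hn
  cases m with
  | ridge => exact convexOn_sqNorm.smul (c := √((p : ℝ) / (n : ℝ)) * (lam / 2)) (by positivity)
  | lasso => exact convexOn_l1Norm.smul (c := lam / √(n : ℝ)) (by positivity)
  | smoothedLasso α hα =>
    exact (convexOn_moreauL1 (t := α / √(n : ℝ)) (by positivity)).smul (c := lam / √(n : ℝ))
      (by positivity)

lemma eventually_abs_le {t : ℝ} (ht : 0 < t) : ∀ᶠ x : Fin p → ℝ in 𝓝 0, ∀ j, |x j| ≤ t := by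
  filter_upwards [Metric.closedBall_mem_nhds (0 : Fin p → ℝ) ht] with x hx j
  rw [mem_closedBall_zero_iff] at hx
  exact (norm_le_pi_norm x j).trans hx

/-- Near the origin, a penalty either has the subgradient of a positive multiple of the squared
norm, or has all small vectors as subgradients at the origin. -/
lemma penalty_local (m : Method) (hp : 0 < p) (hn : 0 < n) (hlam : 0 < lam) :
    (∃ κ, 0 < κ ∧ ∀ᶠ x : Fin p → ℝ in 𝓝 0, ∀ w,
      penalty m n lam x + κ * (x ⬝ᵥ (w - x)) ≤ penalty m n lam w) ∨
    (∀ᶠ v : Fin p → ℝ in 𝓝 0, ∀ w, v ⬝ᵥ w ≤ penalty m n lam w) := by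
  have hn' : (0 : ℝ) < n := by exact_mod_cast hn
  cases m with
  | ridge =>
    left
    have hc := ridge_factor_pos hp hn hlam
    refine ⟨2 * (√((p : ℝ) / (n : ℝ)) * (lam / 2)), by positivity,
      Eventually.of_forall fun x w => ?_⟩
    have := mul_le_mul_of_nonneg_left (sqNorm_add_dotProduct_le x w) hc.le
    simp only [penalty]
    linarith
  | lasso =>
    right
    filter_upwards [eventually_abs_le (show 0 < lam / √(n : ℝ) by positivity)] with v hv w
    simp only [penalty, l1Norm, dotProduct, Finset.mul_sum]
    refine Finset.sum_le_sum fun j _ => (le_abs_self _).trans ?_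
    rw [abs_mul]
    gcongr
    exact hv j
  | smoothedLasso α hα =>
    left
    set t := α / √(n : ℝ) with ht
    have ht0 : 0 < t := by positivity
    refine ⟨lam / √(n : ℝ) * (1 / t), by positivity, ?_⟩
    filter_upwards [eventually_abs_le ht0] with x hx w
    simp only [penalty]
    have h1 := le_moreauL1 ht0 hx w
    have h2 := moreauL1_le ht0 x 0
    rw [sub_zero, show l1Norm (0 : Fin p → ℝ) = 0 by simp [l1Norm], add_zero] at h2
    have h3 : moreauL1 t x + 1 / t * (x ⬝ᵥ (w - x)) ≤ moreauL1 t w := by linarith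
    have h4 : 0 ≤ lam / √(n : ℝ) := by positivity
    have := mul_le_mul_of_nonneg_left h3 h4
    linarith

end Penalty


/-! ### Linear proximal maps and the degrees of freedom of resolvents -/

section LinearModel

open Filter Topology
open scoped RealInnerProductSpace

/-- `A = 1 + cT²` satisfies `⟨Ax, x⟩ = ‖x‖² + c‖Tx‖²`, so it is injective, hence invertible in
finite dimension. -/
lemma exists_linear_resolvent {E : Type*} [NormedAddCommGroup E] [InnerProductSpace ℝ E]
    [FiniteDimensional ℝ E] {T : E →L[ℝ] E} (hT : ∀ x y, ⟪T x, y⟫ = ⟪x, T y⟫) {c : ℝ}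
    (hc : 0 ≤ c) : ∃ L : E →L[ℝ] E, ∀ y, L y + c • T (T (L y)) = y := by
  set A : E →L[ℝ] E := ContinuousLinearMap.id ℝ E + c • (T.comp T) with hA
  have hinj : Function.Injective (A : E →ₗ[ℝ] E) := by
    refine (injective_iff_map_eq_zero _).2 fun x hx => ?_
    have h1 : x + c • T (T x) = 0 := hx
    have h2 : ⟪x + c • T (T x), x⟫ = ‖x‖ ^ 2 + c * ‖T x‖ ^ 2 := by
      rw [inner_add_left, real_inner_smul_left, hT, real_inner_self_eq_norm_sq,
        real_inner_self_eq_norm_sq]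
    rw [h1, inner_zero_left] at h2
    have h3 : ‖x‖ ^ 2 = 0 := by nlinarith [sq_nonneg ‖x‖, sq_nonneg ‖T x‖]
    exact norm_eq_zero.1 (pow_eq_zero_iff two_ne_zero |>.1 h3)
  set e := LinearEquiv.ofInjectiveEndo (A : E →ₗ[ℝ] E) hinj
  refine ⟨LinearMap.toContinuousLinearMap (e.symm : E →ₗ[ℝ] E), fun y => ?_⟩
  exact e.apply_symm_apply y

variable {p : ℕ}

/-- A vector field on Euclidean space as a map of coordinate vectors. -/
def coordMap (G : EuclideanSpace ℝ (Fin p) → EuclideanSpace ℝ (Fin p)) (y : Fin p → ℝ) :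
    Fin p → ℝ := (G (WithLp.toLp 2 y)).ofLp

lemma lipschitz_coordMap {G : EuclideanSpace ℝ (Fin p) → EuclideanSpace ℝ (Fin p)} {K : NNReal}
    (hG : LipschitzWith K G) : ∃ K', LipschitzWith K' (coordMap G) :=
  ⟨_, (PiLp.lipschitzWith_ofLp 2 _).comp (hG.comp (PiLp.lipschitzWith_toLp 2 _))⟩

/-- A linear model in coordinates. -/
noncomputable def coordCLM (L : EuclideanSpace ℝ (Fin p) →L[ℝ] EuclideanSpace ℝ (Fin p)) :
    (Fin p → ℝ) →L[ℝ] (Fin p → ℝ) :=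
  LinearMap.toContinuousLinearMap
    { toFun := coordMap L
      map_add' := fun x y => by simp [coordMap]
      map_smul' := fun a x => by simp [coordMap] }

/-- The derivative of a linear model at any point is the model itself. -/
lemma hasFDerivAt_coordMap_linear (L : EuclideanSpace ℝ (Fin p) →L[ℝ] EuclideanSpace ℝ (Fin p))
    (y : Fin p → ℝ) : HasFDerivAt (coordMap L) (coordCLM L) y :=
  (coordCLM L).hasFDerivAt

lemma coordCLM_apply (L : EuclideanSpace ℝ (Fin p) →L[ℝ] EuclideanSpace ℝ (Fin p))
    (y : Fin p → ℝ) : coordCLM L y = (L (WithLp.toLp 2 y)).ofLp := rfl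

lemma divergence_coordMap_linear (L : EuclideanSpace ℝ (Fin p) →L[ℝ] EuclideanSpace ℝ (Fin p))
    (y : Fin p → ℝ) : Model.divergence (coordMap L) y =
      ∫ g, ⟪g, L g⟫ ∂stdGaussian (EuclideanSpace ℝ (Fin p)) := by
  obtain ⟨K, hK⟩ := lipschitz_coordMap L.lipschitz
  have h := integral_divergence_stdGaussian hK 0 one_ne_zero
  have hconst : ∀ y', Model.divergence (coordMap L) y' = Model.divergence (coordMap L) y :=
    fun y' => by
      simp only [Model.divergence, (hasFDerivAt_coordMap_linear L _).fderiv]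
  simp_rw [hconst] at h
  rw [integral_const] at h
  simpa [coordMap] using h

/-- For the resolvents of a positive quadratic form, the equation `n (1 - z) = div` has exactly one
positive solution. -/
lemma existsUnique_linear_df {T : EuclideanSpace ℝ (Fin p) →L[ℝ] EuclideanSpace ℝ (Fin p)}
    (hT : ∀ x y, ⟪T x, y⟫ = ⟪x, T y⟫) (hinj : ∀ x, T x = 0 → x = 0) {κ n : ℝ} (hκ : 0 < κ)
    (hn : 0 < n) {L : ℝ → EuclideanSpace ℝ (Fin p) →L[ℝ] EuclideanSpace ℝ (Fin p)}
    (hL : ∀ z, 0 < z → ∀ y, L z y + (κ / z) • T (T (L z y)) = y) :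
    ∃ z, 0 < z ∧ n * (1 - z) = Model.divergence (coordMap (L z)) 0 ∧
      ∀ z', 0 < z' → n * (1 - z') = Model.divergence (coordMap (L z')) 0 → z' = z := by
  set q : EuclideanSpace ℝ (Fin p) → ℝ := fun x => κ / 2 * ‖T x‖ ^ 2 with hq
  have hF : IsProx q fun z y => L z y := fun z hz y w => by
    have h1 : y - L z y = (κ / z) • T (T (L z y)) := by
      rw [sub_eq_iff_eq_add, add_comm]; exact (hL z hz y).symm
    rw [h1, real_inner_smul_left, hT, ← mul_assoc, mul_div_cancel₀ _ hz.ne', map_sub,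
      inner_sub_right, real_inner_self_eq_norm_sq]
    simp only [hq]
    have h2 : 0 ≤ ‖T (L z y)‖ ^ 2 - 2 * ⟪T (L z y), T w⟫ + ‖T w‖ ^ 2 := by
      rw [← norm_sub_sq_real]; positivity
    nlinarith
  have h0 : q 0 = 0 := by simp [hq]
  have hnn : ∀ x, 0 ≤ q x := fun x => by positivity
  have hconv : ConvexOn ℝ Set.univ q := by
    have h1 : ConvexOn ℝ Set.univ fun x : EuclideanSpace ℝ (Fin p) => ‖T x‖ :=
      (convexOn_norm convex_univ).comp_linearMap T.toLinearMap
    exact (h1.pow (fun _ _ => norm_nonneg _) 2).smul (c := κ / 2) (by positivity)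
  have hpos : ∀ x, x ≠ 0 → 0 < q x := fun x hx => by
    have : T x ≠ 0 := fun h => hx (hinj x h)
    positivity
  have hcorr : ∀ τ z, corr (fun z y => L z y) 0 τ z =
      τ * Model.divergence (coordMap (L z)) 0 := fun τ z => by
    rw [divergence_coordMap_linear]
    simp only [corr, zero_add, map_smul, sub_zero, real_inner_smul_right]
    rw [integral_const_mul]
  -- `L z` is the proximal map of the quadratic form `q`. With zero signal and the auxiliary noise
  -- variance `1`, its correlation is `τ` times the divergence, so the marginal system contains the
  -- wanted equation for `z`.
  obtain ⟨τ, z, hτ, hsol⟩ := exists_marginalSol hF h0 hnn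
    (fun r hr => (exists_coercive hconv h0 hpos hr)) 0 hn zero_le_one (Or.inl one_ne_zero)
  refine ⟨z, hsol.pos, ?_, fun z' hz' h => ?_⟩
  · have := hsol.eq_corr
    rw [hcorr] at this
    refine mul_left_cancel₀ hτ.ne' ?_
    linarith
  · set b := ∫ g, ‖L z' g‖ ^ 2 ∂stdGaussian (EuclideanSpace ℝ (Fin p)) with hb
    have hmse : ∀ τ, mse (fun z y => L z y) 0 τ z' = τ ^ 2 * b := fun τ => by
      simp only [mse, zero_add, map_smul, sub_zero, norm_smul, mul_pow, Real.norm_eq_abs, sq_abs]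
      rw [integral_const_mul]
    -- Firmness gives `E‖L g‖² ≤ div = n(1 - z') < n`. Hence `τ² = 1/(n - b)` completes `z'` to a
    -- solution of the auxiliary system, where uniqueness is known.
    have hbn : b < n := by
      have h1 : b ≤ Model.divergence (coordMap (L z')) 0 := by
        rw [divergence_coordMap_linear]
        have hm : MemLp (fun g => L z' g) 2 (stdGaussian (EuclideanSpace ℝ (Fin p))) :=
          memLp_two_of_lipschitz memLp_id_stdGaussian (L z').lipschitz
        refine integral_mono (integrable_norm_sq_of_memLp hm)
          (integrable_inner_of_memLp memLp_id_stdGaussian hm) fun g => ?_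
        have := (hF z' hz' g).firm hz' (hF z' hz' 0)
        simp only [map_zero, sub_zero] at this
        rwa [real_inner_comm]
      have : 0 < n * z' := by positivity
      linarith
    have hnb : 0 < n - b := by linarith
    have hsq : √(1 / (n - b)) ^ 2 = 1 / (n - b) := Real.sq_sqrt (by positivity)
    have hsol' : MarginalSol (fun z y => L z y) 0 n 1 √(1 / (n - b)) z' := by
      refine ⟨by positivity, hz', ?_, ?_⟩
      · rw [hmse, hsq]; field_simp; ring
      · rw [hcorr, ← h]; ring
    have := hsol'.unique hF hn zero_le_one hsol
    exact this.2 (by positivity)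

end LinearModel

/-! ### Well-posedness of the marginal system -/

section MarginalTheorem

open Filter Topology
open scoped RealInnerProductSpace

variable {p : ℕ}

/-- The degrees of freedom at noise level `τ`. -/
noncomputable def marginalDf (F : ℝ → EuclideanSpace ℝ (Fin p) → EuclideanSpace ℝ (Fin p))
    (x₀ : EuclideanSpace ℝ (Fin p)) (τ z : ℝ) : ℝ :=
  ∫ g, Model.divergence (coordMap (F z)) (x₀.ofLp + τ • g.ofLp)
    ∂stdGaussian (EuclideanSpace ℝ (Fin p))

/-- The fixed-point equations of a single regression. -/
structure MarginalFixedPoint (F : ℝ → EuclideanSpace ℝ (Fin p) → EuclideanSpace ℝ (Fin p))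
    (x₀ : EuclideanSpace ℝ (Fin p)) (n s τ z : ℝ) : Prop where
  nonneg : 0 ≤ τ
  pos : 0 < z
  eq_mse : n * τ ^ 2 = s + mse F x₀ τ z
  eq_df : n * (1 - z) = marginalDf F x₀ τ z

variable {f : EuclideanSpace ℝ (Fin p) → ℝ}
  {F : ℝ → EuclideanSpace ℝ (Fin p) → EuclideanSpace ℝ (Fin p)} {x₀ : EuclideanSpace ℝ (Fin p)}
  {n s : ℝ}

lemma IsProx.mul_marginalDf (hF : IsProx f F) (x₀ : EuclideanSpace ℝ (Fin p)) {τ z : ℝ}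
    (hτ : τ ≠ 0) (hz : 0 < z) : τ * marginalDf F x₀ τ z = corr F x₀ τ z := by
  obtain ⟨K, hK⟩ := lipschitz_coordMap (hF.lipschitz hz)
  rw [marginalDf, integral_divergence_stdGaussian hK _ hτ]
  have hg := memLp_id_stdGaussian (E := EuclideanSpace ℝ (Fin p))
  have e : ∀ g : EuclideanSpace ℝ (Fin p), ⟪g, WithLp.toLp 2 (coordMap (F z)
      (x₀.ofLp + τ • g.ofLp))⟫ = ⟪g, F z (x₀ + τ • g) - x₀⟫ + ⟪g, x₀⟫ := fun g => by
    rw [← inner_add_right, sub_add_cancel]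
    rfl
  simp_rw [e]
  rw [integral_add (integrable_inner_of_memLp hg (hF.memLp_error hz x₀ τ))
    (integrable_inner_of_memLp hg (memLp_const x₀)), integral_inner_const_stdGaussian, add_zero]
  rfl

lemma corr_zero (F : ℝ → EuclideanSpace ℝ (Fin p) → EuclideanSpace ℝ (Fin p))
    (x₀ : EuclideanSpace ℝ (Fin p)) (z : ℝ) : corr F x₀ 0 z = 0 := by
  simp only [corr, zero_smul]
  exact integral_inner_const_stdGaussian _

/-- At `τ = 0` the correlation equation reads `0 = 0`, so the converse needs `τ > 0`: the original
equation still determines `z` there. -/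
lemma MarginalFixedPoint.marginalSol (hF : IsProx f F) {τ z : ℝ}
    (h : MarginalFixedPoint F x₀ n s τ z) : MarginalSol F x₀ n s τ z := by
  refine ⟨h.nonneg, h.pos, h.eq_mse, ?_⟩
  rcases h.nonneg.eq_or_lt with h0 | h0
  · rw [← h0, corr_zero]; ring
  · rw [← hF.mul_marginalDf x₀ h0.ne' h.pos, ← h.eq_df]; ring

lemma MarginalSol.marginalFixedPoint (hF : IsProx f F) {τ z : ℝ} (hτ : 0 < τ)
    (h : MarginalSol F x₀ n s τ z) : MarginalFixedPoint F x₀ n s τ z := by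
  refine ⟨h.nonneg, h.pos, h.eq_mse, mul_left_cancel₀ hτ.ne' ?_⟩
  rw [hF.mul_marginalDf x₀ hτ.ne' h.pos, ← h.eq_corr]; ring

/-- Well-posedness of the fixed-point equations of a single regression. -/
def MarginalWellPosed (F : ℝ → EuclideanSpace ℝ (Fin p) → EuclideanSpace ℝ (Fin p))
    (x₀ : EuclideanSpace ℝ (Fin p)) (n s : ℝ) : Prop :=
  ∃ τ z, MarginalFixedPoint F x₀ n s τ z ∧
    (∀ᵐ g ∂stdGaussian (EuclideanSpace ℝ (Fin p)),
      DifferentiableAt ℝ (coordMap (F z)) (x₀.ofLp + τ • g.ofLp)) ∧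
    ∀ τ' z', MarginalFixedPoint F x₀ n s τ' z' → τ' = τ ∧ z' = z

/-- Least squares. -/
theorem marginalWellPosed_of_id (hF : ∀ z, 0 < z → ∀ y, F z y = y) (hn : (p : ℝ) < n)
    (hs : 0 ≤ s) : MarginalWellPosed F x₀ n s := by
  have hFz : ∀ z, 0 < z → F z = ContinuousLinearMap.id ℝ _ := fun z hz => funext (hF z hz)
  have hdiv : ∀ y, Model.divergence (coordMap (ContinuousLinearMap.id ℝ
      (EuclideanSpace ℝ (Fin p)))) y = p := fun y => by
    simp only [Model.divergence, (hasFDerivAt_coordMap_linear _ _).fderiv]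
    simp [coordCLM_apply]
  have hP : ∫ g, ‖g‖ ^ 2 ∂stdGaussian (EuclideanSpace ℝ (Fin p)) = p := by
    rw [← hdiv 0, divergence_coordMap_linear]
    simp
  have hmse : ∀ τ z, 0 < z → mse F x₀ τ z = τ ^ 2 * p := fun τ z hz => by
    simp only [mse, hF z hz, add_sub_cancel_left, norm_smul, mul_pow, Real.norm_eq_abs, sq_abs]
    rw [integral_const_mul, hP]
  have hdf : ∀ τ z, 0 < z → marginalDf F x₀ τ z = p := fun τ z hz => by
    simp only [marginalDf, hFz z hz, hdiv]
    simp
  have hp0 : (0 : ℝ) ≤ p := by positivity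
  have hn0 : 0 < n := by linarith
  have hnp : 0 < n - p := by linarith
  have hz : 0 < 1 - p / n := by
    have : p / n < 1 := (div_lt_one hn0).2 hn
    linarith
  refine ⟨√(s / (n - p)), 1 - p / n, ⟨by positivity, hz, ?_, ?_⟩, ?_, fun τ' z' h => ⟨?_, ?_⟩⟩
  · rw [hmse _ _ hz, Real.sq_sqrt (by positivity)]; field_simp; ring
  · rw [hdf _ _ hz]; field_simp; ring
  · refine ae_of_all _ fun g => ?_
    rw [hFz _ hz]
    exact (hasFDerivAt_coordMap_linear _ _).differentiableAt
  · have h1 := h.eq_mse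
    rw [hmse _ _ h.pos] at h1
    rw [← Real.sqrt_sq h.nonneg]
    congr 1
    rw [eq_div_iff hnp.ne']
    linarith
  · have h1 := h.eq_df
    rw [hdf _ _ h.pos] at h1
    rw [eq_sub_iff_add_eq, ← eq_sub_iff_add_eq', div_eq_iff hn0.ne']
    linarith

/-- Convex penalties that vanish only at the origin and whose proximal maps are linear there. -/
theorem marginalWellPosed_of_pos (hF : IsProx f F) (hconv : ConvexOn ℝ Set.univ f) (h0 : f 0 = 0)
    (hpos : ∀ x, x ≠ 0 → 0 < f x) (hn : 0 < n) (hs : 0 ≤ s)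
    {L : ℝ → EuclideanSpace ℝ (Fin p) →L[ℝ] EuclideanSpace ℝ (Fin p)}
    (hL : ∀ z, 0 < z → ∀ᶠ y in 𝓝 0, F z y = L z y)
    (hdf : ∃ z, 0 < z ∧ n * (1 - z) = Model.divergence (coordMap (L z)) 0 ∧
      ∀ z', 0 < z' → n * (1 - z') = Model.divergence (coordMap (L z')) 0 → z' = z) :
    MarginalWellPosed F x₀ n s := by
  have hnn : ∀ x, 0 ≤ f x := fun x => by
    rcases eq_or_ne x 0 with rfl | h
    · exact h0.ge
    · exact (hpos x h).le
  -- In the degenerate case the solution has `τ = 0`, the observation is the origin, and only the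
  -- local linear form of the proximal map matters.
  by_cases hdeg : s = 0 ∧ x₀ = 0
  · obtain ⟨rfl, rfl⟩ := hdeg
    obtain ⟨z, hz, hz1, hz2⟩ := hdf
    have hloc : ∀ z, 0 < z → coordMap (F z) =ᶠ[𝓝 0] coordMap (L z) := fun z hz => by
      have hc : Tendsto (WithLp.toLp 2 : (Fin p → ℝ) → EuclideanSpace ℝ (Fin p)) (𝓝 0) (𝓝 0) :=
        (PiLp.continuous_toLp 2 _).tendsto 0
      filter_upwards [hc.eventually (hL z hz)] with y hy
      simp only [coordMap, hy]
    have hmdf : ∀ z, 0 < z → marginalDf F 0 0 z = Model.divergence (coordMap (L z)) 0 :=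
      fun z hz => by
        simp only [marginalDf, zero_smul, add_zero, WithLp.ofLp_zero, integral_const]
        simp only [Model.divergence, (hloc z hz).fderiv_eq]
        simp
    have hfp : MarginalFixedPoint F 0 n 0 0 z := by
      refine ⟨le_rfl, hz, ?_, ?_⟩
      · simp [mse, hF.map_zero h0 hnn hz]
      · rw [hmdf z hz, hz1]
    refine ⟨0, z, hfp, ?_, fun τ' z' h => ?_⟩
    · refine ae_of_all _ fun g => ?_
      rw [zero_smul, add_zero, WithLp.ofLp_zero]
      exact ((hasFDerivAt_coordMap_linear (L z) 0).congr_of_eventuallyEq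
        (hloc z hz)).differentiableAt
    · have h1 := ((h.marginalSol hF).unique hF hn le_rfl (hfp.marginalSol hF)).1
      subst h1
      refine ⟨rfl, hz2 z' h.pos ?_⟩
      rw [h.eq_df, hmdf z' h.pos]
  · have hnd : s ≠ 0 ∨ x₀ ≠ 0 := by
      by_contra hcon
      push Not at hcon
      exact hdeg hcon
    obtain ⟨τ, z, hτ, hsol⟩ := exists_marginalSol hF h0 hnn
      (fun r hr => exists_coercive hconv h0 hpos hr) x₀ hn hs hnd
    refine ⟨τ, z, hsol.marginalFixedPoint hF hτ, ?_, fun τ' z' h => ?_⟩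
    · obtain ⟨K, hK⟩ := lipschitz_coordMap (hF.lipschitz hsol.pos)
      exact ae_differentiableAt_stdGaussian hK _ hτ.ne'
    · have h1 := hsol.unique hF hn hs (h.marginalSol hF)
      exact ⟨h1.1.symm, (h1.2 hτ).symm⟩

end MarginalTheorem


/-! ### Matrices acting on Euclidean space -/

section MatrixAction

open scoped RealInnerProductSpace

variable {p : ℕ}

/-- The action of a matrix on Euclidean space. -/
noncomputable def act (A : Matrix (Fin p) (Fin p) ℝ) :
    EuclideanSpace ℝ (Fin p) →L[ℝ] EuclideanSpace ℝ (Fin p) :=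
  LinearMap.toContinuousLinearMap
    { toFun := fun x => WithLp.toLp 2 (A *ᵥ x.ofLp)
      map_add' := fun x y => by simp [Matrix.mulVec_add]
      map_smul' := fun a x => by simp [Matrix.mulVec_smul] }

lemma act_apply (A : Matrix (Fin p) (Fin p) ℝ) (x : EuclideanSpace ℝ (Fin p)) :
    act A x = WithLp.toLp 2 (A *ᵥ x.ofLp) := rfl

lemma inner_eq_dotProduct (x y : EuclideanSpace ℝ (Fin p)) : ⟪x, y⟫ = x.ofLp ⬝ᵥ y.ofLp := by
  rw [EuclideanSpace.inner_eq_star_dotProduct, dotProduct_comm]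
  simp

lemma inner_act {A : Matrix (Fin p) (Fin p) ℝ} (hA : Aᵀ = A) (x y : EuclideanSpace ℝ (Fin p)) :
    ⟪act A x, y⟫ = ⟪x, act A y⟫ := by
  simp only [inner_eq_dotProduct, act_apply]
  rw [Matrix.dotProduct_mulVec, ← Matrix.mulVec_transpose, hA]

end MatrixAction

/-! ### The regressions as proximal maps -/

namespace Model

open Filter Topology
open scoped RealInnerProductSpace

variable {N p : ℕ} {M : Model N p}

lemma sqrtSigma_mul_self (hS : M.Sigma.PosSemidef) : M.sqrtSigma * M.sqrtSigma = M.Sigma :=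
  CFC.sqrt_mul_sqrt_self _ hS.nonneg

lemma sqrtSigma_transpose (M : Model N p) : M.sqrtSigmaᵀ = M.sqrtSigma := by
  have h : M.sqrtSigma.PosSemidef := Matrix.nonneg_iff_posSemidef.1 (CFC.sqrt_nonneg _)
  rw [← Matrix.conjTranspose_eq_transpose_of_trivial]
  exact h.isHermitian

lemma isUnit_det_sqrtSigma (hS : M.Sigma.PosSemidef) (hu : IsUnit M.Sigma) :
    IsUnit M.sqrtSigma.det := by
  rw [Matrix.isUnit_iff_isUnit_det, ← sqrtSigma_mul_self hS, Matrix.det_mul] at hu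
  exact isUnit_of_mul_isUnit_left hu

/-- The penalty in terms of the fitted vector `Σ^{1/2} π`. -/
noncomputable def fitPenalty (M : Model N p) (k : Fin 2) (x : EuclideanSpace ℝ (Fin p)) : ℝ :=
  penalty (M.method k) (M.n k) (M.lam k) (M.sqrtSigma⁻¹ *ᵥ x.ofLp)

/-- The fit as a map of Euclidean space. -/
noncomputable def fitMap (M : Model N p) (k : Fin 2) (z : ℝ) (y : EuclideanSpace ℝ (Fin p)) :
    EuclideanSpace ℝ (Fin p) := WithLp.toLp 2 (M.fit k z y.ofLp)

/-- The signal `Σ^{1/2} θ_k`. -/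
noncomputable def signal (M : Model N p) (k : Fin 2) : EuclideanSpace ℝ (Fin p) :=
  WithLp.toLp 2 (M.sqrtSigma *ᵥ fun j => M.Theta j k)

lemma obs_eq (M : Model N p) (k : Fin 2) (g : EuclideanSpace ℝ (Fin 2 × Fin p)) :
    M.obs k g = (M.signal k + block k g).ofLp := by
  ext j
  simp [obs, signal, block_apply]

section Regular

variable {k : Fin 2} {z : ℝ}

lemma inv_mulVec_mulVec (hS : M.Sigma.PosSemidef) (hu : IsUnit M.Sigma) (x : Fin p → ℝ) :
    M.sqrtSigma⁻¹ *ᵥ M.sqrtSigma *ᵥ x = x := by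
  rw [Matrix.mulVec_mulVec, Matrix.nonsing_inv_mul _ (isUnit_det_sqrtSigma hS hu),
    Matrix.one_mulVec]

lemma mulVec_inv_mulVec (hS : M.Sigma.PosSemidef) (hu : IsUnit M.Sigma) (x : Fin p → ℝ) :
    M.sqrtSigma *ᵥ M.sqrtSigma⁻¹ *ᵥ x = x := by
  rw [Matrix.mulVec_mulVec, Matrix.mul_nonsing_inv _ (isUnit_det_sqrtSigma hS hu),
    Matrix.one_mulVec]

lemma convexOn_fitPenalty (hn : 0 < M.n k) (hl : 0 ≤ M.lam k) :
    ConvexOn ℝ Set.univ (M.fitPenalty k) := by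
  let A : EuclideanSpace ℝ (Fin p) →ₗ[ℝ] (Fin p → ℝ) :=
    { toFun := fun x => M.sqrtSigma⁻¹ *ᵥ x.ofLp
      map_add' := fun x y => by simp [Matrix.mulVec_add]
      map_smul' := fun a x => by simp [Matrix.mulVec_smul] }
  exact (convexOn_penalty (M.method k) hn hl).comp_linearMap A

lemma fitPenalty_zero (hn : 0 < M.n k) : M.fitPenalty k 0 = 0 := by
  simp [fitPenalty, penalty_zero _ hn]

lemma fitPenalty_nonneg (hn : 0 < M.n k) (hl : 0 ≤ M.lam k) (x : EuclideanSpace ℝ (Fin p)) :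
    0 ≤ M.fitPenalty k x := penalty_nonneg _ hn hl _

lemma fitPenalty_pos (hS : M.Sigma.PosSemidef) (hu : IsUnit M.Sigma) (hn : 0 < M.n k)
    (hl : 0 < M.lam k) (x : EuclideanSpace ℝ (Fin p)) (hx : x ≠ 0) : 0 < M.fitPenalty k x := by
  refine penalty_pos _ hn hl fun h => hx ?_
  have := mulVec_inv_mulVec hS hu x.ofLp
  rw [h, Matrix.mulVec_zero] at this
  ext j
  exact (congrFun this j).symm

lemma objective_eq (hS : M.Sigma.PosSemidef) (hu : IsUnit M.Sigma) (y x : Fin p → ℝ) :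
    M.objective k z y x = 1 / 2 * ‖WithLp.toLp 2 y - WithLp.toLp 2 (M.sqrtSigma *ᵥ x)‖ ^ 2 +
      1 / z * M.fitPenalty k (WithLp.toLp 2 (M.sqrtSigma *ᵥ x)) := by
  rw [objective, fitPenalty, inv_mulVec_mulVec hS hu, EuclideanSpace.real_norm_sq_eq]
  rfl

/-- Invertibility of `Σ^{1/2}` makes `x ↦ Σ^{1/2} x` a bijection, so minimizing over coefficients is
the same as minimizing over fitted vectors. -/
lemma isMinOn_objective_iff (hS : M.Sigma.PosSemidef) (hu : IsUnit M.Sigma) (hn : 0 < M.n k)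
    (hl : 0 ≤ M.lam k) (hz : 0 < z) (y x : Fin p → ℝ) :
    IsMinOn (M.objective k z y) Set.univ x ↔
      ProxAt (M.fitPenalty k) z (WithLp.toLp 2 y) (WithLp.toLp 2 (M.sqrtSigma *ᵥ x)) := by
  rw [isMinOn_univ_iff]
  refine ⟨fun h => proxAt_of_isMin (convexOn_fitPenalty hn hl) hz fun w => ?_, fun h w => ?_⟩
  · have := h (M.sqrtSigma⁻¹ *ᵥ w.ofLp)
    rwa [objective_eq hS hu, objective_eq hS hu, mulVec_inv_mulVec hS hu] at this
  · rw [objective_eq hS hu, objective_eq hS hu]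
    exact h.isMin hz _

lemma existsUnique_isMinOn (hS : M.Sigma.PosSemidef) (hu : IsUnit M.Sigma) (hn : 0 < M.n k)
    (hl : 0 ≤ M.lam k) (hz : 0 < z) (y : Fin p → ℝ) :
    ∃! x, IsMinOn (M.objective k z y) Set.univ x := by
  obtain ⟨v, hv⟩ := exists_proxAt (convexOn_fitPenalty hn hl) (fitPenalty_nonneg hn hl) hz
    (WithLp.toLp 2 y)
  refine ⟨M.sqrtSigma⁻¹ *ᵥ v.ofLp, ?_, fun x hx => ?_⟩
  · change IsMinOn _ _ _
    rw [isMinOn_objective_iff hS hu hn hl hz, mulVec_inv_mulVec hS hu]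
    exact hv
  · have h := ((isMinOn_objective_iff hS hu hn hl hz y x).1 hx).unique hz hv
    rw [← h]
    exact (inv_mulVec_mulVec hS hu x).symm

lemma isProx_fitMap (hS : M.Sigma.PosSemidef) (hu : IsUnit M.Sigma) (hn : 0 < M.n k)
    (hl : 0 ≤ M.lam k) : IsProx (M.fitPenalty k) (M.fitMap k) := fun _ hz y =>
  (isMinOn_objective_iff hS hu hn hl hz y.ofLp _).1
    (Classical.epsilon_spec (existsUnique_isMinOn hS hu hn hl hz y.ofLp).exists)

lemma fitMap_of_lam_zero (hS : M.Sigma.PosSemidef) (hu : IsUnit M.Sigma) (hn : 0 < M.n k)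
    (hl : M.lam k = 0) (hz : 0 < z) (y : EuclideanSpace ℝ (Fin p)) : M.fitMap k z y = y := by
  refine (isProx_fitMap hS hu hn hl.ge z hz y).unique hz fun w => ?_
  simp [fitPenalty, hl, penalty_zero_lam]

end Regular

end Model


/-- The case of a proximal map vanishing near the origin: no degrees of freedom, so `z = 1`. -/
lemma existsUnique_zero_df {p : ℕ} {n : ℝ} (hn : 0 < n) :
    ∃ z, 0 < z ∧ n * (1 - z) = Model.divergence (coordMap
        (0 : EuclideanSpace ℝ (Fin p) →L[ℝ] EuclideanSpace ℝ (Fin p))) 0 ∧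
      ∀ z', 0 < z' → n * (1 - z') = Model.divergence (coordMap
        (0 : EuclideanSpace ℝ (Fin p) →L[ℝ] EuclideanSpace ℝ (Fin p))) 0 → z' = z := by
  have h : Model.divergence (coordMap
      (0 : EuclideanSpace ℝ (Fin p) →L[ℝ] EuclideanSpace ℝ (Fin p))) 0 = 0 := by
    rw [divergence_coordMap_linear]
    simp
  refine ⟨1, one_pos, by rw [h]; ring, fun z' _ hz' => ?_⟩
  rw [h] at hz'
  have := (mul_eq_zero.1 hz').resolve_left hn.ne'
  linarith

namespace Model

open Filter Topology
open scoped RealInnerProductSpace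

variable {N p : ℕ} {M : Model N p} {k : Fin 2} {z : ℝ}

lemma inv_sqrtSigma_transpose (M : Model N p) : (M.sqrtSigma⁻¹)ᵀ = M.sqrtSigma⁻¹ := by
  rw [Matrix.transpose_nonsing_inv, sqrtSigma_transpose]

lemma fitPenalty_eq (M : Model N p) (k : Fin 2) (x : EuclideanSpace ℝ (Fin p)) :
    M.fitPenalty k x =
      penalty (M.method k) (M.n k) (M.lam k) (act M.sqrtSigma⁻¹ x).ofLp := rfl

lemma eventually_ofLp {P : (Fin p → ℝ) → Prop} (h : ∀ᶠ x in 𝓝 0, P x)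
    (A : EuclideanSpace ℝ (Fin p) →L[ℝ] EuclideanSpace ℝ (Fin p)) :
    ∀ᶠ y in 𝓝 0, P (A y).ofLp := by
  have hc : Continuous fun y => (A y).ofLp := (PiLp.continuous_ofLp 2 _).comp A.continuous
  have ht : Tendsto (fun y => (A y).ofLp) (𝓝 0) (𝓝 0) := by
    simpa using hc.tendsto 0
  exact ht.eventually h

/-- For small `y` the resolvent `L y` is small, so the local subgradient `κ x` at `x = Σ^{-1/2} L y`
certifies `L y` as the proximal point. -/
lemma fitMap_eventually_eq_resolvent (hS : M.Sigma.PosSemidef) (hu : IsUnit M.Sigma)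
    (hn : 0 < M.n k) (hl : 0 ≤ M.lam k) (hz : 0 < z) {κ : ℝ}
    (hκ : ∀ᶠ x : Fin p → ℝ in 𝓝 0, ∀ w, penalty (M.method k) (M.n k) (M.lam k) x +
      κ * (x ⬝ᵥ (w - x)) ≤ penalty (M.method k) (M.n k) (M.lam k) w)
    {L : EuclideanSpace ℝ (Fin p) →L[ℝ] EuclideanSpace ℝ (Fin p)}
    (hL : ∀ y, L y + (κ / z) • act M.sqrtSigma⁻¹ (act M.sqrtSigma⁻¹ (L y)) = y) :
    ∀ᶠ y in 𝓝 0, M.fitMap k z y = L y := by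
  filter_upwards [eventually_ofLp hκ ((act M.sqrtSigma⁻¹).comp L)] with y hy
  refine (isProx_fitMap hS hu hn hl z hz y).unique hz fun w => ?_
  have h1 : y - L y = (κ / z) • act M.sqrtSigma⁻¹ (act M.sqrtSigma⁻¹ (L y)) := by
    rw [sub_eq_iff_eq_add, add_comm]; exact (hL y).symm
  rw [h1, real_inner_smul_left, inner_act (inv_sqrtSigma_transpose M), ← mul_assoc,
    mul_div_cancel₀ _ hz.ne', map_sub, inner_eq_dotProduct]
  exact hy (act M.sqrtSigma⁻¹ w).ofLp

/-- Thresholding: for small `y` the vector `z Σ^{1/2} y` is a subgradient of the penalty at the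
origin. -/
lemma fitMap_eventually_eq_zero (hS : M.Sigma.PosSemidef) (hu : IsUnit M.Sigma)
    (hn : 0 < M.n k) (hl : 0 ≤ M.lam k) (hz : 0 < z)
    (hv : ∀ᶠ v : Fin p → ℝ in 𝓝 0, ∀ w, v ⬝ᵥ w ≤ penalty (M.method k) (M.n k) (M.lam k) w) :
    ∀ᶠ y in 𝓝 0, M.fitMap k z y = 0 := by
  filter_upwards [eventually_ofLp hv (z • act M.sqrtSigma)] with y hy
  refine (isProx_fitMap hS hu hn hl z hz y).unique hz fun w => ?_
  have h1 := hy (act M.sqrtSigma⁻¹ w).ofLp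
  rw [← inner_eq_dotProduct, ← fitPenalty_eq, smul_apply,
    real_inner_smul_left, inner_act (sqrtSigma_transpose M)] at h1
  have h2 : act M.sqrtSigma (act M.sqrtSigma⁻¹ w) = w := by
    simp only [act_apply, mulVec_inv_mulVec hS hu]
  rw [h2] at h1
  rwa [fitPenalty_zero hn, zero_add, sub_zero, sub_zero]

lemma marginalWellPosed (hS : M.Sigma.PosSemidef) (hu : IsUnit M.Sigma) (hSe : 0 ≤ M.Se k k)
    (hn : 0 < M.n k) (hl : 0 ≤ M.lam k) (hreg : p < M.n k ∨ 0 < M.lam k) :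
    MarginalWellPosed (M.fitMap k) (M.signal k) (M.n k) (M.Se k k) := by
  have hn' : (0 : ℝ) < M.n k := by exact_mod_cast hn
  rcases hl.eq_or_lt with h0 | h0
  · have hp : p < M.n k := hreg.resolve_right h0.not_lt
    exact marginalWellPosed_of_id (fun z hz y => fitMap_of_lam_zero hS hu hn h0.symm hz y)
      (by exact_mod_cast hp) hSe
  · have main : ∃ L : ℝ → EuclideanSpace ℝ (Fin p) →L[ℝ] EuclideanSpace ℝ (Fin p),
        (∀ z, 0 < z → ∀ᶠ y in 𝓝 0, M.fitMap k z y = L z y) ∧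
        ∃ z, 0 < z ∧ (M.n k : ℝ) * (1 - z) = divergence (coordMap (L z)) 0 ∧
          ∀ z', 0 < z' → (M.n k : ℝ) * (1 - z') = divergence (coordMap (L z')) 0 → z' = z := by
      -- Dimension zero is separate because the ridge factor `√(p/n)` vanishes there.
      rcases p.eq_zero_or_pos with rfl | hp
      · exact ⟨fun _ => 0, fun z _ => Eventually.of_forall fun y => Subsingleton.elim _ _,
          existsUnique_zero_df hn'⟩
      rcases penalty_local (M.method k) hp hn h0 with ⟨κ, hκ, hloc⟩ | hloc
      · have hT := inner_act (inv_sqrtSigma_transpose M)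
        have hex : ∀ z, ∃ L : EuclideanSpace ℝ (Fin p) →L[ℝ] EuclideanSpace ℝ (Fin p),
            0 < z → ∀ y, L y + (κ / z) • act M.sqrtSigma⁻¹ (act M.sqrtSigma⁻¹ (L y)) = y := by
          intro z
          by_cases hz : 0 < z
          · obtain ⟨L, hL⟩ := exists_linear_resolvent hT (c := κ / z) (by positivity)
            exact ⟨L, fun _ => hL⟩
          · exact ⟨0, fun h => absurd h hz⟩
        choose L hL using hex
        refine ⟨L, fun z hz => fitMap_eventually_eq_resolvent hS hu hn hl hz hloc (hL z hz),
          existsUnique_linear_df hT (fun x hx => ?_) hκ hn' hL⟩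
        have h1 : act M.sqrtSigma (act M.sqrtSigma⁻¹ x) = x := by
          simp only [act_apply, mulVec_inv_mulVec hS hu]
        rw [← h1, hx, map_zero]
      · exact ⟨fun _ => 0, fun z hz => fitMap_eventually_eq_zero hS hu hn hl hz hloc,
          existsUnique_zero_df hn'⟩
    obtain ⟨L, hL, hdf⟩ := main
    exact marginalWellPosed_of_pos (isProx_fitMap hS hu hn hl) (convexOn_fitPenalty hn hl)
      (fitPenalty_zero hn) (fitPenalty_pos hS hu hn h0) hn' hSe hL hdf

end Model


/-- The determinant form of the fact that a sum of two positive semidefinite `2 × 2` matrices is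
positive semidefinite. -/
lemma sq_add_le_of_sq_le {a b c e l m : ℝ} (ha : 0 ≤ a) (hb : 0 ≤ b) (hl : 0 ≤ l) (hm : 0 ≤ m)
    (he : e ^ 2 ≤ a * b) (hc : c ^ 2 ≤ m * l) : (e + c) ^ 2 ≤ (a + m) * (b + l) := by
  have h1 : (2 * (e * c)) ^ 2 ≤ (a * l + m * b) ^ 2 := by
    have h2 : e ^ 2 * c ^ 2 ≤ a * b * (m * l) := by gcongr
    nlinarith [sq_nonneg (a * l - m * b)]
  have h3 := abs_le_of_sq_le_sq' h1 (by positivity)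
  nlinarith

lemma posSemidef_fin_two {S : Matrix (Fin 2) (Fin 2) ℝ} (hS : S.PosSemidef) :
    0 ≤ S 0 0 ∧ 0 ≤ S 1 1 ∧ S 1 0 = S 0 1 ∧ S 0 1 ^ 2 ≤ S 0 0 * S 1 1 := by
  have h1 : S 1 0 = S 0 1 := by simpa using congrFun (congrFun hS.isHermitian 0) 1
  refine ⟨hS.diag_nonneg, hS.diag_nonneg, h1, ?_⟩
  have := hS.det_nonneg
  rw [Matrix.det_fin_two, h1] at this
  linarith

lemma covMatrix_sqrt {S : Matrix (Fin 2) (Fin 2) ℝ} (hS : S.PosSemidef) :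
    covMatrix √(S 0 0) √(S 1 1) (S 0 1) = S ∧ |S 0 1| ≤ √(S 0 0) * √(S 1 1) := by
  obtain ⟨h0, h1, hs, hd⟩ := posSemidef_fin_two hS
  refine ⟨?_, ?_⟩
  · ext i j
    fin_cases i <;> fin_cases j <;> simp [covMatrix, Real.sq_sqrt, h0, h1, hs]
  · rw [← Real.sqrt_mul h0]
    exact Real.abs_le_sqrt hd

/-! ### Decoupling and assembly of the solution -/

namespace Model

open Filter Topology
open scoped RealInnerProductSpace

variable {N p : ℕ} {M : Model N p}

/-- The prediction error of the `k`-th regression as a function of the noise. -/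
noncomputable def predError (M : Model N p) (k : Fin 2) (z : ℝ) (v : EuclideanSpace ℝ (Fin p)) :
    EuclideanSpace ℝ (Fin p) := M.fitMap k z (M.signal k + v) - M.signal k

lemma errorGram_eq (hS : M.Sigma.PosSemidef) (ζ : Fin 2 → ℝ)
    (g : EuclideanSpace ℝ (Fin 2 × Fin p)) (a b : Fin 2) : M.errorGram ζ g a b =
      ⟪M.predError a (ζ a) (block a g), M.predError b (ζ b) (block b g)⟫ := by
  set D := M.ThetaHat ζ g - M.Theta with hD
  have h1 : ∀ k, (M.predError k (ζ k) (block k g)).ofLp = M.sqrtSigma *ᵥ fun j => D j k := by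
    intro k
    have h2 : (fun j => D j k) = M.eta k (ζ k) (M.obs k g) - fun j => M.Theta j k := rfl
    rw [h2, Matrix.mulVec_sub, obs_eq]
    rfl
  have h3 : M.errorGram ζ g a b = (fun j => D j a) ⬝ᵥ M.Sigma *ᵥ fun j => D j b := by
    rw [errorGram, Matrix.mul_assoc]
    rfl
  rw [inner_eq_dotProduct, h1, h1, h3, ← sqrtSigma_mul_self hS, ← Matrix.mulVec_mulVec,
    Matrix.dotProduct_mulVec, ← Matrix.mulVec_transpose, sqrtSigma_transpose]

section Regular

variable {k : Fin 2} {z : ℝ} {S : Matrix (Fin 2) (Fin 2) ℝ} {ζ : Fin 2 → ℝ}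

lemma firm_predError (hS : M.Sigma.PosSemidef) (hu : IsUnit M.Sigma) (hn : 0 < M.n k)
    (hl : 0 ≤ M.lam k) (hz : 0 < z) : Firm (M.predError k z) := fun v w => by
  have hF := isProx_fitMap hS hu hn hl z hz
  have := (hF (M.signal k + v)).firm hz (hF (M.signal k + w))
  simpa [predError, real_inner_comm] using this

lemma memLp_predError (hf : Firm (M.predError k z)) :
    MemLp (fun g => M.predError k z (block k g)) 2 (noiseLaw p S) := by
  have h : MemLp (fun g => g) 2 (noiseLaw p S) := by
    unfold noiseLaw
    exact IsGaussian.memLp_two_id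
  exact memLp_two_of_lipschitz h (hf.lipschitz.comp (block k).lipschitz)

lemma integral_norm_predError (hf : Firm (M.predError k z)) (hS' : S.PosSemidef) :
    ∫ g, ‖M.predError k z (block k g)‖ ^ 2 ∂noiseLaw p S =
      mse (M.fitMap k) (M.signal k) √(S k k) z :=
  integral_block_noiseLaw hS' k (φ := fun v => ‖M.predError k z v‖ ^ 2)
    (by have := hf.lipschitz.continuous; fun_prop)

lemma R_diag (hS : M.Sigma.PosSemidef) (hf : Firm (M.predError k (ζ k))) (hS' : S.PosSemidef) :
    M.R S ζ k k = mse (M.fitMap k) (M.signal k) √(S k k) (ζ k) := by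
  simp only [R, Matrix.of_apply, errorGram_eq hS, real_inner_self_eq_norm_sq]
  exact integral_norm_predError hf hS'

lemma R_zero_one (hS : M.Sigma.PosSemidef) :
    M.R S ζ 0 1 = cross (M.predError 0 (ζ 0)) (M.predError 1 (ζ 1)) S := by
  simp only [R, Matrix.of_apply, errorGram_eq hS]
  rfl

lemma R_one_zero (hS : M.Sigma.PosSemidef) : M.R S ζ 1 0 = M.R S ζ 0 1 := by
  simp only [R, Matrix.of_apply, errorGram_eq hS]
  simp_rw [real_inner_comm]

lemma df_eq (hS' : S.PosSemidef) :
    M.df S ζ k = marginalDf (M.fitMap k) (M.signal k) √(S k k) (ζ k) := by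
  simp only [df, obs_eq]
  refine integral_block_noiseLaw hS' k
    (φ := fun v => divergence (M.fit k (ζ k)) (M.signal k + v).ofLp) ?_
  exact (measurable_divergence _).comp (by fun_prop)

lemma selfCorr_predError (τ : ℝ) :
    selfCorr (M.predError k z) τ = τ * corr (M.fitMap k) (M.signal k) τ z := by
  simp only [selfCorr, corr, ← integral_const_mul, real_inner_smul_right]
  simp_rw [real_inner_comm]
  rfl

/-- The fixed-point equations decouple into those of each regression and an equation for the
covariance. -/
lemma isFixedPoint_iff (hS : M.Sigma.PosSemidef) (hu : IsUnit M.Sigma) (hSe : M.Se.PosSemidef)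
    (hn : ∀ k, 0 < M.n k) (hl : ∀ k, 0 ≤ M.lam k) :
    M.IsFixedPoint S ζ ↔ S.PosSemidef ∧
      (∀ k, MarginalFixedPoint (M.fitMap k) (M.signal k) (M.n k) (M.Se k k) √(S k k) (ζ k)) ∧
      S 0 1 = (M.n12 : ℝ) / ((M.n 0 : ℝ) * (M.n 1 : ℝ)) *
        (M.Se 0 1 + cross (M.predError 0 (ζ 0)) (M.predError 1 (ζ 1)) S) := by
  have hn' : ∀ k, (0 : ℝ) < M.n k := fun k => by exact_mod_cast hn k
  have hNd : ∀ k, M.Nminus k k = 1 / (M.n k : ℝ) := fun k => by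
    fin_cases k <;> simp [Nminus]
  have key : S.PosSemidef → (∀ k, 0 < ζ k) → ∀ k,
      S k k = (M.Nminus ⊙ (M.Se + M.R S ζ)) k k ↔
        (M.n k : ℝ) * √(S k k) ^ 2 = M.Se k k + mse (M.fitMap k) (M.signal k) √(S k k) (ζ k) := by
    intro hS' hζ k
    rw [Matrix.hadamard_apply, Matrix.add_apply, hNd,
      R_diag hS (firm_predError hS hu (hn k) (hl k) (hζ k)) hS', Real.sq_sqrt hS'.diag_nonneg,
      one_div, inv_mul_eq_div, eq_div_iff (hn' k).ne', mul_comm]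
  have key' : S.PosSemidef → ∀ k, ζ k = 1 - M.df S ζ k / (M.n k : ℝ) ↔
      (M.n k : ℝ) * (1 - ζ k) = marginalDf (M.fitMap k) (M.signal k) √(S k k) (ζ k) := by
    intro hS' k
    rw [df_eq hS', eq_sub_iff_add_eq, ← eq_sub_iff_add_eq', div_eq_iff (hn' k).ne', mul_comm,
      eq_comm]
  have h01 : (M.Nminus ⊙ (M.Se + M.R S ζ)) 0 1 = (M.n12 : ℝ) / ((M.n 0 : ℝ) * (M.n 1 : ℝ)) *
        (M.Se 0 1 + cross (M.predError 0 (ζ 0)) (M.predError 1 (ζ 1)) S) := by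
    rw [Matrix.hadamard_apply, Matrix.add_apply, R_zero_one hS]
    simp [Nminus]
  have h10 : (M.Nminus ⊙ (M.Se + M.R S ζ)) 1 0 = (M.Nminus ⊙ (M.Se + M.R S ζ)) 0 1 := by
    rw [Matrix.hadamard_apply, Matrix.hadamard_apply, Matrix.add_apply, Matrix.add_apply,
      R_one_zero hS, (posSemidef_fin_two hSe).2.2.1]
    simp [Nminus]
  constructor
  · rintro ⟨hS', hζ, h1, h2⟩
    refine ⟨hS', fun k => ⟨Real.sqrt_nonneg _, hζ k, ?_, (key' hS' k).1 (h2 k)⟩, ?_⟩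
    · exact (key hS' hζ k).1 (congrFun (congrFun h1 k) k)
    · rw [← h01, ← h1]
  · rintro ⟨hS', hm, hc⟩
    have hζ : ∀ k, 0 < ζ k := fun k => (hm k).pos
    refine ⟨hS', hζ, ?_, fun k => (key' hS' k).2 (hm k).eq_df⟩
    have hd := fun k => (key hS' hζ k).2 (hm k).eq_mse
    ext i j
    fin_cases i <;> fin_cases j
    · exact hd 0
    · exact hc.trans h01.symm
    · exact (posSemidef_fin_two hS').2.2.1.trans (hc.trans (h01.symm.trans h10.symm))
    · exact hd 1

lemma isWellDefinedAt_of_ae (hS : M.Sigma.PosSemidef) (hu : IsUnit M.Sigma)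
    (hn : ∀ k, 0 < M.n k) (hl : ∀ k, 0 ≤ M.lam k) (hS' : S.PosSemidef) (hζ : ∀ k, 0 < ζ k)
    (hd : ∀ k, ∀ᵐ g ∂stdGaussian (EuclideanSpace ℝ (Fin p)),
      DifferentiableAt ℝ (coordMap (M.fitMap k (ζ k)))
        ((M.signal k).ofLp + √(S k k) • g.ofLp)) : M.IsWellDefinedAt S ζ := by
  have hf := fun k => firm_predError hS hu (hn k) (hl k) (hζ k)
  refine ⟨fun k y => existsUnique_isMinOn hS hu (hn k) (hl k) (hζ k) y, fun a b => ?_,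
    fun k => ?_, fun k => ?_⟩
  · simp only [errorGram_eq hS]
    exact integrable_inner_of_memLp (memLp_predError (hf a)) (memLp_predError (hf b))
  · simp only [obs_eq]
    refine ae_block_noiseLaw hS' k
      (P := fun v => DifferentiableAt ℝ (M.fit k (ζ k)) (M.signal k + v).ofLp) ?_ (hd k)
    exact (measurableSet_of_differentiableAt ℝ (M.fit k (ζ k))).preimage (by fun_prop)
  · obtain ⟨K, hK⟩ := lipschitz_coordMap ((isProx_fitMap hS hu (hn k) (hl k)).lipschitz (hζ k))
    refine integrable_divergence_comp hK (Y := M.obs k) ?_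
    rw [show M.obs k = fun g => (M.signal k + block k g).ofLp from funext (M.obs_eq k)]
    fun_prop

/-- The overlap is at most each sample size; the bound is `n₁₂² ≤ n₁n₂`. -/
lemma sq_overlap_le (hn : ∀ k, 0 < M.n k) :
    ((M.n12 : ℝ) / ((M.n 0 : ℝ) * (M.n 1 : ℝ))) ^ 2 * ((M.n 0 : ℝ) * (M.n 1 : ℝ)) ≤ 1 := by
  have h0 : (0 : ℝ) < M.n 0 := by exact_mod_cast hn 0
  have h1 : (0 : ℝ) < M.n 1 := by exact_mod_cast hn 1
  have h2 : (M.n12 : ℝ) ≤ M.n 0 := by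
    exact_mod_cast Finset.card_le_card Finset.inter_subset_left
  have h3 : (M.n12 : ℝ) ≤ M.n 1 := by
    exact_mod_cast Finset.card_le_card Finset.inter_subset_right
  have e : ((M.n12 : ℝ) / ((M.n 0 : ℝ) * (M.n 1 : ℝ))) ^ 2 * ((M.n 0 : ℝ) * (M.n 1 : ℝ)) =
      (M.n12 * M.n12 : ℝ) / ((M.n 0 : ℝ) * (M.n 1 : ℝ)) := by
    field_simp
  rw [e, div_le_one (by positivity)]
  gcongr

theorem existsUnique_fixedPoint (hS : M.Sigma.PosSemidef) (hu : IsUnit M.Sigma)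
    (hSe : M.Se.PosSemidef) (hn : ∀ k, 0 < M.n k) (hl : ∀ k, 0 ≤ M.lam k)
    (hreg : ∀ k, p < M.n k ∨ 0 < M.lam k) :
    ∃ (S : Matrix (Fin 2) (Fin 2) ℝ) (ζ : Fin 2 → ℝ),
      M.IsFixedPoint S ζ ∧ M.IsWellDefinedAt S ζ ∧
      ∀ (S' : Matrix (Fin 2) (Fin 2) ℝ) (ζ' : Fin 2 → ℝ),
        M.IsFixedPoint S' ζ' → S' = S ∧ ζ' = ζ := by
  have hn' : ∀ k, (0 : ℝ) < M.n k := fun k => by exact_mod_cast hn k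
  choose τ ζ hfp hdiff huniq using fun k =>
    marginalWellPosed hS hu hSe.diag_nonneg (hn k) (hl k) (hreg k)
  have hτ := fun k => (hfp k).nonneg
  have hζ := fun k => (hfp k).pos
  have hf := fun k => firm_predError hS hu (hn k) (hl k) (hζ k)
  have hdiag0 : ∀ ρ, √(covMatrix (τ 0) (τ 1) ρ 0 0) = τ 0 := fun ρ => by
    simp [covMatrix, Real.sqrt_sq (hτ 0)]
  have hdiag1 : ∀ ρ, √(covMatrix (τ 0) (τ 1) ρ 1 1) = τ 1 := fun ρ => by
    simp [covMatrix, Real.sqrt_sq (hτ 1)]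
  have hdiag : ∀ ρ k, √(covMatrix (τ 0) (τ 1) ρ k k) = τ k := fun ρ k => by
    fin_cases k
    exacts [hdiag0 ρ, hdiag1 ρ]
  set ν : ℝ := (M.n12 : ℝ) / ((M.n 0 : ℝ) * (M.n 1 : ℝ)) with hν
  have hνn : ν ^ 2 * ((M.n 0 : ℝ) * (M.n 1 : ℝ)) ≤ 1 := sq_overlap_le hn
  have hself : ∀ k, selfCorr (M.predError k (ζ k)) (τ k) = M.n k * τ k ^ 2 * (1 - ζ k) :=
    fun k => by
      rw [selfCorr_predError, ← ((hfp k).marginalSol (isProx_fitMap hS hu (hn k) (hl k))).eq_corr]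
      ring
  obtain ⟨-, -, -, hSe2⟩ := posSemidef_fin_two hSe
  -- Cauchy-Schwarz for the errors and for `Se`, then the marginal equations: the numerator is at
  -- most `√(n₁n₂) τ₁τ₂`, and `ν √(n₁n₂) ≤ 1`.
  have hbound : ∀ ρ, |ρ| ≤ τ 0 * τ 1 → |ν * (M.Se 0 1 +
      cross (M.predError 0 (ζ 0)) (M.predError 1 (ζ 1)) (covMatrix (τ 0) (τ 1) ρ))| ≤
        τ 0 * τ 1 := by
    intro ρ hρ
    have hpsd := covMatrix_posSemidef hρ
    refine abs_le_of_sq_le_sq ?_ (mul_nonneg (hτ 0) (hτ 1))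
    have hc : cross (M.predError 0 (ζ 0)) (M.predError 1 (ζ 1)) (covMatrix (τ 0) (τ 1) ρ) ^ 2 ≤ _ :=
      sq_integral_inner_le (memLp_predError (hf 0)) (memLp_predError (hf 1))
    rw [integral_norm_predError (hf 0) hpsd, integral_norm_predError (hf 1) hpsd, hdiag,
      hdiag] at hc
    have h1 := sq_add_le_of_sq_le hSe.diag_nonneg hSe.diag_nonneg (mse_nonneg _ _ _ _)
      (mse_nonneg _ _ _ _) hSe2 hc
    rw [← (hfp 0).eq_mse, ← (hfp 1).eq_mse] at h1
    rw [mul_pow]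
    calc _ ≤ ν ^ 2 * (M.n 0 * τ 0 ^ 2 * (M.n 1 * τ 1 ^ 2)) := by gcongr
      _ = (ν ^ 2 * ((M.n 0 : ℝ) * (M.n 1 : ℝ))) * (τ 0 * τ 1) ^ 2 := by ring
      _ ≤ 1 * (τ 0 * τ 1) ^ 2 := by gcongr
      _ = _ := one_mul _
  have hcontr : 0 < τ 0 → 0 < τ 1 → ν ^ 2 * (selfCorr (M.predError 0 (ζ 0)) (τ 0) *
      selfCorr (M.predError 1 (ζ 1)) (τ 1)) < (τ 0 * τ 1) ^ 2 := by
    intro h0 h1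
    -- Nonnegative self-correlation gives `ζ_k ≤ 1`. Together with `ζ_k > 0` this makes the squared
    -- contraction factor `(1 - ζ₁)(1 - ζ₂)` less than one.
    have hz : ∀ k, 0 < τ k → 0 ≤ 1 - ζ k := fun k hk => by
      have := selfCorr_nonneg (hf k) (τ k)
      rw [hself] at this
      have hpos : 0 < (M.n k : ℝ) * τ k ^ 2 := mul_pos (hn' k) (by positivity)
      exact nonneg_of_mul_nonneg_right this hpos
    have hz0 := hz 0 h0
    have hz1 := hz 1 h1
    have hlt : (1 - ζ 0) * (1 - ζ 1) < 1 := by nlinarith [hζ 0, hζ 1]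
    rw [hself, hself]
    calc _ = (ν ^ 2 * ((M.n 0 : ℝ) * (M.n 1 : ℝ))) *
          ((τ 0 * τ 1) ^ 2 * ((1 - ζ 0) * (1 - ζ 1))) := by ring
      _ ≤ 1 * ((τ 0 * τ 1) ^ 2 * ((1 - ζ 0) * (1 - ζ 1))) := by gcongr
      _ < _ := by
        rw [one_mul]
        exact mul_lt_of_lt_one_right (by positivity) hlt
  obtain ⟨ρ, hρ, hρeq, hρu⟩ := existsUnique_covariance (hf 0) (hf 1) (hτ 0) (hτ 1) hbound hcontr
  have hpsd := covMatrix_posSemidef hρ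
  refine ⟨covMatrix (τ 0) (τ 1) ρ, ζ, ?_, ?_, fun S' ζ' h => ?_⟩
  · rw [isFixedPoint_iff hS hu hSe hn hl]
    exact ⟨hpsd, fun k => by rw [hdiag]; exact hfp k, hρeq⟩
  · exact isWellDefinedAt_of_ae hS hu hn hl hpsd hζ fun k => by rw [hdiag]; exact hdiff k
  · rw [isFixedPoint_iff hS hu hSe hn hl] at h
    obtain ⟨hS', hm, hc⟩ := h
    -- Marginal uniqueness fixes `ζ'` and the diagonal of `S'`; only the off-diagonal entry remains,
    -- and it solves the covariance equation.
    have hζ' : ζ' = ζ := funext fun k => (huniq k _ _ (hm k)).2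
    have hτ' := fun k => (huniq k _ _ (hm k)).1
    obtain ⟨hcov, habs⟩ := covMatrix_sqrt hS'
    rw [hτ', hτ'] at hcov habs
    refine ⟨?_, hζ'⟩
    rw [← hcov, hρu _ habs ?_]
    rw [hcov, ← hζ']
    exact hc

end Regular

end Model

end SimReg

theorem mainTheorem6 {N p : ℕ} (M : SimReg.Model N p)
    (hSigma : M.Sigma.PosSemidef) (hSigma_inv : IsUnit M.Sigma)
    (hSe : M.Se.PosSemidef)
    (hI : ∀ k, (M.I k).Nonempty)
    (hlam : ∀ k, 0 ≤ M.lam k)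
    (hreg : ∀ k, p < M.n k ∨ 0 < M.lam k) :
    ∃ (S : Matrix (Fin 2) (Fin 2) ℝ) (ζ : Fin 2 → ℝ),
      M.IsFixedPoint S ζ ∧ M.IsWellDefinedAt S ζ ∧
      ∀ (S' : Matrix (Fin 2) (Fin 2) ℝ) (ζ' : Fin 2 → ℝ),
        M.IsFixedPoint S' ζ' → S' = S ∧ ζ' = ζ :=
  SimReg.Model.existsUnique_fixedPoint hSigma hSigma_inv hSe (fun k => (hI k).card_pos) hlam hreg
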